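/- **Theorem (stability of transition through a vertex).** Let $G$ be a finite metric tree with vertices $v_1,\dots,v_{m+1}$ and edges $e_1,\dots,e_m$; the edge $e_j$ has length $T_j>0$, is parametrized by $x_j\in[0,T_j]$, and goes from $v_j$ ($x_j=0$) to its parent $v_{p(j)}$ ($x_j=T_j$), where $j<p(j)\le m+1$. The root $v_{m+1}$ has the single incoming edge $e_m$. Vertices of degree $1$ are called boundary vertices, all other vertices internal. For a complex-valued potential $\sigma=\{\sigma_j\}_{j=1}^m$, $\sigma_j\in L_2(0,T_j)$, consider on each edge the equation $$-(y_j^{[1]})'-\sigma_j y_j^{[1]}-\sigma_j^2y_j=\lambda y_j\ \text{ on } (0,T_j),\qquad y_j^{[1]}:=y_j'-\sigma_jy_j,\qquad y_j,y_j^{[1]}\in AC[0,T_j],$$ and its solutions $S_j,\varphi_j$ with $S_j(0,\lambda)=\varphi_j^{[1]}(0,\lambda)=0$, $S_j^{[1]}(0,\lambda)=\varphi_j(0,\lambda)=1$. Given a tree $H$ (a subtree of $G$) and a condition $y(v)=0$ (Dirichlet) or $y^{[1]}(v)=0$ (Neumann) at each of its boundary vertices $v$, the characteristic function of the corresponding boundary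 value problem on $H$, with continuity and Kirchhoff's condition at the internal vertices, is defined recursively. If $H$ is a single edge $e_j$, it equals $S_j(T_j,\lambda)$, $S_j^{[1]}(T_j,\lambda)$, $\varphi_j(T_j,\lambda)$, $\varphi_j^{[1]}(T_j,\lambda)$ for the conditions (Dirichlet, Dirichlet), (Dirichlet, Neumann), (Neumann, Dirichlet), (Neumann, Neumann) at ($x_j=0$, $x_j=T_j$), respectively. Otherwise split $H$ by an internal vertex $u$ of degree $r$ into $r$ subtrees, let $\Delta_i^D,\Delta_i^N$ be the characteristic functions of the $i$-th subtree with the Dirichlet, respectively Neumann, condition at $u$ and the given conditions at its other boundary vertices, and put $\Delta=\sum_{i=1}^r\Delta_i^N\prod_{l\ne i}\Delta_l^D$ (the result does not depend on the choice of $u$). Let $v_k$ be a boundary vertex other than the root whose parent $v_p$, $p=p(k)$, is not the root. Let $g_p$ be the directed subtree of $G$ with the root $v_p$ (all edges $e_j$ such that $v_p$ is a proper ancestor of $v_j$), let $G_p$ be the tree formed by the remaining edges, and let $b$ and $B_p$ be the numbers of the boundary vertices of $G$ and of $G_p$. Denote by $\Delta$ and $\Delta_k$ the characteristic functions on $G$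 with the Dirichlet conditions at all the boundary vertices and, respectively, with the Neumann condition at $v_k$ and the Dirichlet conditions at the other boundary vertices; denote by $\Delta_p^D$ and $\Delta_p^N$ the characteristic functions on $G_p$ with the Dirichlet, respectively Neumann, condition at $v_p$ and the Dirichlet conditions at the other boundary vertices. For another potential $\tilde\sigma$ let $\tilde\Delta,\dots$ be the analogous objects, and let $\hat\sigma=\sigma-\tilde\sigma$, $\hat\Delta=\Delta-\tilde\Delta$, and so on. Put $$\delta_k:=\|\rho^{b-1}\hat\Delta(\rho^2)\|_{L_2(\mathbb R)}+\|\rho^{b-2}\hat\Delta_k(\rho^2)\|_{L_2(\mathbb R)},\qquad \|\sigma\|_{L_2(g)}^2:=\sum_{e_j\in g}\|\sigma_j\|^2_{L_2(0,T_j)}.$$ Then for every $\Omega>0$ there is a constant $C$, depending only on $\Omega$ and $k$ (and on the metric tree $G$), such that for all $\sigma,\tilde\sigma$ with $\|\sigma\|_{L_2(G)}\le\Omega$ and $\|\tilde\sigma\|_{L_2(G)}\le\Omega$ the functions $\rho^{b-1}\hat\Delta(\rho^2)$, $\rho^{b-2}\hat\Delta_k(\rho^2)$, $\rho^{B_p-1}\hat\Delta_p^D(\rho^2)$,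 $\rho^{B_p-2}\hat\Delta_p^N(\rho^2)$ belong to $L_2(\mathbb R)$ and $$\|\rho^{B_p-1}\hat\Delta_p^D(\rho^2)\|_{L_2(\mathbb R)}+\|\rho^{B_p-2}\hat\Delta_p^N(\rho^2)\|_{L_2(\mathbb R)}\le C\bigl(\|\hat\sigma\|_{L_2(g_p)}+\delta_k\bigr).$$ -/

import Mathlib

open MeasureTheory Set
open scoped NNReal ENNReal

/-! ### Metric trees -/

/-- A rooted metric tree with vertices `v_0, …, v_m` (type `Fin (m + 1)`) and edges `e_0, …, e_{m-1}`
(type `Fin m`). The edge `e_j` goes from the vertex `v_j` (`j.castSucc`) to its parent `parent j`,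
whose index is larger; `v_m` (`Fin.last m`) is the root, and the last edge is the only edge
coming into it. The edge `e_j` has length `len j > 0` and is parametrized by `[0, len j]`, where `0`
corresponds to `v_j` and `len j` to the parent of `v_j`. -/
structure MetricTree (m : ℕ) where
  parent : Fin m → Fin (m + 1)
  lt_parent : ∀ j, j.castSucc < parent j
  root_edge : ∀ j, parent j = Fin.last m → (j : ℕ) + 1 = m
  len : Fin m → ℝ
  len_pos : ∀ j, 0 < len j

/-- Types of boundary conditions: `y(v) = 0` or `y^{[1]}(v) = 0`. -/
inductive BoundaryCond where
  | dirichlet : BoundaryCond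
  | neumann : BoundaryCond

/-! ### The Sturm-Liouville equation on an interval -/

/-- `y` is a solution on `[0, T]` of `-(y^{[1]})' - s y^{[1]} - s² y = lam y` and `y1` is its
quasi-derivative `y^{[1]} = y' - s y`: both are absolutely continuous on `[0, T]`, and the relations
`y' = y1 + s y`, `y1' = -s y1 - s² y - lam y` hold almost everywhere on `(0, T)`. -/
structure IsSLSolution (T : ℝ) (s : ℝ → ℂ) (lam : ℂ) (y y1 : ℝ → ℂ) : Prop where
  ac : AbsolutelyContinuousOnInterval y 0 T
  ac_quasi : AbsolutelyContinuousOnInterval y1 0 T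
  quasi_deriv : ∀ᵐ x ∂(volume.restrict (Ioo 0 T)), HasDerivAt y (y1 x + s x * y x) x
  equation : ∀ᵐ x ∂(volume.restrict (Ioo 0 T)),
    HasDerivAt y1 (-(s x * y1 x) - s x ^ 2 * y x - lam * y x) x

/-- The pair `(y, y^{[1]})` for the solution `y` with `y(0) = a`, `y^{[1]}(0) = b` (it exists and its
values on `[0, T]` are unique when `s` is square-integrable on `(0, T)`). -/
noncomputable def slSolution (T : ℝ) (s : ℝ → ℂ) (lam a b : ℂ) : (ℝ → ℂ) × (ℝ → ℂ) :=
  Classical.epsilon fun Y : (ℝ → ℂ) × (ℝ → ℂ) =>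
    IsSLSolution T s lam Y.1 Y.2 ∧ Y.1 0 = a ∧ Y.2 0 = b

/-- The characteristic function of a single edge of length `T` with the potential `s`, for given
conditions at the endpoints `x = 0` and `x = T`. With the solutions `S` (`S(0) = 0`, `S^{[1]}(0) = 1`)
and `φ` (`φ(0) = 1`, `φ^{[1]}(0) = 0`) these are `S(T)`, `S^{[1]}(T)`, `φ(T)`, `φ^{[1]}(T)`. -/
noncomputable def edgeCharFun (T : ℝ) (s : ℝ → ℂ) : BoundaryCond → BoundaryCond → ℂ → ℂ
  | .dirichlet, .dirichlet => fun lam => (slSolution T s lam 0 1).1 T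
  | .dirichlet, .neumann => fun lam => (slSolution T s lam 0 1).2 T
  | .neumann, .dirichlet => fun lam => (slSolution T s lam 1 0).1 T
  | .neumann, .neumann => fun lam => (slSolution T s lam 1 0).2 T

namespace MetricTree

variable {m : ℕ} (G : MetricTree m)

/-! ### Subtrees, described by their sets of edges -/

/-- The edges in `F` incident to the vertex `v`. -/
def edgesAt (F : Finset (Fin m)) (v : Fin (m + 1)) : Finset (Fin m) :=
  F.filter fun e => e.castSucc = v ∨ G.parent e = v

/-- The degree of the vertex `v` in the subgraph with edge set `F`. -/
def degree (F : Finset (Fin m)) (v : Fin (m + 1)) : ℕ := (G.edgesAt F v).card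

/-- The boundary vertices (vertices of degree `1`) of the subgraph with edge set `F`. -/
def boundary (F : Finset (Fin m)) : Finset (Fin (m + 1)) :=
  Finset.univ.filter fun v => G.degree F v = 1

open Classical in
/-- Splitting `F` by the vertex `u`: the part containing the edge `e`, that is, the edges of `F`
that are connected to `e` inside `F` without passing through `u`. -/
noncomputable def branch (F : Finset (Fin m)) (u : Fin (m + 1)) (e : Fin m) : Finset (Fin m) :=
  F.filter fun f => Relation.ReflTransGen
    (fun a b : Fin m => b ∈ F ∧ ∃ v, v ≠ u ∧ a ∈ G.edgesAt F v ∧ b ∈ G.edgesAt F v) e f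

open Classical in
/-- The edges of the directed subtree `g_p` with the root `v_p`: all edges `e_j` such that `v_p` can
be reached from `v_j` by passing (at least once) to the parent. -/
noncomputable def below (p : Fin (m + 1)) : Finset (Fin m) :=
  Finset.univ.filter fun j => Relation.TransGen
    (fun a b : Fin (m + 1) => ∃ i : Fin m, a = i.castSucc ∧ b = G.parent i) j.castSucc p

/-- The edges of the directed subtree `G_p` obtained by excluding `g_p`. -/
noncomputable def above (p : Fin (m + 1)) : Finset (Fin m) := (G.below p)ᶜ

/-! ### Characteristic functions -/

/-- `G.IsCharFun σ F bc Δ`: the function `Δ` is obtained by the recursive construction of the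
characteristic function of the Sturm-Liouville problem with the potential `σ` on the subtree with edge
set `F`, with the conditions `bc` at its boundary vertices (the values of `bc` elsewhere play no
role) and the matching conditions at its internal vertices: a single edge is the base case, and a
larger tree is split by an internal vertex `u` into the branches at `u`. -/
inductive IsCharFun (σ : Fin m → ℝ → ℂ) :
    Finset (Fin m) → (Fin (m + 1) → BoundaryCond) → (ℂ → ℂ) → Prop
  | single (e : Fin m) (bc : Fin (m + 1) → BoundaryCond) :
      IsCharFun σ {e} bc (edgeCharFun (G.len e) (σ e) (bc e.castSucc) (bc (G.parent e)))
  | split (F : Finset (Fin m)) (bc : Fin (m + 1) → BoundaryCond) (u : Fin (m + 1))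
      (hu : 2 ≤ G.degree F u) (ΔD ΔN : Fin m → ℂ → ℂ)
      (hD : ∀ e ∈ G.edgesAt F u,
        IsCharFun σ (G.branch F u e) (Function.update bc u .dirichlet) (ΔD e))
      (hN : ∀ e ∈ G.edgesAt F u,
        IsCharFun σ (G.branch F u e) (Function.update bc u .neumann) (ΔN e)) :
      IsCharFun σ F bc fun lam =>
        ∑ e ∈ G.edgesAt F u, ΔN e lam * ∏ e' ∈ (G.edgesAt F u).erase e, ΔD e' lam

/-- The characteristic function on the subtree with edge set `F` (the construction does not depend
on the vertices chosen for the splittings). -/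
noncomputable def charFun (σ : Fin m → ℝ → ℂ) (F : Finset (Fin m))
    (bc : Fin (m + 1) → BoundaryCond) : ℂ → ℂ :=
  Classical.epsilon (G.IsCharFun σ F bc)

/-- Dirichlet conditions at all boundary vertices. -/
def allDirichlet : Fin (m + 1) → BoundaryCond := fun _ => .dirichlet

/-- The Neumann condition at `v`, Dirichlet conditions at all the other boundary vertices. -/
def neumannAt (v : Fin (m + 1)) : Fin (m + 1) → BoundaryCond :=
  Function.update allDirichlet v .neumann

/-- `Δ`: the whole tree, Dirichlet conditions. -/
noncomputable def Delta (σ : Fin m → ℝ → ℂ) : ℂ → ℂ :=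
  G.charFun σ Finset.univ allDirichlet

/-- `Δ_k`: the whole tree, Neumann condition at `v_k`, Dirichlet conditions elsewhere. -/
noncomputable def DeltaNeumann (k : Fin (m + 1)) (σ : Fin m → ℝ → ℂ) : ℂ → ℂ :=
  G.charFun σ Finset.univ (neumannAt k)

/-- `Δ_p^D`: the subtree `G_p`, Dirichlet conditions. -/
noncomputable def DeltaAboveD (p : Fin (m + 1)) (σ : Fin m → ℝ → ℂ) : ℂ → ℂ :=
  G.charFun σ (G.above p) allDirichlet

/-- `Δ_p^N`: the subtree `G_p`, Neumann condition at `v_p`, Dirichlet conditions elsewhere. -/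
noncomputable def DeltaAboveN (p : Fin (m + 1)) (σ : Fin m → ℝ → ℂ) : ℂ → ℂ :=
  G.charFun σ (G.above p) (neumannAt p)

/-! ### Norms -/

/-- The norm in `L₂` of the subtree with edge set `F`. -/
noncomputable def l2Norm (F : Finset (Fin m)) (σ : Fin m → ℝ → ℂ) : ℝ≥0∞ :=
  (∑ j ∈ F, eLpNorm (σ j) 2 (volume.restrict (Ioo 0 (G.len j))) ^ 2) ^ (1 / 2 : ℝ)

/-- The ball of radius `Ω` in `L₂(G)`. -/
def InBall (Ω : ℝ) (σ : Fin m → ℝ → ℂ) : Prop :=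
  (∀ j, MemLp (σ j) 2 (volume.restrict (Ioo 0 (G.len j)))) ∧
    G.l2Norm Finset.univ σ ≤ ENNReal.ofReal Ω

end MetricTree

/-- The function `ρ ↦ ρⁿ f(ρ²)` on the real line. -/
noncomputable def rhoFun (n : ℤ) (f : ℂ → ℂ) : ℝ → ℂ := fun ρ => (ρ : ℂ) ^ n * f ((ρ : ℂ) ^ 2)

namespace MetricTree

variable {m : ℕ} (G : MetricTree m)

/-- `ρ^{b-1} (Δ - Δ')(ρ²)`, where `b` is the number of the boundary vertices of the tree. -/
noncomputable def diffDelta (σ σ' : Fin m → ℝ → ℂ) : ℝ → ℂ :=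
  rhoFun (((G.boundary Finset.univ).card : ℤ) - 1) fun lam => G.Delta σ lam - G.Delta σ' lam

/-- `ρ^{b-2} (Δ_k - Δ_k')(ρ²)`. -/
noncomputable def diffDeltaNeumann (k : Fin (m + 1)) (σ σ' : Fin m → ℝ → ℂ) : ℝ → ℂ :=
  rhoFun (((G.boundary Finset.univ).card : ℤ) - 2) fun lam =>
    G.DeltaNeumann k σ lam - G.DeltaNeumann k σ' lam

/-- `ρ^{B_p-1} (Δ_p^D - Δ_p^D')(ρ²)`, where `B_p` is the number of the boundary vertices of `G_p`. -/
noncomputable def diffDeltaAboveD (p : Fin (m + 1)) (σ σ' : Fin m → ℝ → ℂ) : ℝ → ℂ :=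
  rhoFun (((G.boundary (G.above p)).card : ℤ) - 1) fun lam =>
    G.DeltaAboveD p σ lam - G.DeltaAboveD p σ' lam

/-- `ρ^{B_p-2} (Δ_p^N - Δ_p^N')(ρ²)`. -/
noncomputable def diffDeltaAboveN (p : Fin (m + 1)) (σ σ' : Fin m → ℝ → ℂ) : ℝ → ℂ :=
  rhoFun (((G.boundary (G.above p)).card : ℤ) - 2) fun lam =>
    G.DeltaAboveN p σ lam - G.DeltaAboveN p σ' lam

/-- `δ_k`, the distance between the data `(Δ, Δ_k)` for the potentials `σ` and `σ'`. -/
noncomputable def dataDist (k : Fin (m + 1)) (σ σ' : Fin m → ℝ → ℂ) : ℝ≥0∞ :=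
  eLpNorm (G.diffDelta σ σ') 2 volume + eLpNorm (G.diffDeltaNeumann k σ σ') 2 volume

end MetricTree

/-! ### Absolutely continuous functions -/

section AbsolutelyContinuous

open Filter Topology

/-! Put λ = ρ² and multiply every characteristic function by the power of ρ that occurs in the
norms. Cut `G` at v_p: one part is G_p, one is the edge e_k, the others are directed subtrees
hanging below v_p. Let P be the product of the Dirichlet characteristic functions of the latter, and
Q the sum of these products with one factor replaced by its Neumann counterpart. The splitting
formula reads Δ = Δ_p^N S_k P + Δ_p^D (S_k^{[1]} P + S_k Q), and Δ_k satisfies the same relation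
with φ_k in place of S_k. As φ_k S_k^{[1]} − φ_k^{[1]} S_k = 1, the pair can be solved
(`normChar_above_mul`): Δ_p^D P = φ_k Δ − S_k Δ_k, Δ_p^N P = S_k^{[1]} Δ_k − φ_k^{[1]} Δ − Δ_p^D Q.
All coefficients depend only on the potential on g_p. It remains to subtract these identities for
two potentials and to divide by P (`dominated_above`).

On the real axis P may vanish, so this is done on a line Im ρ = τ, with τ large in terms of Ω and
the edge lengths only. Three facts make it work.

Stability: on that line the normalized characteristic functions are bounded and depend on the
potential in a Lipschitz way, with values in L₂ (`Connected.stable_normChar`). The splitting formula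
reduces this to one edge. There p, q = e^{iρx}(y^{[1]}/ρ ± iy) satisfy integral equations. The
first-order term in σ − σ̃ is a Fourier integral, controlled by Plancherel; the terms quadratic in
the potentials carry 1/ρ, which is in L₂ of the line; the coupling of p and q is absorbed because
the kernel e^{2iρ(x−t)} is small in L₂ for large τ (`IsProfile.eLpNorm_sub_le`).

Lower bound: |P| is bounded away from zero (`exists_le_norm_normChar`). The condition
Im(y^{[1]}/(ρy)) ≤ 0, written without division as `InCone`, survives both the passage along an edge
and the joining of branches at a vertex, where logarithmic derivatives add; along an edge it forces
|y| to stay large.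

Passage between the lines: differences of normalized characteristic functions are entire of
exponential type, so the Plancherel-Pólya inequality makes their L₂-norms on the real axis and on Im
ρ = τ comparable.

Finally, the recursive characteristic function has to be well defined. It has a closed form
(`charSum`): a sum, over all choices of one Neumann edge at every internal vertex, of products of
edge functions. This form satisfies the splitting relation at every internal vertex. -/

lemma AbsolutelyContinuousOnInterval.of_dist_le {X Y : Type*} [PseudoMetricSpace X]
    [PseudoMetricSpace Y] {f : ℝ → X} {h : ℝ → Y} {a b K : ℝ}
    (hh : AbsolutelyContinuousOnInterval h a b)
    (hle : ∀ x ∈ uIcc a b, ∀ y ∈ uIcc a b, dist (f x) (f y) ≤ K * dist (h x) (h y)) :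
    AbsolutelyContinuousOnInterval f a b := by
  have h1 := (show Tendsto _ _ _ from hh).const_mul K
  rw [mul_zero] at h1
  refine squeeze_zero' ?_ ?_ h1
  · exact Eventually.of_forall fun E => Finset.sum_nonneg fun _ _ => dist_nonneg
  · have : ∀ᶠ E : ℕ × (ℕ → ℝ × ℝ) in AbsolutelyContinuousOnInterval.totalLengthFilter ⊓
        𝓟 (AbsolutelyContinuousOnInterval.disjWithin a b),
        E ∈ AbsolutelyContinuousOnInterval.disjWithin a b :=
      eventually_inf_principal.mpr (by simp)
    filter_upwards [this] with E hE
    rw [Finset.mul_sum]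
    refine Finset.sum_le_sum fun i hi => ?_
    have := hE.1 i hi
    exact hle _ this.1 _ this.2

lemma IntervalIntegrable.absolutelyContinuousOnInterval_primitive {E : Type*}
    [NormedAddCommGroup E] [NormedSpace ℝ E] {f : ℝ → E} {a b : ℝ}
    (h : IntervalIntegrable f volume a b) :
    AbsolutelyContinuousOnInterval (fun x => ∫ t in a..x, f t) a b := by
  refine (h.norm.absolutelyContinuousOnInterval_intervalIntegral (c := a) (by simp)).of_dist_le
    (K := 1) fun x hx y hy => ?_
  have hx' : IntervalIntegrable f volume a x := h.mono_set (uIcc_subset_uIcc_left hx)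
  have hy' : IntervalIntegrable f volume a y := h.mono_set (uIcc_subset_uIcc_left hy)
  rw [dist_eq_norm, dist_eq_norm, intervalIntegral.integral_interval_sub_left hx' hy',
    intervalIntegral.integral_interval_sub_left hx'.norm hy'.norm, one_mul]
  exact intervalIntegral.norm_integral_le_abs_integral_norm

/-- Subtracting the primitive of `f'` leaves an absolutely continuous function with derivative zero
almost everywhere, hence a constant. -/
lemma AbsolutelyContinuousOnInterval.integral_eq_sub_of_ae_hasDerivAt {E : Type*}
    [NormedAddCommGroup E] [NormedSpace ℝ E] [CompleteSpace E] {f f' : ℝ → E} {a b : ℝ}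
    (hf : AbsolutelyContinuousOnInterval f a b) (hi : IntervalIntegrable f' volume a b)
    (hd : ∀ᵐ x, x ∈ uIcc a b → HasDerivAt f (f' x) x) :
    ∀ x ∈ uIcc a b, ∫ t in a..x, f' t = f x - f a := by
  have hac := hi.absolutelyContinuousOnInterval_primitive
  obtain ⟨C, hC⟩ := (hf.sub hac).const_of_ae_hasDerivAt_zero (by
    filter_upwards [hd, hi.ae_hasDerivAt_integral] with x h1 h2 hx
    convert (h1 hx).sub (h2 hx a (by simp)) using 1
    simp)
  intro x hx
  have h1 := hC a (by simp)
  have h2 := hC x hx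
  simp only [Pi.sub_apply, intervalIntegral.integral_same, sub_zero] at h1 h2
  rw [h1, ← h2]; abel

lemma AbsolutelyContinuousOnInterval.exp {F : ℝ → ℝ} {a b : ℝ}
    (hF : AbsolutelyContinuousOnInterval F a b) :
    AbsolutelyContinuousOnInterval (fun x => Real.exp (F x)) a b := by
  obtain ⟨C, hC⟩ := hF.exists_bound
  refine hF.of_dist_le (K := Real.exp C) fun x hx y hy => ?_
  have key : ∀ u v : ℝ, u ≤ C → v ≤ u → Real.exp u - Real.exp v ≤ Real.exp C * (u - v) := by
    intro u v hu hv
    have h1 : Real.exp v = Real.exp u * Real.exp (v - u) := by rw [← Real.exp_add]; ring_nf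
    have h2 := Real.add_one_le_exp (v - u)
    have h3 : Real.exp u ≤ Real.exp C := Real.exp_le_exp.mpr hu
    have h4 := Real.exp_pos u
    nlinarith
  have hx' := (abs_le.mp (hC x hx)).2
  have hy' := (abs_le.mp (hC y hy)).2
  rw [Real.dist_eq, Real.dist_eq]
  rcases le_total (F y) (F x) with h | h
  · rw [abs_of_nonneg (sub_nonneg.mpr (Real.exp_le_exp.mpr h)), abs_of_nonneg (sub_nonneg.mpr h)]
    exact key _ _ hx' h
  · rw [abs_sub_comm, abs_sub_comm (F x), abs_of_nonneg (sub_nonneg.mpr (Real.exp_le_exp.mpr h)),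
      abs_of_nonneg (sub_nonneg.mpr h)]
    exact key _ _ hy' h

/-- The reason for the weight e^{2∫a}: integrated against `a` it returns at most half of itself, so
weighted Volterra operators are contractions with constant 1/2. -/
lemma integral_mul_exp_primitive {a : ℝ → ℝ} {T : ℝ} (ha : IntervalIntegrable a volume 0 T) :
    ∀ x ∈ uIcc 0 T, ∫ t in (0 : ℝ)..x, Real.exp (2 * ∫ s in (0 : ℝ)..t, a s) * a t =
      (Real.exp (2 * ∫ s in (0 : ℝ)..x, a s) - 1) / 2 := by
  have hF := (ha.absolutelyContinuousOnInterval_intervalIntegral (c := 0) (by simp)).const_mul 2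
  have hE := hF.exp
  have hi : IntervalIntegrable (fun t => Real.exp (2 * ∫ s in (0 : ℝ)..t, a s) * (2 * a t))
      volume 0 T := (ha.const_mul 2).continuousOn_mul hE.continuousOn
  have hd : ∀ᵐ x, x ∈ uIcc 0 T → HasDerivAt (fun t => Real.exp (2 * ∫ s in (0 : ℝ)..t, a s))
      (Real.exp (2 * ∫ s in (0 : ℝ)..x, a s) * (2 * a x)) x := by
    filter_upwards [ha.ae_hasDerivAt_integral] with x h hx
    exact ((h hx 0 (by simp)).const_mul 2).exp
  intro x hx
  have := hE.integral_eq_sub_of_ae_hasDerivAt hi hd x hx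
  simp only [intervalIntegral.integral_same, mul_zero, Real.exp_zero] at this
  rw [← this, eq_div_iff (by norm_num), ← intervalIntegral.integral_mul_const]
  congr 1; ext t; ring

/-- Grönwall's inequality with a non-sharp constant. At a maximum point of ‖Y‖/F, where F is the
exponential weight, the integral is at most M(F − 1)/2 for the maximum M, and this can be absorbed.
-/
lemma norm_le_of_le_add_integral {E : Type*} [NormedAddCommGroup E] {T : ℝ} {a : ℝ → ℝ}
    (ha : IntervalIntegrable a volume 0 T) (ha0 : ∀ t, 0 ≤ a t) {Y : ℝ → E}
    (hY : ContinuousOn Y (Icc 0 T)) {K : ℝ} (hK : 0 ≤ K)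
    (hle : ∀ x ∈ Icc 0 T, ‖Y x‖ ≤ K + ∫ t in (0 : ℝ)..x, a t * ‖Y t‖) :
    ∀ x ∈ Icc 0 T, ‖Y x‖ ≤ 2 * K * Real.exp (2 * ∫ t in (0 : ℝ)..x, a t) := by
  intro x₀ hx₀
  have hT : (0 : ℝ) ≤ T := hx₀.1.trans hx₀.2
  have hFc := ((ha.absolutelyContinuousOnInterval_intervalIntegral (c := 0) (by simp)).const_mul
    2).exp.continuousOn
  rw [uIcc_of_le hT] at hFc
  set F : ℝ → ℝ := fun x => Real.exp (2 * ∫ t in (0 : ℝ)..x, a t) with hF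
  have hFpos : ∀ x, 0 < F x := fun x => Real.exp_pos _
  have hFc' : ContinuousOn F (Icc 0 T) := hFc
  obtain ⟨z, hz, hmax⟩ := isCompact_Icc.exists_isMaxOn ⟨x₀, hx₀⟩
    (hY.norm.div hFc' fun x _ => (hFpos x).ne')
  set M := ‖Y z‖ / F z with hM
  have hM' : ∀ x ∈ Icc 0 T, ‖Y x‖ ≤ M * F x := fun x hx => by
    have : ‖Y x‖ / F x ≤ M := hmax hx
    rwa [div_le_iff₀ (hFpos x)] at this
  have hM0 : 0 ≤ M := div_nonneg (norm_nonneg _) (hFpos z).le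
  have hsub : uIcc 0 z ⊆ uIcc 0 T := by
    rw [uIcc_of_le hz.1, uIcc_of_le hT]; exact Icc_subset_Icc_right hz.2
  have hsub' : uIcc 0 z ⊆ Icc 0 T := by rwa [uIcc_of_le hT] at hsub
  have haz := ha.mono_set hsub
  have h1 : ∫ t in (0 : ℝ)..z, a t * ‖Y t‖ ≤ ∫ t in (0 : ℝ)..z, M * (F t * a t) := by
    refine intervalIntegral.integral_mono_on hz.1 (haz.mul_continuousOn (hY.norm.mono hsub'))
      ((haz.continuousOn_mul (hFc'.mono hsub')).const_mul M) fun t ht => ?_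
    have := hM' t ⟨ht.1, ht.2.trans hz.2⟩
    nlinarith [ha0 t]
  rw [intervalIntegral.integral_const_mul, integral_mul_exp_primitive ha z
    (by rwa [uIcc_of_le hT])] at h1
  have h2 := hle z hz
  have h3 : ‖Y z‖ = M * F z := by rw [hM]; field_simp [(hFpos z).ne']
  have hF1 : 1 ≤ F z := Real.one_le_exp (mul_nonneg (by norm_num)
    (intervalIntegral.integral_nonneg hz.1 fun t _ => ha0 t))
  change _ ≤ M * ((F z - 1) / 2) at h1
  have h4 : M ≤ 2 * K := by
    have : M * F z ≤ K + M * ((F z - 1) / 2) := by linarith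
    nlinarith
  exact (hM' x₀ hx₀).trans (mul_le_mul_of_nonneg_right h4 (hFpos x₀).le)

end AbsolutelyContinuous

/-! ### Linear Carathéodory systems -/

section LinearSystem

open BoundedContinuousFunction

variable {E : Type*} [NormedAddCommGroup E] [NormedSpace ℂ E]

lemma integrable_clm_apply {A : ℝ → E →L[ℂ] E} (hA : Integrable A) {Z : ℝ → E}
    (hZ : Continuous Z) {C : ℝ} (hC : ∀ t, ‖Z t‖ ≤ C) : Integrable fun t => A t (Z t) := by
  refine (hA.norm.mul_const C).mono' ?_ (Filter.Eventually.of_forall fun t => ?_)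
  · have := hA.aestronglyMeasurable.prodMk hZ.aestronglyMeasurable (μ := volume)
    exact (isBoundedBilinearMap_apply (𝕜 := ℂ) (E := E) (F := E)).continuous.comp_aestronglyMeasurable
      this
  · exact (A t).le_opNorm_of_le (hC t)

/-- The Volterra operator `Z ↦ e^{-2F} ∫₀ˣ e^{2F} A Z` with `F = ∫₀ˣ a`, pointwise. -/
noncomputable def weightedVolterra (a : ℝ → ℝ) (A : ℝ → E →L[ℂ] E) (Z : ℝ → E) (x : ℝ) : E :=
  Real.exp (-(2 * ∫ s in (0 : ℝ)..x, a s)) •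
    ∫ t in (0 : ℝ)..x, Real.exp (2 * ∫ s in (0 : ℝ)..t, a s) • A t (Z t)

lemma continuous_exp_primitive {a : ℝ → ℝ} (ha : Integrable a) (c : ℝ) :
    Continuous fun x => Real.exp (c * ∫ s in (0 : ℝ)..x, a s) :=
  Real.continuous_exp.comp (continuous_const.mul
    (intervalIntegral.continuous_primitive (fun _ _ => ha.intervalIntegrable) 0))

lemma exp_primitive_le {a : ℝ → ℝ} (ha : Integrable a) (x : ℝ) :
    Real.exp (2 * ∫ s in (0 : ℝ)..x, a s) ≤ Real.exp (2 * ∫ s, ‖a s‖) := by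
  refine Real.exp_le_exp.mpr (mul_le_mul_of_nonneg_left ?_ (by norm_num))
  refine (Real.le_norm_self _).trans (intervalIntegral.norm_integral_le_integral_norm_uIoc.trans ?_)
  exact setIntegral_le_integral ha.norm (Filter.Eventually.of_forall fun t => norm_nonneg _)

lemma integrable_weighted {a : ℝ → ℝ} (ha : Integrable a) {A : ℝ → E →L[ℂ] E} (hA : Integrable A)
    {Z : ℝ → E} (hZ : Continuous Z) {C : ℝ} (hC : ∀ t, ‖Z t‖ ≤ C) :
    Integrable fun t => Real.exp (2 * ∫ s in (0 : ℝ)..t, a s) • A t (Z t) := by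
  refine Integrable.bdd_smul (𝕜 := ℝ) (integrable_clm_apply hA hZ hC)
    (Real.exp (2 * ∫ s, ‖a s‖)) (continuous_exp_primitive ha 2).aestronglyMeasurable ?_
  refine Filter.Eventually.of_forall fun t => ?_
  rw [Real.norm_of_nonneg (Real.exp_pos _).le]
  exact exp_primitive_le ha t

/-- For x ≥ 0 the bound is e^{-2F}(e^{2F} − 1)/2 ≤ 1/2, by `integral_mul_exp_primitive`; for x ≤ 0
the coefficient vanishes, so no growth to the left has to be controlled. -/
lemma norm_weightedVolterra_le {a : ℝ → ℝ} (ha : Integrable a)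
    {A : ℝ → E →L[ℂ] E} (hAa : ∀ t, ‖A t‖ ≤ a t) (h0 : ∀ t ≤ 0, A t = 0)
    {Z : ℝ → E} {C : ℝ} (hC : ∀ t, ‖Z t‖ ≤ C) (x : ℝ) :
    ‖weightedVolterra a A Z x‖ ≤ C / 2 := by
  have hC0 : 0 ≤ C := (norm_nonneg _).trans (hC 0)
  unfold weightedVolterra
  rcases le_total x 0 with hx | hx
  · rw [intervalIntegral.integral_congr (g := fun _ => (0 : E)) fun t ht => by
      rw [uIcc_of_ge hx] at ht
      simp [h0 t ht.2]]
    simp only [intervalIntegral.integral_zero, smul_zero, norm_zero]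
    positivity
  · rw [norm_smul, Real.norm_of_nonneg (Real.exp_pos _).le, Real.exp_neg]
    have h1 : ‖∫ t in (0 : ℝ)..x, Real.exp (2 * ∫ s in (0 : ℝ)..t, a s) • A t (Z t)‖ ≤
        ∫ t in (0 : ℝ)..x, C * (Real.exp (2 * ∫ s in (0 : ℝ)..t, a s) * a t) := by
      refine intervalIntegral.norm_integral_le_of_norm_le hx
        (Filter.Eventually.of_forall fun t _ => ?_) ?_
      · rw [norm_smul, Real.norm_of_nonneg (Real.exp_pos _).le]
        have : ‖A t (Z t)‖ ≤ a t * C :=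
          ((A t).le_opNorm_of_le (hC t)).trans (mul_le_mul_of_nonneg_right (hAa t) hC0)
        nlinarith [Real.exp_pos (2 * ∫ s in (0 : ℝ)..t, a s)]
      · exact ((ha.intervalIntegrable).continuousOn_mul
          (continuous_exp_primitive ha 2).continuousOn).const_mul C
    rw [intervalIntegral.integral_const_mul,
      integral_mul_exp_primitive (ha.intervalIntegrable (b := x)) x (by simp)] at h1
    have hpos := Real.exp_pos (2 * ∫ s in (0 : ℝ)..x, a s)
    rw [inv_mul_le_iff₀ hpos]
    nlinarith

lemma continuous_weightedVolterra {a : ℝ → ℝ} (ha : Integrable a) {A : ℝ → E →L[ℂ] E}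
    (hA : Integrable A) {Z : ℝ → E} (hZ : Continuous Z) {C : ℝ} (hC : ∀ t, ‖Z t‖ ≤ C) :
    Continuous (weightedVolterra a A Z) := by
  have h1 := continuous_exp_primitive ha (-2)
  simp only [neg_mul] at h1
  exact h1.smul (intervalIntegral.continuous_primitive
    (fun _ _ => (integrable_weighted ha hA hZ hC).intervalIntegrable) 0)

/-- `weightedVolterra` as a bounded operator. -/
noncomputable def volterraCLM {a : ℝ → ℝ} (ha : Integrable a)
    {A : ℝ → E →L[ℂ] E} (hA : Integrable A) (hAa : ∀ t, ‖A t‖ ≤ a t) (h0 : ∀ t ≤ 0, A t = 0) :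
    (ℝ →ᵇ E) →L[ℂ] (ℝ →ᵇ E) :=
  LinearMap.mkContinuous
    { toFun := fun Z => BoundedContinuousFunction.ofNormedAddCommGroup (weightedVolterra a A Z)
        (continuous_weightedVolterra ha hA Z.continuous Z.norm_coe_le_norm) (‖Z‖ / 2)
        (norm_weightedVolterra_le ha hAa h0 Z.norm_coe_le_norm)
      map_add' := fun Z W => by
        ext x
        simp only [weightedVolterra, BoundedContinuousFunction.coe_ofNormedAddCommGroup,
          BoundedContinuousFunction.coe_add, Pi.add_apply, map_add, smul_add]
        rw [intervalIntegral.integral_add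
          (integrable_weighted ha hA Z.continuous Z.norm_coe_le_norm).intervalIntegrable
          (integrable_weighted ha hA W.continuous W.norm_coe_le_norm).intervalIntegrable, smul_add]
      map_smul' := fun c Z => by
        ext x
        simp only [weightedVolterra, BoundedContinuousFunction.coe_ofNormedAddCommGroup,
          BoundedContinuousFunction.coe_smul, map_smul, RingHom.id_apply]
        simp_rw [smul_comm _ c]
        rw [intervalIntegral.integral_smul, smul_comm] }
    (1 / 2) fun Z => by
      refine (BoundedContinuousFunction.norm_le (by positivity)).mpr fun x => ?_
      refine (norm_weightedVolterra_le ha hAa h0 Z.norm_coe_le_norm x).trans ?_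
      linarith

lemma volterraCLM_apply {a : ℝ → ℝ} (ha : Integrable a)
    {A : ℝ → E →L[ℂ] E} (hA : Integrable A) (hAa : ∀ t, ‖A t‖ ≤ a t) (h0 : ∀ t ≤ 0, A t = 0)
    (Z : ℝ →ᵇ E) (x : ℝ) : volterraCLM ha hA hAa h0 Z x = weightedVolterra a A Z x := rfl

lemma norm_volterraCLM_le {a : ℝ → ℝ} (ha : Integrable a)
    {A : ℝ → E →L[ℂ] E} (hA : Integrable A) (hAa : ∀ t, ‖A t‖ ≤ a t) (h0 : ∀ t ≤ 0, A t = 0) :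
    ‖volterraCLM ha hA hAa h0‖ ≤ 1 / 2 :=
  LinearMap.mkContinuous_norm_le _ (by norm_num) _

/-- The substitution Y = e^{2F}Z turns the equation into Z = e^{-2F}Y₀ + (V₀ + λV₁)Z. The weight a =
‖A₀‖ + R‖A₁‖ dominates A₀ + λA₁ for |λ| < R, so V₀ + λV₁ has norm at most 1/2 and 1 − (V₀ + λV₁) is
invertible. Analyticity in λ is that of the inverse in a Banach algebra. The assumption R ≥ 1 lets
the same weight dominate A₁, so that V₁ is bounded too. -/
lemma exists_linearSystem_solution_of_bound [CompleteSpace E] {A₀ A₁ : ℝ → E →L[ℂ] E}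
    (hA₀ : Integrable A₀) (hA₁ : Integrable A₁) (h₀ : ∀ t ≤ 0, A₀ t = 0) (h₁ : ∀ t ≤ 0, A₁ t = 0)
    (Y₀ : E) (R : ℝ) (hR : 1 ≤ R) :
    ∃ Y : ℂ → ℝ → E, ∀ lam, ‖lam‖ < R → Continuous (Y lam) ∧ 
      (∀ x, Y lam x = Y₀ + ∫ t in (0 : ℝ)..x, (A₀ t + lam • A₁ t) (Y lam t)) ∧
      ∀ x, DifferentiableAt ℂ (fun l => Y l x) lam := by
  have hR0 : (0 : ℝ) ≤ R := by linarith
  set a : ℝ → ℝ := fun t => ‖A₀ t‖ + R * ‖A₁ t‖ with ha_def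
  have ha : Integrable a := hA₀.norm.add (hA₁.norm.const_mul R)
  have hb₀ : ∀ t, ‖A₀ t‖ ≤ a t := fun t => by
    have : 0 ≤ R * ‖A₁ t‖ := by positivity
    simp only [ha_def]; linarith
  have hb₁ : ∀ t, ‖A₁ t‖ ≤ a t := fun t => by
    simp only [ha_def]; nlinarith [norm_nonneg (A₀ t), norm_nonneg (A₁ t)]
  set V₀ := volterraCLM ha hA₀ hb₀ h₀
  set V₁ := volterraCLM ha hA₁ hb₁ h₁
  set F : ℝ → ℝ := fun x => ∫ s in (0 : ℝ)..x, a s with hF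
  have hV : ∀ (lam : ℂ) (Z : ℝ →ᵇ E) (x : ℝ), (V₀ + lam • V₁) Z x =
      weightedVolterra a (fun t => A₀ t + lam • A₁ t) Z x := by
    intro lam Z x
    have i0 := (integrable_weighted ha hA₀ Z.continuous Z.norm_coe_le_norm).intervalIntegrable
      (a := 0) (b := x)
    have i1 := (integrable_weighted ha hA₁ Z.continuous Z.norm_coe_le_norm).intervalIntegrable
      (a := 0) (b := x)
    change weightedVolterra a A₀ Z x + lam • weightedVolterra a A₁ Z x = _
    simp only [weightedVolterra, _root_.add_apply, _root_.smul_apply,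
      smul_add]
    simp_rw [smul_comm _ lam]
    have := intervalIntegral.integral_add i0 (i1.smul lam)
    simp only [Pi.smul_apply] at this
    rw [this, intervalIntegral.integral_smul, smul_add, smul_comm lam]
  have hnorm : ∀ lam : ℂ, ‖lam‖ < R → ‖V₀ + lam • V₁‖ < 1 := by
    intro lam hl
    have hA : Integrable (fun t => A₀ t + lam • A₁ t) := hA₀.add (hA₁.smul lam)
    have hAa : ∀ t, ‖A₀ t + lam • A₁ t‖ ≤ a t := fun t => by
      refine (norm_add_le _ _).trans (add_le_add_right ?_ _)
      rw [norm_smul]; exact mul_le_mul_of_nonneg_right hl.le (norm_nonneg _)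
    have h00 : ∀ t ≤ 0, A₀ t + lam • A₁ t = 0 := fun t ht => by simp [h₀ t ht, h₁ t ht]
    have : V₀ + lam • V₁ = volterraCLM ha hA hAa h00 := by
      ext Z x; rw [hV, volterraCLM_apply]
    rw [this]
    exact (norm_volterraCLM_le ha hA hAa h00).trans_lt (by norm_num)
  have hz0 : ∀ x, ‖Real.exp (-2 * F x) • Y₀‖ ≤ Real.exp (2 * ∫ s, ‖a s‖) * ‖Y₀‖ := fun x => by
    rw [norm_smul, Real.norm_of_nonneg (Real.exp_pos _).le]
    refine mul_le_mul_of_nonneg_right ?_ (norm_nonneg _)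
    have := exp_primitive_le ha.neg x
    simpa [intervalIntegral.integral_neg] using this
  set z0 : ℝ →ᵇ E := BoundedContinuousFunction.ofNormedAddCommGroup
    (fun x => Real.exp (-2 * F x) • Y₀) ((continuous_exp_primitive ha (-2)).smul continuous_const)
    _ hz0 with hz0_def
  set Z : ℂ → (ℝ →ᵇ E) := fun lam => Ring.inverse (1 - (V₀ + lam • V₁)) z0 with hZ
  refine ⟨fun lam x => Real.exp (2 * F x) • Z lam x, fun lam hl => ⟨?_, ?_, ?_⟩⟩
  · exact (continuous_exp_primitive ha 2).smul (Z lam).continuous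
  · intro x
    have hu : IsUnit (1 - (V₀ + lam • V₁)) := isUnit_one_sub_of_norm_lt_one (hnorm lam hl)
    have h1 : (1 - (V₀ + lam • V₁)) (Z lam) = z0 := by
      have := congrArg (fun (U : (ℝ →ᵇ E) →L[ℂ] (ℝ →ᵇ E)) => U z0) (Ring.mul_inverse_cancel _ hu)
      simpa [hZ] using this
    have h2 : Z lam x = z0 x + weightedVolterra a (fun t => A₀ t + lam • A₁ t) (Z lam) x := by
      rw [← hV, ← h1]; simp
    have h3 : z0 x = Real.exp (-2 * F x) • Y₀ := rfl
    change Real.exp (2 * F x) • Z lam x = _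
    rw [h2, h3, smul_add, smul_smul, ← Real.exp_add, weightedVolterra, smul_smul, ← Real.exp_add]
    simp only [hF, neg_mul, add_neg_cancel, Real.exp_zero, one_smul]
    congr 2
    ext t
    have : ∀ (c : ℝ) (B : E →L[ℂ] E) (v : E), B (c • v) = c • B v := fun c B v =>
      B.map_smul_of_tower c v
    rw [this]
  · intro x
    have hu : IsUnit (1 - (V₀ + lam • V₁)) := isUnit_one_sub_of_norm_lt_one (hnorm lam hl)
    have h1 : DifferentiableAt ℂ (fun l : ℂ => Ring.inverse (1 - (V₀ + l • V₁))) lam :=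
      DifferentiableAt.comp lam (g := Ring.inverse) (f := fun l : ℂ => 1 - (V₀ + l • V₁))
        (differentiableAt_inverse (𝕜 := ℂ) hu) (by fun_prop)
    have h2 : DifferentiableAt ℂ Z lam := h1.clm_apply (differentiableAt_const _)
    let e : (ℝ →ᵇ E) →L[ℂ] E := BoundedContinuousFunction.evalCLM ℂ x
    have h3 : DifferentiableAt ℂ (fun l => Z l x) lam := e.differentiableAt.comp lam h2
    exact h3.const_smul (Real.exp (2 * F x))

lemma linearSystem_solution_unique {A : ℝ → E →L[ℂ] E} (hA : Integrable A)
    (h0 : ∀ t ≤ 0, A t = 0) {Y₀ : E} {Y W : ℝ → E} (hY : Continuous Y) (hW : Continuous W)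
    (hYe : ∀ x, Y x = Y₀ + ∫ t in (0 : ℝ)..x, A t (Y t))
    (hWe : ∀ x, W x = Y₀ + ∫ t in (0 : ℝ)..x, A t (W t)) : Y = W := by
  have hneg : ∀ (U : ℝ → E) (x : ℝ), x ≤ 0 → ∫ t in (0 : ℝ)..x, A t (U t) = 0 := by
    intro U x hx
    rw [intervalIntegral.integral_congr (g := fun _ => (0 : E)) fun t ht => by
      rw [uIcc_of_ge hx] at ht
      simp [h0 t ht.2]]
    simp
  ext x
  rcases le_total x 0 with hx | hx
  · rw [hYe, hWe, hneg _ _ hx, hneg _ _ hx]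
  have hint : ∀ (U : ℝ → E), Continuous U → ∀ z, 0 ≤ z →
      IntervalIntegrable (fun t => A t (U t)) volume 0 z := by
    intro U hU z hz
    obtain ⟨C, hC⟩ := isCompact_Icc.exists_bound_of_continuousOn (hU.continuousOn (s := Icc 0 z))
    have hUc : Continuous fun t => U (projIcc 0 z hz t) :=
      hU.comp (continuous_subtype_val.comp continuous_projIcc)
    have := (integrable_clm_apply hA hUc (C := C) fun t => hC _ (projIcc 0 z hz t).2)
    refine (this.intervalIntegrable (a := 0) (b := z)).congr fun t ht => ?_
    rw [uIoc_of_le hz] at ht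
    simp only [projIcc_of_mem hz (Ioc_subset_Icc_self ht)]
  have key := norm_le_of_le_add_integral (T := x) (a := fun t => ‖A t‖)
    (hA.norm.intervalIntegrable) (fun t => norm_nonneg _)
    (Y := fun t => Y t - W t) (hY.sub hW).continuousOn (K := 0) le_rfl (fun z hz => by
      have hsub : Y z - W z = ∫ t in (0 : ℝ)..z, A t (Y t - W t) := by
        conv_lhs => rw [hYe, hWe]
        simp only [map_sub]
        rw [intervalIntegral.integral_sub (hint Y hY z hz.1) (hint W hW z hz.1)]
        abel
      rw [hsub, zero_add]
      refine intervalIntegral.norm_integral_le_of_norm_le hz.1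
        (Filter.Eventually.of_forall fun t _ => (A t).le_opNorm _) ?_
      exact hA.norm.intervalIntegrable.mul_continuousOn (hY.sub hW).norm.continuousOn) x ⟨hx, le_rfl⟩
  simp only [mul_zero, zero_mul, norm_le_zero_iff] at key
  exact sub_eq_zero.mp key

theorem exists_linearSystem_solution [CompleteSpace E] {A₀ A₁ : ℝ → E →L[ℂ] E}
    (hA₀ : Integrable A₀) (hA₁ : Integrable A₁) (h₀ : ∀ t ≤ 0, A₀ t = 0) (h₁ : ∀ t ≤ 0, A₁ t = 0)
    (Y₀ : E) :
    ∃ Y : ℂ → ℝ → E, (∀ lam, Continuous (Y lam)) ∧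
      (∀ lam x, Y lam x = Y₀ + ∫ t in (0 : ℝ)..x, (A₀ t + lam • A₁ t) (Y lam t)) ∧
      ∀ x, Differentiable ℂ (fun l => Y l x) := by
  have hex := fun R : ℝ => exists_linearSystem_solution_of_bound hA₀ hA₁ h₀ h₁ Y₀ (max 1 R)
    (le_max_left _ _)
  choose Y hY using hex
  have hlt : ∀ (l : ℂ) (R : ℝ), ‖l‖ < R → ‖l‖ < max 1 R := fun l R h => lt_max_of_lt_right h
  have huniq : ∀ (l : ℂ) (R S : ℝ), ‖l‖ < R → ‖l‖ < S → Y R l = Y S l := fun l R S hR hS =>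
    linearSystem_solution_unique (hA₀.add (hA₁.smul l)) (fun t ht => by simp [h₀ t ht, h₁ t ht])
      (hY R l (hlt l R hR)).1 (hY S l (hlt l S hS)).1 (hY R l (hlt l R hR)).2.1
      (hY S l (hlt l S hS)).2.1
  have h1 : ∀ l : ℂ, ‖l‖ < ‖l‖ + 1 := fun l => lt_add_one _
  refine ⟨fun l => Y (‖l‖ + 1) l, fun l => (hY _ l (hlt _ _ (h1 l))).1,
    fun l => (hY _ l (hlt _ _ (h1 l))).2.1, fun x l => ?_⟩
  -- The radius in the definition varies with `l`; by uniqueness all values near `l` belong to the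
  -- family with the fixed radius ‖l‖ + 2, whose analyticity is known.
  refine ((hY (‖l‖ + 2) l (hlt _ _ (by linarith))).2.2 x).congr_of_eventuallyEq ?_
  filter_upwards [Metric.ball_mem_nhds l one_pos] with l' hl'
  have : ‖l'‖ < ‖l‖ + 2 := by
    have h3 : ‖l'‖ ≤ ‖l‖ + ‖l' - l‖ := by simpa using norm_add_le l (l' - l)
    rw [Metric.mem_ball, dist_eq_norm] at hl'
    linarith
  rw [huniq l' _ (‖l‖ + 2) (h1 l') this]

end LinearSystem

/-! ### The Sturm-Liouville equation -/

section SturmLiouville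

variable {T : ℝ} {s : ℝ → ℂ} {lam : ℂ} {y y1 z z1 : ℝ → ℂ}

lemma ae_restrict_Ioo_iff {P : ℝ → Prop} (hT : 0 ≤ T) :
    (∀ᵐ x ∂(volume.restrict (Ioo 0 T)), P x) ↔ ∀ᵐ x, x ∈ uIcc 0 T → P x := by
  rw [Measure.restrict_congr_set Ioo_ae_eq_Icc, ae_restrict_iff' measurableSet_Icc, uIcc_of_le hT]

lemma MeasureTheory.MemLp.intervalIntegrable_of_Ioo (hs : MemLp s 2 (volume.restrict (Ioo 0 T)))
    (hT : 0 ≤ T) : IntervalIntegrable s volume 0 T := by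
  rw [intervalIntegrable_iff_integrableOn_Ioo_of_le hT]
  exact hs.integrable (by norm_num)

lemma MeasureTheory.MemLp.intervalIntegrable_sq_of_Ioo
    (hs : MemLp s 2 (volume.restrict (Ioo 0 T)))
    (hT : 0 ≤ T) : IntervalIntegrable (fun t => s t ^ 2) volume 0 T := by
  rw [intervalIntegrable_iff_integrableOn_Ioo_of_le hT]
  have := (memLp_two_iff_integrable_sq_norm hs.aestronglyMeasurable).mp hs
  refine Integrable.mono' this (hs.aestronglyMeasurable.pow 2) (ae_of_all _ fun t => ?_)
  rw [norm_pow]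

lemma IsSLSolution.continuousOn (h : IsSLSolution T s lam y y1) : ContinuousOn y (uIcc 0 T) :=
  h.ac.continuousOn

lemma IsSLSolution.continuousOn_quasi (h : IsSLSolution T s lam y y1) :
    ContinuousOn y1 (uIcc 0 T) := h.ac_quasi.continuousOn

lemma IsSLSolution.add (h : IsSLSolution T s lam y y1) (h' : IsSLSolution T s lam z z1) :
    IsSLSolution T s lam (fun x => y x + z x) (fun x => y1 x + z1 x) where
  ac := h.ac.add h'.ac
  ac_quasi := h.ac_quasi.add h'.ac_quasi
  quasi_deriv := by
    filter_upwards [h.quasi_deriv, h'.quasi_deriv] with x hx hx'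
    exact (hx.fun_add hx').congr_deriv (by ring)
  equation := by
    filter_upwards [h.equation, h'.equation] with x hx hx'
    exact (hx.fun_add hx').congr_deriv (by ring)

lemma IsSLSolution.const_mul (h : IsSLSolution T s lam y y1) (c : ℂ) :
    IsSLSolution T s lam (fun x => c * y x) (fun x => c * y1 x) where
  ac := h.ac.const_smul c
  ac_quasi := h.ac_quasi.const_smul c
  quasi_deriv := by
    filter_upwards [h.quasi_deriv] with x hx
    exact (hx.const_mul c).congr_deriv (by ring)
  equation := by
    filter_upwards [h.equation] with x hx
    exact (hx.const_mul c).congr_deriv (by ring)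

lemma IsSLSolution.intervalIntegrable (h : IsSLSolution T s lam y y1) (hT : 0 ≤ T)
    (hs : MemLp s 2 (volume.restrict (Ioo 0 T))) :
    IntervalIntegrable (fun x => y1 x + s x * y x) volume 0 T ∧
      IntervalIntegrable (fun x => -(s x * y1 x) - s x ^ 2 * y x - lam * y x) volume 0 T := by
  have h1 := hs.intervalIntegrable_of_Ioo hT
  have h2 := hs.intervalIntegrable_sq_of_Ioo hT
  have hy := h.continuousOn
  have hy1 := h.continuousOn_quasi
  exact ⟨hy1.intervalIntegrable.add (h1.mul_continuousOn hy),
    ((h1.mul_continuousOn hy1).neg.sub (h2.mul_continuousOn hy)).sub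
      (hy.intervalIntegrable.const_mul lam)⟩

lemma IsSLSolution.eq_integral (h : IsSLSolution T s lam y y1) (hT : 0 ≤ T)
    (hs : MemLp s 2 (volume.restrict (Ioo 0 T))) {x : ℝ} (hx : x ∈ uIcc 0 T) :
    y x = y 0 + ∫ t in (0 : ℝ)..x, (y1 t + s t * y t) := by
  rw [h.ac.integral_eq_sub_of_ae_hasDerivAt (h.intervalIntegrable hT hs).1
    ((ae_restrict_Ioo_iff hT).mp h.quasi_deriv) x hx]
  ring

lemma IsSLSolution.quasi_eq_integral (h : IsSLSolution T s lam y y1) (hT : 0 ≤ T)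
    (hs : MemLp s 2 (volume.restrict (Ioo 0 T))) {x : ℝ} (hx : x ∈ uIcc 0 T) :
    y1 x = y1 0 + ∫ t in (0 : ℝ)..x, (-(s t * y1 t) - s t ^ 2 * y t - lam * y t) := by
  rw [h.ac_quasi.integral_eq_sub_of_ae_hasDerivAt (h.intervalIntegrable hT hs).2
    ((ae_restrict_Ioo_iff hT).mp h.equation) x hx]
  ring

/-- For the vector (y, y^{[1]}/κ) in the maximum norm the system matrix has norm at most κ + |s| +
|s|², since dividing by κ turns |λ| ≤ κ² into κ. Grönwall's inequality then applies. -/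
lemma IsSLSolution.norm_le (h : IsSLSolution T s lam y y1) (hT : 0 ≤ T)
    (hs : MemLp s 2 (volume.restrict (Ioo 0 T))) {κ : ℝ} (hκ : 1 ≤ κ) (hlam : ‖lam‖ ≤ κ ^ 2)
    {x : ℝ} (hx : x ∈ Icc 0 T) :
    max ‖y x‖ (‖y1 x‖ / κ) ≤ 2 * max ‖y 0‖ (‖y1 0‖ / κ) *
      Real.exp (2 * ∫ t in (0 : ℝ)..T, (κ + ‖s t‖ + ‖s t‖ ^ 2)) := by
  have hκ0 : 0 < κ := by linarith
  have h1 := hs.intervalIntegrable_of_Ioo hT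
  have h2 : IntervalIntegrable (fun t => ‖s t‖ ^ 2) volume 0 T := by
    simpa using (hs.intervalIntegrable_sq_of_Ioo hT).norm
  have ha : IntervalIntegrable (fun t => κ + ‖s t‖ + ‖s t‖ ^ 2) volume 0 T :=
    (intervalIntegrable_const.add h1.norm).add h2
  have ha0 : ∀ t, 0 ≤ κ + ‖s t‖ + ‖s t‖ ^ 2 := fun t => by positivity
  have hy := h.continuousOn
  have hy1 := h.continuousOn_quasi
  set Y : ℝ → ℂ × ℂ := fun t => (y t, (κ : ℂ)⁻¹ * y1 t) with hYdef
  have hnorm : ∀ t, ‖Y t‖ = max ‖y t‖ (‖y1 t‖ / κ) := fun t => by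
    simp only [hYdef, Prod.norm_def, norm_mul, norm_inv, Complex.norm_real, Real.norm_eq_abs,
      abs_of_pos hκ0]
    rw [inv_mul_eq_div]
  have hY : ContinuousOn Y (uIcc 0 T) := hy.prodMk (continuousOn_const.mul hy1)
  have hsub : ∀ {z}, z ∈ Icc 0 T → uIcc 0 z ⊆ uIcc 0 T := fun hz => by
    rw [uIcc_of_le hz.1, uIcc_of_le hT]; exact Icc_subset_Icc_right hz.2
  have key := norm_le_of_le_add_integral ha ha0 (Y := Y) (K := ‖Y 0‖)
    (by rwa [uIcc_of_le hT] at hY) (norm_nonneg _) (fun z hz => by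
      have hi : IntervalIntegrable (fun t => (κ + ‖s t‖ + ‖s t‖ ^ 2) * ‖Y t‖) volume 0 z :=
        (ha.mul_continuousOn hY.norm).mono_set (hsub hz)
      have hz' : z ∈ uIcc 0 T := by rwa [uIcc_of_le hT]
      have e1 : ‖y z‖ ≤ ‖Y 0‖ + ∫ t in (0 : ℝ)..z, (κ + ‖s t‖ + ‖s t‖ ^ 2) * ‖Y t‖ := by
        rw [h.eq_integral hT hs hz']
        refine (norm_add_le _ _).trans (add_le_add ?_ ?_)
        · rw [hnorm]; exact le_max_left _ _
        · refine intervalIntegral.norm_integral_le_of_norm_le hz.1 (ae_of_all _ fun t _ => ?_) hi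
          have b1 : ‖y t‖ ≤ ‖Y t‖ := by rw [hnorm]; exact le_max_left _ _
          have b2 : ‖y1 t‖ ≤ κ * ‖Y t‖ := by
            rw [hnorm, ← div_le_iff₀' hκ0]; exact le_max_right _ _
          calc ‖y1 t + s t * y t‖ ≤ ‖y1 t‖ + ‖s t‖ * ‖y t‖ := by
                rw [← norm_mul]; exact norm_add_le _ _
            _ ≤ κ * ‖Y t‖ + ‖s t‖ * ‖Y t‖ := by gcongr
            _ ≤ _ := by nlinarith [mul_nonneg (sq_nonneg ‖s t‖) (norm_nonneg (Y t))]
      have e2 : ‖y1 z‖ / κ ≤ ‖Y 0‖ + ∫ t in (0 : ℝ)..z, (κ + ‖s t‖ + ‖s t‖ ^ 2) * ‖Y t‖ := by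
        rw [h.quasi_eq_integral hT hs hz', div_le_iff₀ hκ0, add_mul,
          ← intervalIntegral.integral_mul_const]
        refine (norm_add_le _ _).trans (add_le_add ?_ ?_)
        · rw [hnorm, ← div_le_iff₀ hκ0]; exact le_max_right _ _
        · refine intervalIntegral.norm_integral_le_of_norm_le hz.1 (ae_of_all _ fun t _ => ?_)
            (hi.mul_const κ)
          have b1 : ‖y t‖ ≤ ‖Y t‖ := by rw [hnorm]; exact le_max_left _ _
          have b2 : ‖y1 t‖ ≤ κ * ‖Y t‖ := by
            rw [hnorm, ← div_le_iff₀' hκ0]; exact le_max_right _ _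
          calc ‖-(s t * y1 t) - s t ^ 2 * y t - lam * y t‖
              ≤ ‖s t‖ * ‖y1 t‖ + ‖s t‖ ^ 2 * ‖y t‖ + ‖lam‖ * ‖y t‖ := by
                refine (norm_sub_le _ _).trans (add_le_add ((norm_sub_le _ _).trans
                  (add_le_add ?_ ?_)) ?_) <;> simp
            _ ≤ ‖s t‖ * (κ * ‖Y t‖) + ‖s t‖ ^ 2 * ‖Y t‖ + κ ^ 2 * ‖Y t‖ := by gcongr
            _ ≤ _ := by nlinarith [mul_nonneg (sq_nonneg ‖s t‖) (norm_nonneg (Y t))]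
      rw [hnorm z]
      exact max_le e1 e2) x hx
  rw [← hnorm, ← hnorm]
  refine key.trans (mul_le_mul_of_nonneg_left (Real.exp_le_exp.mpr ?_) (by positivity))
  refine mul_le_mul_of_nonneg_left ?_ (by norm_num)
  exact intervalIntegral.integral_mono_interval le_rfl hx.1 hx.2 (ae_of_all _ ha0) ha

lemma IsSLSolution.unique (h : IsSLSolution T s lam y y1) (h' : IsSLSolution T s lam z z1)
    (hT : 0 ≤ T) (hs : MemLp s 2 (volume.restrict (Ioo 0 T))) (h0 : y 0 = z 0) (h1 : y1 0 = z1 0)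
    {x : ℝ} (hx : x ∈ Icc 0 T) : y x = z x ∧ y1 x = z1 x := by
  have hd := h.add (h'.const_mul (-1))
  have := hd.norm_le hT hs (κ := 1 + ‖lam‖) (by simp) (by nlinarith [norm_nonneg lam]) hx
  simp only [h0, h1, neg_mul, one_mul, add_neg_cancel, norm_zero, zero_div, max_self, mul_zero,
    zero_mul] at this
  have a1 := (le_max_left _ _).trans this
  have a2 := (le_max_right _ _).trans this
  have hpos : (0 : ℝ) < 1 + ‖lam‖ := by positivity
  rw [div_le_iff₀ hpos, zero_mul] at a2
  exact ⟨by simpa [← sub_eq_add_neg, sub_eq_zero] using a1,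
    by simpa [← sub_eq_add_neg, sub_eq_zero] using a2⟩

/-- The matrix of the first-order system has trace zero, so the Wronskian has derivative zero almost
everywhere. -/
lemma IsSLSolution.wronskian (h : IsSLSolution T s lam y y1) (h' : IsSLSolution T s lam z z1)
    (hT : 0 ≤ T) : y T * z1 T - y1 T * z T = y 0 * z1 0 - y1 0 * z 0 := by
  have hac : AbsolutelyContinuousOnInterval (fun x => y x * z1 x - y1 x * z x) 0 T :=
    (h.ac.smul h'.ac_quasi).sub (h.ac_quasi.smul h'.ac)
  obtain ⟨C, hC⟩ := hac.const_of_ae_hasDerivAt_zero (by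
    rw [← ae_restrict_Ioo_iff hT]
    filter_upwards [h.quasi_deriv, h.equation, h'.quasi_deriv, h'.equation] with x a b c d
    exact ((a.fun_mul d).fun_sub (b.fun_mul c)).congr_deriv (by ring))
  rw [hC T (by simp), hC 0 (by simp)]

/-- The system for `(y, y^{[1]})` has the matrix `s • slMatrixA + (s ^ 2 + lam) • slMatrixB +
slMatrixC`. -/
noncomputable def slMatrixA : ℂ × ℂ →L[ℂ] ℂ × ℂ :=
  (ContinuousLinearMap.fst ℂ ℂ ℂ).prod (-ContinuousLinearMap.snd ℂ ℂ ℂ)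

/-- See `slMatrixA`. -/
noncomputable def slMatrixB : ℂ × ℂ →L[ℂ] ℂ × ℂ :=
  (0 : ℂ × ℂ →L[ℂ] ℂ).prod (-ContinuousLinearMap.fst ℂ ℂ ℂ)

/-- See `slMatrixA`. -/
noncomputable def slMatrixC : ℂ × ℂ →L[ℂ] ℂ × ℂ :=
  (ContinuousLinearMap.snd ℂ ℂ ℂ).prod (0 : ℂ × ℂ →L[ℂ] ℂ)

lemma slMatrix_apply (c l : ℂ) (v : ℂ × ℂ) :
    (c • slMatrixA + c ^ 2 • slMatrixB + slMatrixC + l • slMatrixB) v =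
      (v.2 + c * v.1, -(c * v.2) - c ^ 2 * v.1 - l * v.1) := by
  obtain ⟨x, y⟩ := v
  have hA : slMatrixA (x, y) = (x, -y) := rfl
  have hB : slMatrixB (x, y) = (0, -x) := rfl
  have hC : slMatrixC (x, y) = (y, 0) := rfl
  simp only [_root_.add_apply, _root_.smul_apply, hA, hB, hC, Prod.smul_mk, Prod.mk_add_mk,
    smul_eq_mul, mul_zero, add_zero]
  exact Prod.ext (by simp only; ring) (by simp only; ring)

lemma integrable_indicator_of_integrableOn {F : Type*} [NormedAddCommGroup F] {f : ℝ → F}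
    {S : Set ℝ} (hf : IntegrableOn f S volume) (hS : MeasurableSet S) :
    Integrable (S.indicator f) volume := hf.integrable_indicator hS

lemma integrableOn_add {F : Type*} [NormedAddCommGroup F] {f g : ℝ → F}
    {S : Set ℝ} (hf : IntegrableOn f S volume) (hg : IntegrableOn g S volume) :
    IntegrableOn (fun t => f t + g t) S volume := hf.add hg

/-- `slSolution` is picked separately for every λ and is arbitrary outside `[0, T]`. This family is
continuous on the whole line and entire in λ, and agrees with it at `T` by uniqueness. The
coefficients are cut off to (0, T] to fit the general theorem on linear systems. -/
theorem exists_isSLSolution (hT : 0 ≤ T) (hs : MemLp s 2 (volume.restrict (Ioo 0 T))) (a b : ℂ) :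
    ∃ Y : ℂ → ℝ → ℂ × ℂ, (∀ lam, Continuous (Y lam)) ∧
      (∀ lam, IsSLSolution T s lam (fun x => (Y lam x).1) (fun x => (Y lam x).2)) ∧
      (∀ lam, Y lam 0 = (a, b)) ∧ ∀ x, Differentiable ℂ (fun l => Y l x) := by
  set A₀ : ℝ → ℂ × ℂ →L[ℂ] ℂ × ℂ :=
    (Ioc 0 T).indicator fun t => s t • slMatrixA + s t ^ 2 • slMatrixB + slMatrixC with hA₀
  set A₁ : ℝ → ℂ × ℂ →L[ℂ] ℂ × ℂ := (Ioc 0 T).indicator fun _ => slMatrixB with hA₁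
  have hi := (intervalIntegrable_iff_integrableOn_Ioc_of_le hT).mp (hs.intervalIntegrable_of_Ioo hT)
  have hi2 := (intervalIntegrable_iff_integrableOn_Ioc_of_le hT).mp
    (hs.intervalIntegrable_sq_of_Ioo hT)
  have hc : ∀ M : ℂ × ℂ →L[ℂ] ℂ × ℂ, IntegrableOn (fun _ : ℝ => M) (Ioc 0 T) volume :=
    fun M => integrableOn_const (C := M) measure_Ioc_lt_top.ne (by simp)
  have i0 : Integrable A₀ := by
    refine integrable_indicator_of_integrableOn ?_ measurableSet_Ioc
    have h1 : IntegrableOn (fun t => s t • slMatrixA) (Ioc 0 T) volume :=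
      Integrable.smul_const hi slMatrixA
    have h2 : IntegrableOn (fun t => s t ^ 2 • slMatrixB) (Ioc 0 T) volume :=
      Integrable.smul_const hi2 slMatrixB
    exact integrableOn_add (integrableOn_add h1 h2) (hc slMatrixC)
  have i1 : Integrable A₁ := integrable_indicator_of_integrableOn (hc slMatrixB) measurableSet_Ioc
  have hneg : ∀ t ≤ 0, t ∉ Ioc 0 T := fun t ht h => not_lt.mpr ht h.1
  obtain ⟨Y, hYc, hYe, hYd⟩ := exists_linearSystem_solution i0 i1
    (fun t ht => indicator_of_notMem (hneg t ht) _)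
    (fun t ht => indicator_of_notMem (hneg t ht) _) (a, b)
  refine ⟨Y, hYc, fun lam => ?_, fun lam => by
    rw [hYe, intervalIntegral.integral_same, add_zero], hYd⟩
  have hval : ∀ t ∈ Ioc 0 T, (A₀ t + lam • A₁ t) (Y lam t) =
      ((Y lam t).2 + s t * (Y lam t).1,
        -(s t * (Y lam t).2) - s t ^ 2 * (Y lam t).1 - lam * (Y lam t).1) := by
    intro t ht
    rw [hA₀, hA₁, indicator_of_mem ht, indicator_of_mem ht, slMatrix_apply]
  have hint : IntervalIntegrable (fun t => (A₀ t + lam • A₁ t) (Y lam t)) volume 0 T := by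
    have hy1 : Continuous fun t => (Y lam t).1 := continuous_fst.comp (hYc lam)
    have hy2 : Continuous fun t => (Y lam t).2 := continuous_snd.comp (hYc lam)
    have g1 : IntervalIntegrable (fun t => (Y lam t).2 + s t * (Y lam t).1) volume 0 T :=
      (hy2.intervalIntegrable _ _).add
        ((hs.intervalIntegrable_of_Ioo hT).mul_continuousOn hy1.continuousOn)
    have g2 : IntervalIntegrable
        (fun t => -(s t * (Y lam t).2) - s t ^ 2 * (Y lam t).1 - lam * (Y lam t).1) volume 0 T :=
      (((hs.intervalIntegrable_of_Ioo hT).mul_continuousOn hy2.continuousOn).neg.sub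
        ((hs.intervalIntegrable_sq_of_Ioo hT).mul_continuousOn hy1.continuousOn)).sub
        ((hy1.intervalIntegrable _ _).const_mul lam)
    rw [intervalIntegrable_iff_integrableOn_Ioc_of_le hT] at g1 g2 ⊢
    exact (Integrable.prodMk g1 g2).congr ((ae_restrict_iff' measurableSet_Ioc).mpr
      (ae_of_all _ fun t ht => (hval t ht).symm))
  have hYeq : Y lam = fun x => (a, b) + ∫ t in (0 : ℝ)..x, (A₀ t + lam • A₁ t) (Y lam t) :=
    funext fun x => hYe lam x
  have hac : AbsolutelyContinuousOnInterval (Y lam) 0 T :=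
    hint.absolutelyContinuousOnInterval_primitive.of_dist_le (K := 1) fun x _ y _ => by
      rw [hYe lam x, hYe lam y, dist_add_left, one_mul]
  have hder : ∀ᵐ x ∂(volume.restrict (Ioo 0 T)), HasDerivAt (Y lam)
      ((Y lam x).2 + s x * (Y lam x).1,
        -(s x * (Y lam x).2) - s x ^ 2 * (Y lam x).1 - lam * (Y lam x).1) x := by
    have h1 := hint.ae_hasDerivAt_integral
    rw [← ae_restrict_Ioo_iff hT] at h1
    filter_upwards [h1, ae_restrict_mem measurableSet_Ioo] with x hx hm
    rw [← hval x (Ioo_subset_Ioc_self hm)]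
    conv in (Y lam) => rw [hYeq]
    exact (hx 0 (by simp)).const_add _
  refine ⟨hac.of_dist_le (K := 1) fun x _ y _ => ?_, hac.of_dist_le (K := 1) fun x _ y _ => ?_,
    ?_, ?_⟩
  · rw [one_mul]; exact le_max_left _ _
  · rw [one_mul]; exact le_max_right _ _
  · filter_upwards [hder] with x hx using hx.fst
  · filter_upwards [hder] with x hx using hx.snd

lemma slSolution_spec (hT : 0 ≤ T) (hs : MemLp s 2 (volume.restrict (Ioo 0 T))) (lam a b : ℂ) :
    IsSLSolution T s lam (slSolution T s lam a b).1 (slSolution T s lam a b).2 ∧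
      (slSolution T s lam a b).1 0 = a ∧ (slSolution T s lam a b).2 0 = b := by
  obtain ⟨Y, -, hY, h0, -⟩ := exists_isSLSolution hT hs a b
  exact Classical.epsilon_spec (p := fun Y : (ℝ → ℂ) × (ℝ → ℂ) =>
    IsSLSolution T s lam Y.1 Y.2 ∧ Y.1 0 = a ∧ Y.2 0 = b)
    ⟨(fun x => (Y lam x).1, fun x => (Y lam x).2), hY lam, by simp [h0], by simp [h0]⟩

lemma slSolution_eq (h : IsSLSolution T s lam y y1) (hT : 0 ≤ T)
    (hs : MemLp s 2 (volume.restrict (Ioo 0 T))) :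
    (slSolution T s lam (y 0) (y1 0)).1 T = y T ∧ (slSolution T s lam (y 0) (y1 0)).2 T = y1 T := by
  obtain ⟨h1, h2, h3⟩ := slSolution_spec hT hs lam (y 0) (y1 0)
  exact h1.unique h hT hs h2 h3 ⟨hT, le_rfl⟩

end SturmLiouville

/-! ### Tools for `L₂` norms -/

section LTwo

open Filter Topology

lemma sq_eLpNorm_two {α E : Type*} [MeasurableSpace α] [ENorm E] (f : α → E)
    (μ : Measure α) : eLpNorm f 2 μ ^ 2 = ∫⁻ x, ‖f x‖ₑ ^ 2 ∂μ := by
  have := eLpNorm_nnreal_pow_eq_lintegral (f := f) (μ := μ) (p := 2) (by norm_num)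
  simpa using this

lemma eLpNorm_two_le_iff {α E : Type*} [MeasurableSpace α] [ENorm E] {f : α → E}
    {μ : Measure α} {K : ℝ≥0∞} : eLpNorm f 2 μ ≤ K ↔ ∫⁻ x, ‖f x‖ₑ ^ 2 ∂μ ≤ K ^ 2 := by
  rw [← sq_eLpNorm_two]
  exact (ENNReal.pow_le_pow_left_iff two_ne_zero).symm

lemma lintegral_enorm_mul_le {α : Type*} [MeasurableSpace α] {μ : Measure α} {f g : α → ℂ}
    (hf : AEStronglyMeasurable f μ) (hg : AEStronglyMeasurable g μ) :
    ∫⁻ x, ‖f x‖ₑ * ‖g x‖ₑ ∂μ ≤ eLpNorm f 2 μ * eLpNorm g 2 μ := by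
  have := eLpNorm_smul_le_mul_eLpNorm (p := 2) (q := 2) (r := 1) hg hf
  rw [eLpNorm_one_eq_lintegral_enorm] at this
  simpa [enorm_mul] using this

/-- The Cauchy-Schwarz inequality for the measure a dμ, from the factorization a f = √a · (√a f). -/
lemma sq_lintegral_mul_le {α : Type*} [MeasurableSpace α] {μ : Measure α} {a f : α → ℝ≥0∞}
    (ha : AEMeasurable a μ) (hf : AEMeasurable f μ) :
    (∫⁻ x, a x * f x ∂μ) ^ 2 ≤ (∫⁻ x, a x ∂μ) * ∫⁻ x, a x * f x ^ 2 ∂μ := by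
  have h := ENNReal.lintegral_mul_le_Lp_mul_Lq μ (Real.HolderConjugate.two_two)
    (f := fun x => a x ^ (1 / 2 : ℝ)) (g := fun x => a x ^ (1 / 2 : ℝ) * f x)
    (ha.pow_const _) ((ha.pow_const _).mul hf)
  have e : ∀ x : ℝ≥0∞, x ^ (1 / 2 : ℝ) * x ^ (1 / 2 : ℝ) = x := fun x => by
    rw [← ENNReal.rpow_add_of_nonneg _ _ (by norm_num) (by norm_num)]; norm_num
  have e1 : ∀ x, ((fun x => a x ^ (1 / 2 : ℝ)) * fun x => a x ^ (1 / 2 : ℝ) * f x) x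
      = a x * f x := fun x => by
    simp only [Pi.mul_apply]; rw [← mul_assoc, e]
  have e2 : ∀ x, (a x ^ (1 / 2 : ℝ)) ^ (2 : ℝ) = a x := fun x => by
    rw [← ENNReal.rpow_mul]; norm_num
  have e3 : ∀ x, (a x ^ (1 / 2 : ℝ) * f x) ^ (2 : ℝ) = a x * f x ^ 2 := fun x => by
    rw [ENNReal.mul_rpow_of_nonneg _ _ (by norm_num), e2]; norm_num
  simp only [e1, e2, e3] at h
  calc _ ≤ _ := pow_le_pow_left₀ (zero_le) h 2
    _ = _ := by
      rw [mul_pow, ← ENNReal.rpow_natCast, ← ENNReal.rpow_natCast, ← ENNReal.rpow_mul,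
        ← ENNReal.rpow_mul]
      norm_num

lemma ENNReal.two_mul_mul_le_add_sq (a b : ℝ≥0∞) : 2 * a * b ≤ a ^ 2 + b ^ 2 := by
  wlog h : a ≤ b generalizing a b
  · rw [mul_right_comm, add_comm]
    exact this b a (le_of_not_ge h)
  obtain ⟨c, rfl⟩ := exists_add_of_le h
  calc 2 * a * (a + c) ≤ 2 * a * (a + c) + c ^ 2 := le_self_add
    _ = _ := by ring

lemma aemeasurable_lintegral_mul_enorm {α β : Type*} [MeasurableSpace α] [MeasurableSpace β]
    {μ : Measure α} [SFinite μ] {ν : Measure β} [SFinite ν] {a : β → ℝ≥0∞} (ha : AEMeasurable a ν)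
    {u : β → α → ℂ} (hu : Measurable (Function.uncurry u)) :
    AEMeasurable (fun ξ => ∫⁻ t, a t * ‖u t ξ‖ₑ ∂ν) μ := by
  have h1 : AEMeasurable (fun z : α × β => a z.2) (μ.prod ν) :=
    ha.comp_quasiMeasurePreserving Measure.quasiMeasurePreserving_snd
  have h2 : Measurable fun z : α × β => ‖u z.2 z.1‖ₑ := (hu.comp measurable_swap).enorm
  exact (h1.mul h2.aemeasurable).lintegral_prod_right'

/-- Minkowski's integral inequality for a family that is uniformly bounded in `L₂`. -/
lemma eLpNorm_two_le_of_le_lintegral {α β E : Type*} [MeasurableSpace α] [MeasurableSpace β]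
    [ENorm E]
    {μ : Measure α} [SFinite μ] {ν : Measure β} [SFinite ν] {a : β → ℝ≥0∞} (ha : AEMeasurable a ν)
    {u : β → α → ℂ} (hu : Measurable (Function.uncurry u)) {g : α → E}
    (hg : ∀ᵐ ξ ∂μ, ‖g ξ‖ₑ ≤ ∫⁻ t, a t * ‖u t ξ‖ₑ ∂ν) {A N : ℝ≥0∞} (hA : ∫⁻ t, a t ∂ν ≤ A)
    (hN : ∀ᵐ t ∂ν, eLpNorm (u t) 2 μ ≤ N) : eLpNorm g 2 μ ≤ A * N := by
  rw [eLpNorm_two_le_iff]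
  have hm : AEMeasurable (Function.uncurry fun ξ t => a t * ‖u t ξ‖ₑ ^ 2) (μ.prod ν) := by
    have h1 : AEMeasurable (fun z : α × β => a z.2) (μ.prod ν) :=
      ha.comp_quasiMeasurePreserving Measure.quasiMeasurePreserving_snd
    have h2 : Measurable fun z : α × β => ‖u z.2 z.1‖ₑ ^ 2 :=
      ((hu.comp measurable_swap).enorm).pow_const 2
    exact h1.mul h2.aemeasurable
  -- For exponent two, Minkowski's inequality is the weighted Cauchy-Schwarz inequality in t
  -- followed by Tonelli's theorem.
  calc ∫⁻ ξ, ‖g ξ‖ₑ ^ 2 ∂μ ≤ ∫⁻ ξ, A * ∫⁻ t, a t * ‖u t ξ‖ₑ ^ 2 ∂ν ∂μ := by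
        refine lintegral_mono_ae ?_
        filter_upwards [hg] with ξ hξ
        refine (pow_le_pow_left₀ (zero_le) hξ 2).trans ((sq_lintegral_mul_le ha ?_).trans ?_)
        · exact (hu.comp (measurable_id.prodMk measurable_const)).enorm.aemeasurable
        · gcongr
    _ = A * ∫⁻ t, a t * ∫⁻ ξ, ‖u t ξ‖ₑ ^ 2 ∂μ ∂ν := by
        have hm' : AEMeasurable (fun ξ => ∫⁻ t, a t * ‖u t ξ‖ₑ ^ 2 ∂ν) μ :=
          hm.lintegral_prod_right'
        rw [lintegral_const_mul'' _ hm', lintegral_lintegral_swap hm]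
        congr 1
        refine lintegral_congr fun t => ?_
        rw [lintegral_const_mul]
        exact (hu.comp (measurable_const.prodMk measurable_id)).enorm.pow_const 2
    _ ≤ A * ∫⁻ t, a t * N ^ 2 ∂ν := by
        gcongr 1
        refine lintegral_mono_ae ?_
        filter_upwards [hN] with t ht
        gcongr
        exact eLpNorm_two_le_iff.mp ht
    _ = A * ((∫⁻ t, a t ∂ν) * N ^ 2) := by rw [lintegral_mul_const'' _ ha]
    _ ≤ A * (A * N ^ 2) := by gcongr
    _ = (A * N) ^ 2 := by ring

/-- Absorption arguments need norms known to be finite, which is clear only on bounded intervals;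
bounds uniform in the interval pass to the whole line. -/
lemma eLpNorm_two_le_of_forall_restrict {E : Type*} [NormedAddCommGroup E] {g : ℝ → E}
    (hg : AEStronglyMeasurable g volume)
    {K : ℝ≥0∞} (h : ∀ n : ℕ, eLpNorm g 2 (volume.restrict (Icc (-n : ℝ) n)) ≤ K) :
    eLpNorm g 2 volume ≤ K := by
  rw [eLpNorm_two_le_iff]
  have hc : AECover (volume : Measure ℝ) atTop fun n : ℕ => Icc (-n : ℝ) n :=
    aecover_Icc (tendsto_neg_atTop_atBot.comp tendsto_natCast_atTop_atTop)
      tendsto_natCast_atTop_atTop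
  exact le_of_tendsto' (hc.lintegral_tendsto_of_nat (hg.enorm.pow_const 2))
    fun n => eLpNorm_two_le_iff.mp (h n)

/-! #### Fourier integrals -/

/-- The integral `∫ h(t) e^{2iξt} dt`. -/
noncomputable def fourierTwo (h : ℝ → ℂ) (ξ : ℝ) : ℂ :=
  ∫ t, h t * Complex.exp (2 * Complex.I * ξ * t)

lemma norm_exp_two_I (ξ t : ℝ) : ‖Complex.exp (2 * Complex.I * ξ * t)‖ = 1 := by
  rw [show (2 * Complex.I * ξ * t : ℂ) = ((2 * ξ * t : ℝ) : ℂ) * Complex.I by push_cast; ring,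
    Complex.norm_exp_ofReal_mul_I]

lemma gaussian_kernel_integral {ε : ℝ} (hε : 0 < ε) (u : ℝ) :
    ∫ ξ : ℝ, Complex.exp (-ε * ξ ^ 2) * Complex.exp (2 * Complex.I * ξ * u) =
      ((√(Real.pi / ε) * Real.exp (-(1 / ε) * u ^ 2) : ℝ) : ℂ) := by
  have h := fourierIntegral_gaussian (b := ε) (by simpa using hε) (2 * u)
  rw [show (fun ξ : ℝ => Complex.exp (-ε * ξ ^ 2) * Complex.exp (2 * Complex.I * ξ * u)) =
    fun x : ℝ => Complex.exp (Complex.I * (2 * u) * x) * Complex.exp (-ε * x ^ 2) by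
      ext x; rw [mul_comm]; ring_nf, h]
  rw [Complex.ofReal_mul, Complex.ofReal_exp, Real.sqrt_eq_rpow,
    Complex.ofReal_cpow (by positivity)]
  have : (ε : ℂ) ≠ 0 := by exact_mod_cast hε.ne'
  congr 2
  · push_cast; ring_nf
  · push_cast; ring_nf
  · push_cast; field_simp; ring

/-- The Gaussian kernel whose Fourier transform is `e^{-εξ²}`. -/
noncomputable def gaussianKernel (ε t s : ℝ) : ℝ≥0∞ :=
  ENNReal.ofReal (√(Real.pi / ε) * Real.exp (-(1 / ε) * (t - s) ^ 2))

lemma gaussianKernel_comm (ε t s : ℝ) : gaussianKernel ε t s = gaussianKernel ε s t := by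
  rw [gaussianKernel, gaussianKernel, show (t - s) ^ 2 = (s - t) ^ 2 by ring]

lemma measurable_gaussianKernel (ε : ℝ) :
    Measurable fun z : ℝ × ℝ => gaussianKernel ε z.1 z.2 := by
  unfold gaussianKernel; fun_prop

lemma lintegral_gaussianKernel {ε : ℝ} (hε : 0 < ε) (t : ℝ) :
    ∫⁻ s : ℝ, gaussianKernel ε t s = ENNReal.ofReal Real.pi := by
  unfold gaussianKernel
  rw [lintegral_sub_left_eq_self
    (fun v => ENNReal.ofReal (√(Real.pi / ε) * Real.exp (-(1 / ε) * v ^ 2))) t]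
  have hi : Integrable fun v : ℝ => √(Real.pi / ε) * Real.exp (-(1 / ε) * v ^ 2) :=
    (integrable_exp_neg_mul_sq (by positivity)).const_mul _
  rw [← ofReal_integral_eq_lintegral_ofReal hi (ae_of_all _ fun v => by positivity),
    integral_const_mul, integral_gaussian, ← Real.sqrt_mul (by positivity)]
  congr 1
  rw [show Real.pi / ε * (Real.pi / (1 / ε)) = Real.pi ^ 2 by field_simp,
    Real.sqrt_sq Real.pi_pos.le]

lemma lintegral_mul_gaussianKernel {h : ℝ → ℝ≥0∞} (hhm : AEMeasurable h volume) {ε : ℝ}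
    (hε : 0 < ε) :
    AEMeasurable (fun z : ℝ × ℝ => h z.1 * gaussianKernel ε z.1 z.2) (volume.prod volume) ∧
    ∫⁻ z : ℝ × ℝ, h z.1 * gaussianKernel ε z.1 z.2 ∂(volume.prod volume) =
      ENNReal.ofReal Real.pi * ∫⁻ t, h t ∧
    ∫⁻ z : ℝ × ℝ, h z.2 * gaussianKernel ε z.1 z.2 ∂(volume.prod volume) =
      ENNReal.ofReal Real.pi * ∫⁻ t, h t := by
  have hhK : AEMeasurable (fun z : ℝ × ℝ => h z.1 * gaussianKernel ε z.1 z.2)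
      (volume.prod volume) :=
    (hhm.comp_quasiMeasurePreserving Measure.quasiMeasurePreserving_fst).mul
      (measurable_gaussianKernel ε).aemeasurable
  have hI1 : ∫⁻ z : ℝ × ℝ, h z.1 * gaussianKernel ε z.1 z.2 ∂(volume.prod volume) =
      ENNReal.ofReal Real.pi * ∫⁻ t, h t := by
    rw [lintegral_prod _ hhK, mul_comm, ← lintegral_mul_const'' _ hhm]
    refine lintegral_congr fun t => ?_
    have hKt : Measurable fun s => gaussianKernel ε t s := by
      unfold gaussianKernel; fun_prop
    change ∫⁻ s, h t * gaussianKernel ε t s = _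
    rw [lintegral_const_mul _ hKt, lintegral_gaussianKernel hε]
  refine ⟨hhK, hI1, ?_⟩
  rw [← hI1, ← lintegral_prod_swap]
  refine lintegral_congr fun z => ?_
  rw [Prod.fst_swap, Prod.snd_swap, gaussianKernel_comm]

lemma continuous_fourierTwo {h : ℝ → ℂ} (hi : Integrable h) : Continuous (fourierTwo h) := by
  refine continuous_of_dominated (bound := fun t => ‖h t‖) (fun ξ => ?_) (fun ξ => ?_) hi.norm ?_
  · exact hi.aestronglyMeasurable.mul (by fun_prop : Continuous _).aestronglyMeasurable
  · exact ae_of_all _ fun t => by rw [norm_mul, norm_exp_two_I, mul_one]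
  · exact ae_of_all _ fun t => by fun_prop

-- With the Gaussian factor Fubini's theorem is applicable and turns the left side into ∬ h(t)
-- conj(h(s)) K(t − s) for a positive Gaussian kernel K of total mass π. The bound is then the Schur
-- test, from 2|h(t)h(s)| ≤ |h(t)|² + |h(s)|².
set_option maxHeartbeats 800000 in
lemma gaussian_fourierTwo_le {h : ℝ → ℂ} (hi : Integrable h) {ε : ℝ} (hε : 0 < ε) :
    ∫⁻ ξ : ℝ, ENNReal.ofReal (Real.exp (-ε * ξ ^ 2)) * ‖fourierTwo h ξ‖ₑ ^ 2 ≤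
      ENNReal.ofReal Real.pi * ∫⁻ t, ‖h t‖ₑ ^ 2 := by
  set Φ : ℝ → ℝ × ℝ → ℂ := fun ξ z => Complex.exp (-ε * ξ ^ 2) *
    ((h z.1 * Complex.exp (2 * Complex.I * ξ * z.1)) *
      (starRingEnd ℂ) (h z.2 * Complex.exp (2 * Complex.I * ξ * z.2))) with hΦ
  have hg : Integrable fun ξ : ℝ => Complex.exp (-ε * ξ ^ 2) :=
    integrable_cexp_neg_mul_sq (by simpa using hε)
  have hbase : Integrable (fun w : ℝ × ℝ × ℝ => Complex.exp (-ε * w.1 ^ 2) *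
      (h w.2.1 * (starRingEnd ℂ) (h w.2.2))) (volume.prod (volume.prod volume)) := by
    have hc : Integrable (fun s => (starRingEnd ℂ) (h s)) :=
      (integrable_norm_iff (Complex.continuous_conj.comp_aestronglyMeasurable
        hi.aestronglyMeasurable)).mp (by simpa using hi.norm)
    have h2 : Integrable (fun z : ℝ × ℝ => h z.1 * (starRingEnd ℂ) (h z.2))
      (volume.prod volume) := Integrable.mul_prod hi hc
    exact Integrable.mul_prod (f := fun ξ : ℝ => Complex.exp (-ε * ξ ^ 2)) hg h2
  have hΦeq : ∀ ξ z, Φ ξ z = Complex.exp (-ε * ξ ^ 2) * (h z.1 * (starRingEnd ℂ) (h z.2)) *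
      Complex.exp (2 * Complex.I * ξ * (z.1 - z.2 : ℝ)) := by
    intro ξ z
    simp only [hΦ, map_mul, ← Complex.exp_conj, map_mul, Complex.conj_ofReal, Complex.conj_I,
      map_ofNat]
    rw [show (2 * Complex.I * ξ * (z.1 - z.2 : ℝ) : ℂ) =
      2 * Complex.I * ξ * z.1 + 2 * -Complex.I * ξ * z.2 by push_cast; ring, Complex.exp_add]
    ring
  have hΦi : Integrable (Function.uncurry Φ) (volume.prod (volume.prod volume)) := by
    refine hbase.norm.mono' ?_ (ae_of_all _ fun w => ?_)
    · have : Function.uncurry Φ = fun w : ℝ × ℝ × ℝ => (Complex.exp (-ε * w.1 ^ 2) *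
        (h w.2.1 * (starRingEnd ℂ) (h w.2.2))) *
          Complex.exp (2 * Complex.I * w.1 * (w.2.1 - w.2.2 : ℝ)) := by
        ext w; exact hΦeq w.1 w.2
      rw [this]
      exact hbase.aestronglyMeasurable.mul (by fun_prop : Continuous _).aestronglyMeasurable
    · change ‖Φ w.1 w.2‖ ≤ _
      rw [hΦeq, norm_mul, norm_exp_two_I, mul_one]
  have hJ : ∫ ξ : ℝ, Complex.exp (-ε * ξ ^ 2) *
      (fourierTwo h ξ * (starRingEnd ℂ) (fourierTwo h ξ)) =
      ∫ z : ℝ × ℝ, (h z.1 * (starRingEnd ℂ) (h z.2)) *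
        ((√(Real.pi / ε) * Real.exp (-(1 / ε) * (z.1 - z.2) ^ 2) : ℝ) : ℂ)
          ∂(volume.prod volume) := by
    calc _ = ∫ ξ : ℝ, ∫ z : ℝ × ℝ, Φ ξ z ∂(volume.prod volume) := by
          congr 1; ext ξ
          simp only [hΦ]
          rw [integral_const_mul, integral_prod_mul
            (fun t : ℝ => h t * Complex.exp (2 * Complex.I * ξ * t))
            (fun s : ℝ => (starRingEnd ℂ) (h s * Complex.exp (2 * Complex.I * ξ * s))),
            integral_conj]
          rfl
      _ = ∫ z : ℝ × ℝ, (∫ ξ : ℝ, Φ ξ z) ∂(volume.prod volume) := integral_integral_swap hΦi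
      _ = _ := by
          congr 1; ext z
          rw [← gaussian_kernel_integral hε, ← integral_const_mul]
          congr 1; ext ξ
          rw [hΦeq]; ring
  have hlhs : ∫⁻ ξ : ℝ, ENNReal.ofReal (Real.exp (-ε * ξ ^ 2)) * ‖fourierTwo h ξ‖ₑ ^ 2 =
      ‖∫ ξ : ℝ, Complex.exp (-ε * ξ ^ 2) *
        (fourierTwo h ξ * (starRingEnd ℂ) (fourierTwo h ξ))‖ₑ := by
    have hint : Integrable fun ξ : ℝ => Real.exp (-ε * ξ ^ 2) * ‖fourierTwo h ξ‖ ^ 2 := by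
      refine (integrable_exp_neg_mul_sq hε).mul_bdd (c := (∫ t, ‖h t‖) ^ 2)
        ((continuous_fourierTwo hi).norm.pow 2).aestronglyMeasurable (ae_of_all _ fun ξ => ?_)
      rw [norm_pow, norm_norm]
      gcongr
      refine (norm_integral_le_integral_norm _).trans (le_of_eq ?_)
      congr 1; ext t; rw [norm_mul, norm_exp_two_I, mul_one]
    have e : ∀ ξ : ℝ, Complex.exp (-ε * ξ ^ 2) *
        (fourierTwo h ξ * (starRingEnd ℂ) (fourierTwo h ξ)) =
        ((Real.exp (-ε * ξ ^ 2) * ‖fourierTwo h ξ‖ ^ 2 : ℝ) : ℂ) := fun ξ => by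
      rw [Complex.mul_conj, Complex.normSq_eq_norm_sq]; push_cast; ring
    simp_rw [e]
    rw [integral_complex_ofReal, ← ofReal_norm, Complex.norm_real, Real.norm_of_nonneg
      (integral_nonneg fun ξ => by positivity),
      ofReal_integral_eq_lintegral_ofReal hint (ae_of_all _ fun ξ => by positivity)]
    refine lintegral_congr fun ξ => ?_
    rw [ENNReal.ofReal_mul (Real.exp_pos _).le, ENNReal.ofReal_pow (norm_nonneg _),
      ofReal_norm]
  obtain ⟨hhK, hI1, hI2⟩ := lintegral_mul_gaussianKernel
    (hi.aestronglyMeasurable.enorm.pow_const 2) hε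
  rw [hlhs, hJ]
  refine (enorm_integral_le_lintegral_enorm _).trans ?_
  have hle : ∀ z : ℝ × ℝ, 2 * ‖(h z.1 * (starRingEnd ℂ) (h z.2)) *
        ((√(Real.pi / ε) * Real.exp (-(1 / ε) * (z.1 - z.2) ^ 2) : ℝ) : ℂ)‖ₑ ≤
      ‖h z.1‖ₑ ^ 2 * gaussianKernel ε z.1 z.2 + ‖h z.2‖ₑ ^ 2 * gaussianKernel ε z.1 z.2 := by
    intro z
    have e1 : ‖((√(Real.pi / ε) * Real.exp (-(1 / ε) * (z.1 - z.2) ^ 2) : ℝ) : ℂ)‖ₑ =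
        gaussianKernel ε z.1 z.2 := by
      rw [← ofReal_norm, Complex.norm_real, Real.norm_of_nonneg (by positivity), gaussianKernel]
    have e2 : ‖(starRingEnd ℂ) (h z.2)‖ₑ = ‖h z.2‖ₑ := by
      rw [← ofReal_norm, ← ofReal_norm, RCLike.norm_conj]
    rw [enorm_mul, enorm_mul, e1, e2, ← add_mul, ← mul_assoc, ← mul_assoc]
    gcongr
    exact ENNReal.two_mul_mul_le_add_sq _ _
  have h2 : 2 * ∫⁻ z : ℝ × ℝ, ‖(h z.1 * (starRingEnd ℂ) (h z.2)) *
        ((√(Real.pi / ε) * Real.exp (-(1 / ε) * (z.1 - z.2) ^ 2) : ℝ) : ℂ)‖ₑ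
          ∂(volume.prod volume) ≤ 2 * (ENNReal.ofReal Real.pi * ∫⁻ t, ‖h t‖ₑ ^ 2) := by
    rw [← lintegral_const_mul' _ _ (by norm_num)]
    refine (lintegral_mono hle).trans ?_
    rw [lintegral_add_left' hhK, hI1, hI2, two_mul]
  exact (ENNReal.mul_le_mul_iff_right (by norm_num) (by norm_num)).mp h2

/-- Plancherel's inequality. -/
lemma eLpNorm_fourierTwo_le {h : ℝ → ℂ} (hi : Integrable h) :
    eLpNorm (fourierTwo h) 2 volume ≤ ENNReal.ofReal 2 * eLpNorm h 2 volume := by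
  rw [eLpNorm_two_le_iff, mul_pow, sq_eLpNorm_two]
  -- The constant √π is rounded up to 2. Afterwards ε → 0 in the Gaussian factor, by Fatou's lemma.
  have hpi : ENNReal.ofReal Real.pi ≤ ENNReal.ofReal 2 ^ 2 := by
    rw [← ENNReal.ofReal_pow (by norm_num)]
    exact ENNReal.ofReal_le_ofReal (by linarith [Real.pi_le_four])
  refine le_trans ?_ (mul_le_mul_left hpi _)
  have hlim : ∀ ξ : ℝ, Tendsto (fun n : ℕ => ENNReal.ofReal
      (Real.exp (-(1 / ((n : ℝ) + 1)) * ξ ^ 2)) * ‖fourierTwo h ξ‖ₑ ^ 2) atTop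
      (𝓝 (‖fourierTwo h ξ‖ₑ ^ 2)) := by
    intro ξ
    have h1 : Tendsto (fun n : ℕ => Real.exp (-(1 / ((n : ℝ) + 1)) * ξ ^ 2)) atTop (𝓝 1) := by
      have := ((tendsto_one_div_add_atTop_nhds_zero_nat (𝕜 := ℝ)).neg.mul_const (ξ ^ 2))
      simpa [Function.comp_def] using (Real.continuous_exp.tendsto _).comp this
    have h2 := ENNReal.Tendsto.mul_const (b := ‖fourierTwo h ξ‖ₑ ^ 2)
      ((ENNReal.continuous_ofReal.tendsto _).comp h1) (Or.inr (by finiteness))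
    simpa using h2
  calc ∫⁻ ξ, ‖fourierTwo h ξ‖ₑ ^ 2
      = ∫⁻ ξ, liminf (fun n : ℕ => ENNReal.ofReal
        (Real.exp (-(1 / ((n : ℝ) + 1)) * ξ ^ 2)) * ‖fourierTwo h ξ‖ₑ ^ 2) atTop :=
        lintegral_congr fun ξ => ((hlim ξ).liminf_eq).symm
    _ ≤ _ := lintegral_liminf_le' fun n => by
        have h1 : Measurable fun ξ : ℝ =>
            ENNReal.ofReal (Real.exp (-(1 / ((n : ℝ) + 1)) * ξ ^ 2)) := by fun_prop
        exact (h1.mul ((continuous_fourierTwo hi).measurable.enorm.pow_const 2)).aemeasurable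
    _ ≤ _ := liminf_le_of_le (by isBoundedDefault) fun b hb => by
        obtain ⟨n, hn⟩ := hb.exists
        exact hn.trans (gaussian_fourierTwo_le hi (by positivity))

end LTwo

/-! ### Entire functions of exponential type -/

section ExpType

open Filter Topology

/-- `f` is an entire function with `|f(z)| ≤ C e^{B|z|}` for some `C`. -/
def HasExpType (B : ℝ) (f : ℂ → ℂ) : Prop :=
  Differentiable ℂ f ∧ ∃ C, ∀ z, ‖f z‖ ≤ C * Real.exp (B * ‖z‖)

lemma HasExpType.exists_pos {B : ℝ} {f : ℂ → ℂ} (hf : HasExpType B f) :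
    ∃ C, 0 < C ∧ ∀ z, ‖f z‖ ≤ C * Real.exp (B * ‖z‖) := by
  obtain ⟨-, C, hC⟩ := hf
  refine ⟨max C 1, lt_max_of_lt_right one_pos, fun z => (hC z).trans ?_⟩
  gcongr
  exact le_max_left _ _

lemma HasExpType.add {B : ℝ} {f g : ℂ → ℂ} (hf : HasExpType B f) (hg : HasExpType B g) :
    HasExpType B (fun z => f z + g z) := by
  obtain ⟨C, -, hC⟩ := hf.exists_pos
  obtain ⟨D, -, hD⟩ := hg.exists_pos
  refine ⟨hf.1.add hg.1, C + D, fun z => (norm_add_le _ _).trans ?_⟩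
  rw [add_mul]; exact add_le_add (hC z) (hD z)

lemma HasExpType.mul {A B : ℝ} {f g : ℂ → ℂ} (hf : HasExpType A f) (hg : HasExpType B g) :
    HasExpType (A + B) (fun z => f z * g z) := by
  obtain ⟨C, hC0, hC⟩ := hf.exists_pos
  obtain ⟨D, -, hD⟩ := hg.exists_pos
  refine ⟨hf.1.mul hg.1, C * D, fun z => ?_⟩
  rw [norm_mul, add_mul, Real.exp_add]
  calc _ ≤ (C * Real.exp (A * ‖z‖)) * (D * Real.exp (B * ‖z‖)) := by gcongr; exacts [hC z, hD z]
    _ = _ := by ring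

lemma HasExpType.const (c : ℂ) : HasExpType 0 (fun _ => c) :=
  ⟨differentiable_const c, ‖c‖, fun z => by simp⟩

lemma HasExpType.mono {A B : ℝ} {f : ℂ → ℂ} (hf : HasExpType A f) (hAB : A ≤ B) :
    HasExpType B f := by
  obtain ⟨C, hC0, hC⟩ := hf.exists_pos
  refine ⟨hf.1, C, fun z => (hC z).trans ?_⟩
  gcongr

lemma HasExpType.neg {B : ℝ} {f : ℂ → ℂ} (hf : HasExpType B f) : HasExpType B (fun z => -f z) :=
  ⟨hf.1.neg, by simpa using hf.2⟩

lemma HasExpType.sub {B : ℝ} {f g : ℂ → ℂ} (hf : HasExpType B f) (hg : HasExpType B g) :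
    HasExpType B (fun z => f z - g z) := by
  simpa [sub_eq_add_neg] using hf.add hg.neg

lemma HasExpType.sum {ι : Type*} (s : Finset ι) {B : ℝ} (hB : 0 ≤ B) {f : ι → ℂ → ℂ}
    (hf : ∀ i ∈ s, HasExpType B (f i)) : HasExpType B (fun z => ∑ i ∈ s, f i z) := by
  classical
  induction s using Finset.induction_on with
  | empty => simpa using (HasExpType.const 0).mono hB
  | insert a s ha ih =>
    simp only [Finset.sum_insert ha]
    exact (hf a (by simp)).add (ih fun i hi => hf i (by simp [hi]))

lemma HasExpType.prod {ι : Type*} (s : Finset ι) {B : ι → ℝ} {f : ι → ℂ → ℂ}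
    (hf : ∀ i ∈ s, HasExpType (B i) (f i)) :
    HasExpType (∑ i ∈ s, B i) (fun z => ∏ i ∈ s, f i z) := by
  classical
  induction s using Finset.induction_on with
  | empty => simpa using HasExpType.const 1
  | insert a s ha ih =>
    simp only [Finset.prod_insert ha, Finset.sum_insert ha]
    exact (hf a (by simp)).mul (ih fun i hi => hf i (by simp [hi]))

lemma HasExpType.pow (n : ℕ) : HasExpType 1 (fun z => z ^ n) := by
  refine ⟨differentiable_id.pow n, n.factorial, fun z => ?_⟩
  rw [norm_pow, one_mul]
  have := Real.pow_div_factorial_le_exp ‖z‖ (norm_nonneg z) n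
  rwa [div_le_iff₀' (by positivity)] at this

lemma HasExpType.comp_add {B : ℝ} (hB : 0 ≤ B) {f : ℂ → ℂ} (hf : HasExpType B f) (w : ℂ) :
    HasExpType B (fun z => f (z + w)) := by
  obtain ⟨C, hC0, hC⟩ := hf.exists_pos
  refine ⟨hf.1.comp (differentiable_id.add_const w), C * Real.exp (B * ‖w‖), fun z => ?_⟩
  refine (hC _).trans ?_
  rw [mul_assoc, ← Real.exp_add, ← mul_add]
  gcongr
  rw [add_comm]; exact norm_add_le _ _

lemma HasExpType.comp_neg {B : ℝ} {f : ℂ → ℂ} (hf : HasExpType B f) :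
    HasExpType B (fun z => f (-z)) := by
  obtain ⟨hd, C, hC⟩ := hf
  exact ⟨hd.comp differentiable_neg, C, fun z => by simpa using hC (-z)⟩

/-- The Phragmén-Lindelöf principle. The substitution z = iw maps the right half-plane to the upper
one; the factor e^{-Bw} cancels the growth on the positive axis and has modulus one on the imaginary
axis, where the values of F on the real line appear. -/
lemma HasExpType.norm_le_of_forall_real {B M : ℝ} {F : ℂ → ℂ} (hF : HasExpType B F)
    (hM : ∀ x : ℝ, ‖F x‖ ≤ M) {τ : ℝ} (hτ : 0 ≤ τ) :
    ‖F (τ * Complex.I)‖ ≤ M * Real.exp (B * τ) := by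
  obtain ⟨C, hC0, hC⟩ := hF.exists_pos
  set g : ℂ → ℂ := fun w => Complex.exp (-B * w) * F (w * Complex.I) with hg
  have hgd : Differentiable ℂ g := by
    have := hF.1
    exact (by fun_prop : Differentiable ℂ fun w : ℂ => Complex.exp (-B * w)).mul
      (this.comp (differentiable_id.mul_const _))
  have hre : ∀ w : ℂ, ‖g w‖ = Real.exp (-B * w.re) * ‖F (w * Complex.I)‖ := fun w => by
    simp only [hg, norm_mul, Complex.norm_exp]
    congr 2
    simp
  have key := PhragmenLindelof.right_half_plane_of_bounded_on_real (f := g) (C := M) (z := τ)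
    hgd.diffContOnCl ⟨1, by norm_num, |B| + |B|, ?_⟩ ?_ ?_ (by simpa using hτ)
  · rw [hre, Complex.ofReal_re] at key
    rw [neg_mul, Real.exp_neg, inv_mul_le_iff₀ (Real.exp_pos _)] at key
    linarith
  · refine Asymptotics.IsBigO.of_bound C (Eventually.of_forall fun w => ?_)
    rw [hre, Real.norm_of_nonneg (Real.exp_pos _).le, Real.rpow_one]
    have h1 := hC (w * Complex.I)
    rw [norm_mul, Complex.norm_I, mul_one] at h1
    have h2 : Real.exp (-B * w.re) ≤ Real.exp (|B| * ‖w‖) := by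
      refine Real.exp_le_exp.mpr ((le_abs_self _).trans ?_)
      rw [abs_mul, abs_neg]
      gcongr; exact Complex.abs_re_le_norm w
    have h3 : Real.exp (B * ‖w‖) ≤ Real.exp (|B| * ‖w‖) := by
      gcongr; exact le_abs_self B
    rw [add_mul, Real.exp_add]
    calc _ ≤ Real.exp (|B| * ‖w‖) * (C * Real.exp (|B| * ‖w‖)) := by
          gcongr; exact h1.trans (mul_le_mul_of_nonneg_left h3 hC0.le)
      _ = _ := by ring
  · refine isBoundedUnder_of_eventually_le (a := C) ((eventually_ge_atTop 0).mono fun x hx => ?_)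
    rw [hre, Complex.ofReal_re]
    have h1 := hC (x * Complex.I)
    rw [norm_mul, Complex.norm_I, mul_one, Complex.norm_real, Real.norm_of_nonneg hx] at h1
    calc _ ≤ Real.exp (-B * x) * (C * Real.exp (B * x)) := by gcongr
      _ = C := by rw [mul_left_comm, ← Real.exp_add]; simp
  · intro x
    rw [hre]
    have : (x * Complex.I * Complex.I : ℂ) = ((-x : ℝ) : ℂ) := by
      rw [mul_assoc, Complex.I_mul_I]; simp
    rw [this]
    simpa using hM (-x)

lemma differentiable_integral_translate {f : ℂ → ℂ} (hf : Differentiable ℂ f) {g : ℝ → ℂ}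
    (hg : Continuous g) (R : ℝ) : Differentiable ℂ fun z => ∫ x in (-R)..R, f (z + x) * g x := by
  intro z₀
  have hd : Continuous (deriv f) := hf.contDiff.continuous_deriv (n := 1) (by norm_num)
  obtain ⟨C, hC⟩ := (isCompact_closedBall z₀ (1 + |R|)).exists_bound_of_continuousOn
    hd.continuousOn
  refine ((intervalIntegral.hasDerivAt_integral_of_dominated_loc_of_deriv_le (μ := volume)
    (F := fun z (x : ℝ) => f (z + x) * g x) (F' := fun z (x : ℝ) => deriv f (z + x) * g x)
    (bound := fun x => C * ‖g x‖) (s := Metric.ball z₀ 1) (Metric.ball_mem_nhds _ one_pos)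
    (Eventually.of_forall fun z => ?_) ?_ ?_ (ae_of_all _ fun x hx z hz => ?_) ?_
    (ae_of_all _ fun x hx z hz => ?_)).2).differentiableAt
  · have := hf.continuous
    exact (by fun_prop : Continuous fun x : ℝ => f (z + x) * g x).aestronglyMeasurable
  · have := hf.continuous
    exact (by fun_prop : Continuous fun x : ℝ => f (z₀ + x) * g x).intervalIntegrable _ _
  · exact (by fun_prop : Continuous fun x : ℝ => deriv f (z₀ + x) * g x).aestronglyMeasurable
  · rw [norm_mul]
    gcongr
    refine hC _ ?_
    have hx' : |x| ≤ |R| := by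
      rcases mem_uIoc.mp hx with h | h
      · exact (abs_le.mpr ⟨h.1.le, h.2⟩).trans (le_abs_self R)
      · exact (abs_le.mpr ⟨by linarith, by linarith⟩ : |x| ≤ -R).trans (neg_le_abs R)
    rw [Metric.mem_ball, dist_eq_norm] at hz
    rw [Metric.mem_closedBall, dist_eq_norm, add_sub_right_comm]
    refine (norm_add_le _ _).trans (add_le_add hz.le ?_)
    rwa [Complex.norm_real]
  · exact (by fun_prop : Continuous fun x : ℝ => C * ‖g x‖).intervalIntegrable _ _
  · have h1 : HasDerivAt f (deriv f (z + x)) (z + x) := (hf _).hasDerivAt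
    exact (h1.comp_add_const z x).mul_const (g x)

lemma hasExpType_integral_translate {B : ℝ} (hB : 0 ≤ B) {f : ℂ → ℂ} (hf : HasExpType B f)
    {g : ℝ → ℂ} (hg : Continuous g) (R : ℝ) :
    HasExpType B fun z => ∫ x in (-R)..R, f (z + x) * g x := by
  refine ⟨differentiable_integral_translate hf.1 hg R, ?_⟩
  obtain ⟨C, hC0, hC⟩ := hf.exists_pos
  obtain ⟨D, hD⟩ := (isCompact_Icc (a := -|R|) (b := |R|)).exists_bound_of_continuousOn
    hg.continuousOn
  refine ⟨C * Real.exp (B * |R|) * D * |R - -R|, fun z => ?_⟩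
  have := intervalIntegral.norm_integral_le_of_norm_le_const (a := -R) (b := R)
    (f := fun x : ℝ => f (z + x) * g x) (C := C * Real.exp (B * (‖z‖ + |R|)) * D) fun x hx => by
      have hx' : |x| ≤ |R| := by
        rcases mem_uIoc.mp hx with h | h
        · exact (abs_le.mpr ⟨h.1.le, h.2⟩).trans (le_abs_self R)
        · exact (abs_le.mpr ⟨by linarith, by linarith⟩ : |x| ≤ -R).trans (neg_le_abs R)
      rw [norm_mul]
      have h1 : ‖z + x‖ ≤ ‖z‖ + |R| :=
        (norm_add_le _ _).trans (add_le_add le_rfl (by rwa [Complex.norm_real]))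
      gcongr
      · exact (hC _).trans (by gcongr)
      · exact hD x (abs_le.mp hx')
  refine this.trans (le_of_eq ?_)
  rw [mul_add, Real.exp_add]; ring

/-- The Plancherel-Pólya inequality. -/
theorem HasExpType.eLpNorm_shift_le {B : ℝ} (hB : 0 ≤ B) {f : ℂ → ℂ} (hf : HasExpType B f)
    {τ : ℝ} (hτ : 0 ≤ τ) :
    eLpNorm (fun x : ℝ => f (x + τ * Complex.I)) 2 volume ≤
      ENNReal.ofReal (Real.exp (B * τ)) * eLpNorm (fun x : ℝ => f x) 2 volume := by
  have hfc := hf.1.continuous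
  set u : ℝ → ℂ := fun x => f (x + τ * Complex.I) with hu
  have huc : Continuous u := by fun_prop
  set M := eLpNorm (fun x : ℝ => f x) 2 volume with hM
  by_cases hMtop : M = ∞
  · rw [hMtop, ENNReal.mul_top (by simpa using Real.exp_pos _)]; exact le_top
  refine eLpNorm_two_le_of_forall_restrict huc.aestronglyMeasurable fun n => ?_
  set ν : Measure ℝ := volume.restrict (Icc (-n : ℝ) n) with hν
  set N := eLpNorm u 2 ν with hN
  obtain ⟨D, hD⟩ := (isCompact_Icc (a := (-n : ℝ)) (b := n)).exists_bound_of_continuousOn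
    huc.continuousOn
  have hmem : MemLp u 2 ν := MemLp.of_bound huc.aestronglyMeasurable D
    ((ae_restrict_iff' measurableSet_Icc).mpr (ae_of_all _ hD))
  have hNtop : N ≠ ∞ := hmem.eLpNorm_ne_top
  set g : ℝ → ℂ := fun x => (starRingEnd ℂ) (u x) with hg
  have hgc : Continuous g := Complex.continuous_conj.comp huc
  have hn : (-n : ℝ) ≤ n := by linarith [(Nat.cast_nonneg n : (0 : ℝ) ≤ n)]
  -- Duality: with u(x) = f(x + iτ), the function z ↦ ∫ f(z + x) conj(u(x)) dx over [−n, n] inherits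
  -- the type of `f`, is at most M N on the real axis by Cauchy-Schwarz, and equals N² at z = iτ.
  -- Hence N² ≤ e^{Bτ} M N. The truncation makes N finite, so that one N can be cancelled.
  have hF := hasExpType_integral_translate hB hf hgc n
  have hgN : eLpNorm g 2 ν = N :=
    eLpNorm_congr_norm_ae (ae_of_all _ fun x => RCLike.norm_conj _)
  have hreal : ∀ t : ℝ, ‖∫ x in (-n : ℝ)..n, f (t + x) * g x‖ ≤ (M * N).toReal := by
    intro t
    rw [intervalIntegral.integral_of_le hn, ← integral_Icc_eq_integral_Ioc, ← toReal_enorm]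
    refine ENNReal.toReal_mono (ENNReal.mul_ne_top hMtop hNtop) ?_
    refine (enorm_integral_le_lintegral_enorm _).trans ?_
    simp_rw [enorm_mul]
    have hft : Continuous fun x : ℝ => f (t + x) := by fun_prop
    refine (lintegral_enorm_mul_le hft.aestronglyMeasurable hgc.aestronglyMeasurable).trans ?_
    rw [hgN]
    gcongr
    refine (eLpNorm_restrict_le _ _ _ _).trans (le_of_eq ?_)
    have := eLpNorm_comp_measurePreserving (p := 2) (g := fun x : ℝ => f x)
      (hfc.comp Complex.continuous_ofReal).aestronglyMeasurable
      (measurePreserving_add_left (volume : Measure ℝ) t)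
    rw [hM, ← this]
    congr 1; ext x; simp [Function.comp]
  have key := hF.norm_le_of_forall_real hreal hτ
  have hval : ∫ x in (-n : ℝ)..n, f (τ * Complex.I + x) * g x = ((N ^ 2).toReal : ℂ) := by
    rw [intervalIntegral.integral_of_le hn, ← integral_Icc_eq_integral_Ioc, hN, sq_eLpNorm_two]
    have e : ∀ x : ℝ, f (τ * Complex.I + x) * g x = ((‖u x‖ ^ 2 : ℝ) : ℂ) := fun x => by
      rw [add_comm, ← Complex.normSq_eq_norm_sq, ← Complex.mul_conj]
    simp_rw [e]
    rw [integral_complex_ofReal]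
    congr 1
    rw [integral_eq_lintegral_of_nonneg_ae (ae_of_all _ fun x => by positivity)
      (by fun_prop)]
    congr 1
    refine lintegral_congr fun x => ?_
    rw [ENNReal.ofReal_pow (norm_nonneg _), ofReal_norm]
  rw [hval, Complex.norm_real, Real.norm_of_nonneg ENNReal.toReal_nonneg, ENNReal.toReal_mul,
    ENNReal.toReal_pow] at key
  by_cases hN0 : N = 0
  · rw [hN0]; exact zero_le
  have hNpos : 0 < N.toReal := ENNReal.toReal_pos hN0 hNtop
  have h2 : N.toReal ≤ Real.exp (B * τ) * M.toReal := by
    have : N.toReal * N.toReal ≤ (Real.exp (B * τ) * M.toReal) * N.toReal := by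
      rw [sq] at key; linarith
    exact le_of_mul_le_mul_right this hNpos
  rw [← ENNReal.ofReal_toReal hNtop, ← ENNReal.ofReal_toReal hMtop,
    ← ENNReal.ofReal_mul (Real.exp_pos _).le]
  exact ENNReal.ofReal_le_ofReal h2

/-- The Plancherel-Pólya inequality, from a horizontal line back to the real line. -/
theorem HasExpType.eLpNorm_le_shift {B : ℝ} (hB : 0 ≤ B) {f : ℂ → ℂ} (hf : HasExpType B f)
    {τ : ℝ} (hτ : 0 ≤ τ) :
    eLpNorm (fun x : ℝ => f x) 2 volume ≤
      ENNReal.ofReal (Real.exp (B * τ)) *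
        eLpNorm (fun x : ℝ => f (x + τ * Complex.I)) 2 volume := by
  have hfc := hf.1.continuous
  -- The map z ↦ −z + iτ interchanges the real axis and the line Im z = τ and keeps the exponential
  -- type.
  have hg := (hf.comp_add hB (τ * Complex.I)).comp_neg
  have key := hg.eLpNorm_shift_le hB hτ
  have e1 : eLpNorm (fun x : ℝ => f (-(x + τ * Complex.I) + τ * Complex.I)) 2 volume =
      eLpNorm (fun x : ℝ => f x) 2 volume := by
    rw [← eLpNorm_comp_measurePreserving (p := 2) (g := fun x : ℝ => f x)
      (hfc.comp Complex.continuous_ofReal).aestronglyMeasurable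
      (Measure.measurePreserving_neg (volume : Measure ℝ))]
    congr 1; ext x; simp [Function.comp]
  have e2 : eLpNorm (fun x : ℝ => f (-(x : ℂ) + τ * Complex.I)) 2 volume =
      eLpNorm (fun x : ℝ => f (x + τ * Complex.I)) 2 volume := by
    rw [← eLpNorm_comp_measurePreserving (p := 2) (g := fun x : ℝ => f (x + τ * Complex.I))
      (by fun_prop : Continuous fun x : ℝ => f (x + τ * Complex.I)).aestronglyMeasurable
      (Measure.measurePreserving_neg (volume : Measure ℝ))]
    congr 1; ext x; simp [Function.comp]
  rwa [e1, e2] at key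

end ExpType

/-! ### Stability of the normalised solutions on a horizontal line -/

section Stability

lemma lintegral_exp_le {τ : ℝ} (hτ : 0 < τ) :
    ∫⁻ t in Ioi (0 : ℝ), ENNReal.ofReal (Real.exp (-(2 * τ * t))) ^ 2 ≤
      ENNReal.ofReal (1 / (4 * τ)) := by
  have hi := integrableOn_exp_mul_Ioi (a := -(4 * τ)) (by linarith) 0
  have he := integral_exp_mul_Ioi (a := -(4 * τ)) (by linarith) 0
  have e : ∀ t : ℝ, ENNReal.ofReal (Real.exp (-(2 * τ * t))) ^ 2 =
      ENNReal.ofReal (Real.exp (-(4 * τ) * t)) := fun t => by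
    rw [← ENNReal.ofReal_pow (Real.exp_pos _).le, ← Real.exp_nat_mul]
    congr 2; push_cast; ring
  simp_rw [e]
  rw [← ofReal_integral_eq_lintegral_ofReal hi (ae_of_all _ fun t => (Real.exp_pos _).le), he]
  refine ENNReal.ofReal_le_ofReal (le_of_eq ?_)
  simp

lemma lintegral_mul_enorm_le {s : ℝ → ℂ} {T Ω : ℝ}
    (hs : AEStronglyMeasurable s (volume.restrict (Ioo 0 T)))
    (hΩ : eLpNorm s 2 (volume.restrict (Ioo 0 T)) ≤ ENNReal.ofReal Ω) {x : ℝ} (hx : x ≤ T)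
    {k : ℝ → ℝ} (hk : Measurable k) {c : ℝ} (hc : 0 ≤ c)
    (hkc : ∫⁻ t in Ioc 0 x, ENNReal.ofReal (k t) ^ 2 ≤ ENNReal.ofReal c) :
    ∫⁻ t in Ioc 0 x, ENNReal.ofReal (k t) * ‖s t‖ₑ ≤ ENNReal.ofReal (Ω * √c) := by
  have hm : volume.restrict (Ioc 0 x) ≤ volume.restrict (Ioo 0 T) := by
    rw [← restrict_Ioo_eq_restrict_Ioc]
    exact Measure.restrict_mono_set _ (Ioo_subset_Ioo_right hx)
  have h := ENNReal.lintegral_mul_le_Lp_mul_Lq (volume.restrict (Ioc 0 x))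
    Real.HolderConjugate.two_two (f := fun t => ENNReal.ofReal (k t)) (g := fun t => ‖s t‖ₑ)
    hk.ennreal_ofReal.aemeasurable (hs.mono_measure hm).enorm
  have h1 : (∫⁻ t in Ioc 0 x, ENNReal.ofReal (k t) ^ (2 : ℝ)) ^ (1 / 2 : ℝ) ≤
      ENNReal.ofReal (√c) := by
    rw [Real.sqrt_eq_rpow, ← ENNReal.ofReal_rpow_of_nonneg hc (by norm_num)]
    gcongr
    simpa using hkc
  have h2 : (∫⁻ t in Ioc 0 x, ‖s t‖ₑ ^ (2 : ℝ)) ^ (1 / 2 : ℝ) ≤ ENNReal.ofReal Ω := by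
    have e : (∫⁻ t in Ioc 0 x, ‖s t‖ₑ ^ (2 : ℝ)) ^ (1 / 2 : ℝ) =
        eLpNorm s 2 (volume.restrict (Ioc 0 x)) := by
      rw [eLpNorm_eq_lintegral_rpow_enorm_toReal (by norm_num) (by norm_num)]
      simp
    rw [e]
    exact (eLpNorm_mono_measure _ hm).trans hΩ
  refine h.trans ((mul_le_mul' h1 h2).trans (le_of_eq ?_))
  rw [← ENNReal.ofReal_mul (Real.sqrt_nonneg _), mul_comm]

/-- The source of smallness: the decaying exponential has L₂-norm at most (4τ)^{-1/2}, uniformly in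
x. -/
lemma lintegral_exp_mul_enorm_le {s : ℝ → ℂ} {T Ω τ : ℝ} (hτ : 0 < τ)
    (hs : AEStronglyMeasurable s (volume.restrict (Ioo 0 T)))
    (hΩ : eLpNorm s 2 (volume.restrict (Ioo 0 T)) ≤ ENNReal.ofReal Ω) {x : ℝ} (hx : x ≤ T) :
    ∫⁻ t in Ioc 0 x, ENNReal.ofReal (Real.exp (-(2 * τ * t))) * ‖s t‖ₑ ≤
        ENNReal.ofReal (Ω * √(1 / (4 * τ))) ∧
      ∫⁻ t in Ioc 0 x, ENNReal.ofReal (Real.exp (-(2 * τ * (x - t)))) * ‖s t‖ₑ ≤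
        ENNReal.ofReal (Ω * √(1 / (4 * τ))) := by
  constructor
  · refine lintegral_mul_enorm_le hs hΩ hx (by fun_prop) (by positivity)
      ((lintegral_mono_set Ioc_subset_Ioi_self).trans (lintegral_exp_le hτ))
  · refine lintegral_mul_enorm_le hs hΩ hx (by fun_prop) (by positivity)
      (le_trans ?_ (lintegral_exp_le hτ))
    rw [← restrict_Ioo_eq_restrict_Ioc, ← lintegral_indicator measurableSet_Ioo,
      ← lintegral_indicator measurableSet_Ioi,
      ← lintegral_sub_left_eq_self ((Ioi (0 : ℝ)).indicator _) x]
    refine lintegral_mono fun t => ?_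
    by_cases ht : t ∈ Ioo 0 x
    · rw [indicator_of_mem ht, indicator_of_mem (by simpa using ht.2)]
    · rw [indicator_of_notMem ht]; exact zero_le

lemma lintegral_enorm_le {s : ℝ → ℂ} {T Ω : ℝ} (hT : 0 ≤ T)
    (hs : AEStronglyMeasurable s (volume.restrict (Ioo 0 T)))
    (hΩ : eLpNorm s 2 (volume.restrict (Ioo 0 T)) ≤ ENNReal.ofReal Ω) :
    ∫⁻ t in Ioc 0 T, ‖s t‖ₑ ≤ ENNReal.ofReal (Ω * √T) := by
  have := lintegral_mul_enorm_le hs hΩ le_rfl (k := fun _ => 1) measurable_const hT (by simp)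
  simpa using this

lemma lintegral_mul_enorm_sq_le {s r : ℝ → ℂ} {T Ω Ω' : ℝ} (hΩ0 : 0 ≤ Ω)
    (hs : AEStronglyMeasurable s (volume.restrict (Ioo 0 T)))
    (hr : AEStronglyMeasurable r (volume.restrict (Ioo 0 T)))
    (hΩ : eLpNorm s 2 (volume.restrict (Ioo 0 T)) ≤ ENNReal.ofReal Ω)
    (hΩ' : eLpNorm r 2 (volume.restrict (Ioo 0 T)) ≤ ENNReal.ofReal Ω') :
    ∫⁻ t in Ioc 0 T, ‖s t‖ₑ * ‖r t‖ₑ ≤ ENNReal.ofReal (Ω * Ω') := by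
  rw [← restrict_Ioo_eq_restrict_Ioc, ENNReal.ofReal_mul hΩ0]
  exact (lintegral_enorm_mul_le hs hr).trans (mul_le_mul' hΩ hΩ')

/-- Let U, V be the suprema over x of the L₂-norms of u, v. The hypotheses give U ≤ K + εV + ε(U +
V) and V ≤ K + aU + ε(U + V). The constant a is not small, but the coupling of u to v is; inserting
the bound for U into that for V yields U + V ≤ (2 + a)K + ε(3 + 2a)(U + V). The last term can be
absorbed because the rough bound `M` shows that U and V are finite. -/
lemma stability_of_integral_inequalities {μ : Measure ℝ} [SFinite μ] {T a ε K : ℝ}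
    (ha : 0 ≤ a) (hε : 0 ≤ ε) (hK : 0 ≤ K) (hεa : ε * (3 + 2 * a) ≤ 1 / 2)
    {w₁ w₂ : ℝ → ℝ≥0∞} {w₃ : ℝ → ℝ → ℝ≥0∞} (hw₁ : AEMeasurable w₁ (volume.restrict (Ioc 0 T)))
    (hw₂ : AEMeasurable w₂ (volume.restrict (Ioc 0 T)))
    (hw₃ : ∀ x ∈ Icc 0 T, AEMeasurable (w₃ x) (volume.restrict (Ioc 0 x)))
    (hi₁ : ∫⁻ t in Ioc 0 T, w₁ t ≤ ENNReal.ofReal a)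
    (hi₂ : ∫⁻ t in Ioc 0 T, w₂ t ≤ ENNReal.ofReal ε)
    (hi₃ : ∀ x ∈ Icc 0 T, ∫⁻ t in Ioc 0 x, w₃ x t ≤ ENNReal.ofReal ε)
    {u v : ℝ → ℝ → ℂ} (hu : Measurable (Function.uncurry u)) (hv : Measurable (Function.uncurry v))
    {M : ℝ≥0∞} (hM : M ≠ ∞) (huM : ∀ x ∈ Icc 0 T, eLpNorm (u x) 2 μ ≤ M)
    (hvM : ∀ x ∈ Icc 0 T, eLpNorm (v x) 2 μ ≤ M) {F G : ℝ → ℝ → ℝ≥0∞}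
    (hF : ∀ x ∈ Icc 0 T, AEMeasurable (F x) μ) (hG : ∀ x ∈ Icc 0 T, AEMeasurable (G x) μ)
    (hFK : ∀ x ∈ Icc 0 T, eLpNorm (F x) 2 μ ≤ ENNReal.ofReal K)
    (hGK : ∀ x ∈ Icc 0 T, eLpNorm (G x) 2 μ ≤ ENNReal.ofReal K)
    (hveq : ∀ x ∈ Icc 0 T, ∀ᵐ ξ ∂μ, ‖v x ξ‖ₑ ≤ F x ξ + (∫⁻ t in Ioc 0 x, w₁ t * ‖u t ξ‖ₑ) +
      ((∫⁻ t in Ioc 0 x, w₂ t * ‖u t ξ‖ₑ) + ∫⁻ t in Ioc 0 x, w₂ t * ‖v t ξ‖ₑ))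
    (hueq : ∀ x ∈ Icc 0 T, ∀ᵐ ξ ∂μ, ‖u x ξ‖ₑ ≤ G x ξ + (∫⁻ t in Ioc 0 x, w₃ x t * ‖v t ξ‖ₑ) +
      ((∫⁻ t in Ioc 0 x, w₂ t * ‖u t ξ‖ₑ) + ∫⁻ t in Ioc 0 x, w₂ t * ‖v t ξ‖ₑ)) :
    ∀ x ∈ Icc 0 T, eLpNorm (u x) 2 μ ≤ ENNReal.ofReal (2 * (2 + a) * K) ∧
      eLpNorm (v x) 2 μ ≤ ENNReal.ofReal (2 * (2 + a) * K) := by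
  set Nu := ⨆ x ∈ Icc 0 T, eLpNorm (u x) 2 μ with hNu
  set Nv := ⨆ x ∈ Icc 0 T, eLpNorm (v x) 2 μ with hNv
  have hNu_top : Nu ≠ ∞ := ne_top_of_le_ne_top hM (iSup₂_le huM)
  have hNv_top : Nv ≠ ∞ := ne_top_of_le_ne_top hM (iSup₂_le hvM)
  have hule : ∀ x ∈ Icc 0 T, eLpNorm (u x) 2 μ ≤ Nu := fun x hx =>
    le_iSup₂ (f := fun x (_ : x ∈ Icc 0 T) => eLpNorm (u x) 2 μ) x hx
  have hvle : ∀ x ∈ Icc 0 T, eLpNorm (v x) 2 μ ≤ Nv := fun x hx =>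
    le_iSup₂ (f := fun x (_ : x ∈ Icc 0 T) => eLpNorm (v x) 2 μ) x hx
  have hsub : ∀ x ∈ Icc 0 T, Ioc 0 x ⊆ Ioc 0 T := fun x hx => Ioc_subset_Ioc_right hx.2
  have hm : ∀ x ∈ Icc 0 T, volume.restrict (Ioc 0 x) ≤ volume.restrict (Ioc 0 T) :=
    fun x hx => Measure.restrict_mono_set _ (hsub x hx)
  -- the norm of one integral term
  have term : ∀ x ∈ Icc 0 T, ∀ (w : ℝ → ℝ≥0∞), AEMeasurable w (volume.restrict (Ioc 0 x)) →
      ∀ (z : ℝ → ℝ → ℂ), Measurable (Function.uncurry z) → ∀ (A N : ℝ≥0∞),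
      ∫⁻ t in Ioc 0 x, w t ≤ A → (∀ y ∈ Icc 0 T, eLpNorm (z y) 2 μ ≤ N) →
      AEMeasurable (fun ξ => ∫⁻ t in Ioc 0 x, w t * ‖z t ξ‖ₑ) μ ∧
        eLpNorm (fun ξ => ∫⁻ t in Ioc 0 x, w t * ‖z t ξ‖ₑ) 2 μ ≤ A * N := by
    intro x hx w hw z hz A N hA hN
    refine ⟨aemeasurable_lintegral_mul_enorm hw hz, eLpNorm_two_le_of_le_lintegral hw hz
      (ae_of_all _ fun ξ => le_rfl) hA ?_⟩
    exact (ae_restrict_iff' measurableSet_Ioc).mpr (ae_of_all _ fun t ht =>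
      hN t (Ioc_subset_Icc_self (hsub x hx ht)))
  have comb : ∀ x ∈ Icc 0 T, ∀ (z : ℝ → ℂ) (H : ℝ → ℝ≥0∞) (w : ℝ → ℝ≥0∞) (z' : ℝ → ℝ → ℂ)
      (A N : ℝ≥0∞), AEMeasurable H μ → eLpNorm H 2 μ ≤ ENNReal.ofReal K →
      AEMeasurable w (volume.restrict (Ioc 0 x)) → Measurable (Function.uncurry z') →
      ∫⁻ t in Ioc 0 x, w t ≤ A → (∀ y ∈ Icc 0 T, eLpNorm (z' y) 2 μ ≤ N) →
      (∀ᵐ ξ ∂μ, ‖z ξ‖ₑ ≤ H ξ + (∫⁻ t in Ioc 0 x, w t * ‖z' t ξ‖ₑ) +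
        ((∫⁻ t in Ioc 0 x, w₂ t * ‖u t ξ‖ₑ) + ∫⁻ t in Ioc 0 x, w₂ t * ‖v t ξ‖ₑ)) →
      eLpNorm z 2 μ ≤ ENNReal.ofReal K + A * N +
        (ENNReal.ofReal ε * Nu + ENNReal.ofReal ε * Nv) := by
    intro x hx z H w z' A N hH hHK hw hz' hA hN hle
    obtain ⟨m1, b1⟩ := term x hx w hw z' hz' A N hA hN
    have hw₂' := hw₂.mono_measure (hm x hx)
    have hi₂' : ∫⁻ t in Ioc 0 x, w₂ t ≤ ENNReal.ofReal ε :=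
      (lintegral_mono_set (hsub x hx)).trans hi₂
    obtain ⟨m2, b2⟩ := term x hx w₂ hw₂' u hu _ _ hi₂' hule
    obtain ⟨m3, b3⟩ := term x hx w₂ hw₂' v hv _ _ hi₂' hvle
    have h12 : (1 : ℝ≥0∞) ≤ 2 := by norm_num
    calc eLpNorm z 2 μ ≤ eLpNorm ((H + fun ξ => (∫⁻ t in Ioc 0 x, w t * ‖z' t ξ‖ₑ)) +
          ((fun ξ => (∫⁻ t in Ioc 0 x, w₂ t * ‖u t ξ‖ₑ)) +
            fun ξ => (∫⁻ t in Ioc 0 x, w₂ t * ‖v t ξ‖ₑ))) 2 μ := eLpNorm_mono_enorm_ae hle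
      _ ≤ _ := eLpNorm_add_le (hH.add m1).aestronglyMeasurable (m2.add m3).aestronglyMeasurable h12
      _ ≤ _ := add_le_add (eLpNorm_add_le hH.aestronglyMeasurable m1.aestronglyMeasurable h12)
          (eLpNorm_add_le m2.aestronglyMeasurable m3.aestronglyMeasurable h12)
      _ ≤ _ := by gcongr
  have hNv_le : Nv ≤ ENNReal.ofReal K + ENNReal.ofReal a * Nu +
      (ENNReal.ofReal ε * Nu + ENNReal.ofReal ε * Nv) := iSup₂_le fun x hx =>
    comb x hx (v x) (F x) w₁ u _ _ (hF x hx) (hFK x hx) (hw₁.mono_measure (hm x hx)) hu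
      ((lintegral_mono_set (hsub x hx)).trans hi₁) hule (hveq x hx)
  have hNu_le : Nu ≤ ENNReal.ofReal K + ENNReal.ofReal ε * Nv +
      (ENNReal.ofReal ε * Nu + ENNReal.ofReal ε * Nv) := iSup₂_le fun x hx =>
    comb x hx (u x) (G x) (w₃ x) v _ _ (hG x hx) (hGK x hx) (hw₃ x hx) hv (hi₃ x hx) hvle
      (hueq x hx)
  obtain ⟨U, hU0, hU⟩ : ∃ U : ℝ, 0 ≤ U ∧ Nu = ENNReal.ofReal U :=
    ⟨Nu.toReal, ENNReal.toReal_nonneg, (ENNReal.ofReal_toReal hNu_top).symm⟩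
  obtain ⟨V, hV0, hV⟩ : ∃ V : ℝ, 0 ≤ V ∧ Nv = ENNReal.ofReal V :=
    ⟨Nv.toReal, ENNReal.toReal_nonneg, (ENNReal.ofReal_toReal hNv_top).symm⟩
  rw [hU, hV, ← ENNReal.ofReal_mul ha, ← ENNReal.ofReal_mul hε, ← ENNReal.ofReal_mul hε,
    ← ENNReal.ofReal_add (by positivity) (by positivity),
    ← ENNReal.ofReal_add (by positivity) (by positivity),
    ← ENNReal.ofReal_add (by positivity) (by positivity),
    ENNReal.ofReal_le_ofReal_iff (by positivity)] at hNv_le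
  rw [hU, hV, ← ENNReal.ofReal_mul hε, ← ENNReal.ofReal_mul hε,
    ← ENNReal.ofReal_add (by positivity) (by positivity),
    ← ENNReal.ofReal_add (by positivity) (by positivity),
    ← ENNReal.ofReal_add (by positivity) (by positivity),
    ENNReal.ofReal_le_ofReal_iff (by positivity)] at hNu_le
  have hS : U + V ≤ 2 * (2 + a) * K := by
    have h1 : U ≤ K + 2 * ε * (U + V) := by nlinarith
    have h2 : V ≤ K + a * (K + 2 * ε * (U + V)) + ε * (U + V) := by nlinarith
    have h3 : U + V ≤ (2 + a) * K + (ε * (3 + 2 * a)) * (U + V) := by nlinarith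
    have h4 : (ε * (3 + 2 * a)) * (U + V) ≤ 1 / 2 * (U + V) :=
      mul_le_mul_of_nonneg_right hεa (by positivity)
    linarith
  intro x hx
  refine ⟨(hule x hx).trans ?_, (hvle x hx).trans ?_⟩
  · rw [hU]; exact ENNReal.ofReal_le_ofReal (by linarith)
  · rw [hV]; exact ENNReal.ofReal_le_ofReal (by linarith)

end Stability

/-! ### The equation on a horizontal line as integral equations for two bounded components. -/

section Profile

/-- The point `ξ + iτ` of a horizontal line. -/
noncomputable def linePt (τ ξ : ℝ) : ℂ := ξ + τ * Complex.I

lemma linePt_im (τ ξ : ℝ) : (linePt τ ξ).im = τ := by simp [linePt]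

lemma continuous_linePt (τ : ℝ) : Continuous (linePt τ) := by unfold linePt; fun_prop

lemma le_norm_linePt (τ ξ : ℝ) : τ ≤ ‖linePt τ ξ‖ := by
  have := Complex.abs_im_le_norm (linePt τ ξ)
  rw [linePt_im] at this
  exact (le_abs_self _).trans this

lemma linePt_ne_zero {τ : ℝ} (hτ : 0 < τ) (ξ : ℝ) : linePt τ ξ ≠ 0 :=
  norm_pos_iff.mp (hτ.trans_le (le_norm_linePt τ ξ))

lemma norm_cexp_linePt (τ ξ t : ℝ) :
    ‖Complex.exp (2 * Complex.I * linePt τ ξ * t)‖ = Real.exp (-(2 * τ * t)) := by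
  rw [Complex.norm_exp]
  congr 1
  simp [linePt]

lemma cexp_linePt (τ ξ t : ℝ) : Complex.exp (2 * Complex.I * linePt τ ξ * t) =
    (Real.exp (-(2 * τ * t)) : ℝ) * Complex.exp (2 * Complex.I * ξ * t) := by
  rw [Complex.ofReal_exp, ← Complex.exp_add]
  congr 1
  simp only [linePt]
  push_cast
  linear_combination 2 * τ * t * Complex.I_sq

lemma enorm_inv_linePt_le {τ : ℝ} (hτ : 0 < τ) (ξ : ℝ) :
    ‖(linePt τ ξ)⁻¹‖ₑ ≤ ENNReal.ofReal (1 / τ) := by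
  rw [← ofReal_norm, norm_inv, one_div]
  exact ENNReal.ofReal_le_ofReal (inv_anti₀ hτ (le_norm_linePt τ ξ))

/-- Since |ξ + iτ|² ≥ 1 + ξ², the squared norm is at most π ≤ 4. This puts the terms quadratic in
the potential into L₂, as they carry the factor 1/ρ. -/
lemma eLpNorm_inv_linePt_le {τ : ℝ} (hτ : 1 ≤ τ) :
    eLpNorm (fun ξ => (linePt τ ξ)⁻¹) 2 volume ≤ ENNReal.ofReal 2 := by
  rw [eLpNorm_two_le_iff, ← ENNReal.ofReal_pow (by norm_num)]
  have h1 : ∀ ξ : ℝ, ‖(linePt τ ξ)⁻¹‖ₑ ^ 2 ≤ ENNReal.ofReal (1 + ξ ^ 2)⁻¹ := fun ξ => by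
    rw [← ofReal_norm, ← ENNReal.ofReal_pow (norm_nonneg _)]
    refine ENNReal.ofReal_le_ofReal ?_
    rw [norm_inv, inv_pow]
    refine inv_anti₀ (by positivity) ?_
    rw [← Complex.normSq_eq_norm_sq, Complex.normSq_apply]
    simp only [linePt, Complex.add_re, Complex.ofReal_re, Complex.mul_re, Complex.I_re, mul_zero,
      Complex.ofReal_im, Complex.I_im, mul_one, sub_self, add_zero, Complex.add_im, Complex.mul_im,
      zero_add]
    nlinarith
  refine (lintegral_mono h1).trans ?_
  rw [← ofReal_integral_eq_lintegral_ofReal integrable_inv_one_add_sq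
    (ae_of_all _ fun ξ => by positivity), integral_univ_inv_one_add_sq]
  exact ENNReal.ofReal_le_ofReal (by linarith [Real.pi_le_four])

/-- The pair `p = e^{iρx}(w + iy)`, `q = e^{iρx}(w - iy)`, `w = y^{[1]}/ρ`, for a solution `y` of the
Sturm-Liouville equation with `λ = ρ²`, as functions of `x` and of `ξ`, where `ρ = ξ + iτ`. -/
structure IsProfile (T τ : ℝ) (s : ℝ → ℂ) (c d : ℂ) (p q : ℝ → ℝ → ℂ) : Prop where
  measurable_p : Measurable (Function.uncurry p)
  measurable_q : Measurable (Function.uncurry q)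
  continuous_p : ∀ ξ, Continuous fun x => p x ξ
  continuous_q : ∀ ξ, Continuous fun x => q x ξ
  bdd : ∀ R : ℝ, ∃ M : ℝ, ∀ x ∈ Icc 0 T, ∀ ξ, |ξ| ≤ R → ‖p x ξ‖ ≤ M ∧ ‖q x ξ‖ ≤ M
  -- Here (p − q)/(2i) stands for e^{iρx}y. The kernel 1 is kept so that both equations have the
  -- same shape and are handled by the same lemmas.
  eq_q : ∀ ξ, ∀ x ∈ Icc 0 T, q x ξ = d - ∫ t in (0 : ℝ)..x, 1 * (s t * p t ξ +
    s t ^ 2 * (linePt τ ξ)⁻¹ * ((p t ξ - q t ξ) / (2 * Complex.I)))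
  eq_p : ∀ ξ, ∀ x ∈ Icc 0 T, p x ξ = Complex.exp (2 * Complex.I * linePt τ ξ * x) * c -
    ∫ t in (0 : ℝ)..x, Complex.exp (2 * Complex.I * linePt τ ξ * (x - t : ℝ)) * (s t * q t ξ +
      s t ^ 2 * (linePt τ ξ)⁻¹ * ((p t ξ - q t ξ) / (2 * Complex.I)))

/-- The free solution as a profile: comparison with it becomes a case of the stability estimate,
with second potential zero. -/
lemma isProfile_zero {T τ : ℝ} (hτ : 0 < τ) (c d : ℂ) :
    IsProfile T τ 0 c d (fun x ξ => Complex.exp (2 * Complex.I * linePt τ ξ * x) * c)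
      (fun _ _ => d) where
  measurable_p := by
    have := continuous_linePt τ
    refine Continuous.measurable ?_
    change Continuous fun z : ℝ × ℝ => Complex.exp (2 * Complex.I * linePt τ z.2 * z.1) * c
    fun_prop
  measurable_q := measurable_const
  continuous_p ξ := by fun_prop
  continuous_q ξ := by fun_prop
  bdd R := by
    refine ⟨max ‖c‖ ‖d‖, fun x hx ξ _ => ⟨?_, le_max_right _ _⟩⟩
    rw [norm_mul, norm_cexp_linePt]
    refine le_trans ?_ (le_max_left _ _)
    refine mul_le_of_le_one_left (norm_nonneg _) (Real.exp_le_one_iff.mpr ?_)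
    have := mul_nonneg hτ.le hx.1
    linarith
  eq_q ξ x hx := by simp
  eq_p ξ x hx := by simp

lemma enorm_intervalIntegral_le {f : ℝ → ℂ} {x : ℝ} (hx : 0 ≤ x) :
    ‖∫ t in (0 : ℝ)..x, f t‖ₑ ≤ ∫⁻ t in Ioc 0 x, ‖f t‖ₑ := by
  rw [intervalIntegral.integral_of_le hx]; exact enorm_integral_le_lintegral_enorm _

lemma lintegral_mul_add_le {x : ℝ} {w : ℝ → ℝ≥0∞} {f u v : ℝ → ℂ}
    (hw : AEMeasurable w (volume.restrict (Ioc 0 x))) (hu : Continuous u)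
    (h : ∀ t ∈ Ioc 0 x, ‖f t‖ₑ ≤ w t * ‖u t‖ₑ + w t * ‖v t‖ₑ) :
    ∫⁻ t in Ioc 0 x, ‖f t‖ₑ ≤ (∫⁻ t in Ioc 0 x, w t * ‖u t‖ₑ) + ∫⁻ t in Ioc 0 x, w t * ‖v t‖ₑ := by
  have hm : AEMeasurable (fun t => w t * ‖u t‖ₑ) (volume.restrict (Ioc 0 x)) :=
    hw.mul hu.measurable.enorm.aemeasurable
  rw [← lintegral_add_left' hm]
  exact setLIntegral_mono_ae' measurableSet_Ioc (ae_of_all _ h)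

/-- The difference of the two right-hand sides splits into a forcing term, where the difference of
the potentials meets the second solution, and terms linear in the difference of the solutions with
coefficients from the first potential. The factor 1/(2τ) comes from |1/ρ| ≤ 1/τ and the division by
2i. -/
lemma enorm_integral_sub_le {T τ x : ℝ} (hτ : 0 < τ) (hx : x ∈ Icc 0 T) {s s' : ℝ → ℂ}
    (hs : MemLp s 2 (volume.restrict (Ioo 0 T))) (hs' : MemLp s' 2 (volume.restrict (Ioo 0 T)))
    (ξ : ℝ) {k a a' p q p' q' : ℝ → ℂ} (hk : Continuous k) (ha : Continuous a)
    (ha' : Continuous a') (hp : Continuous p) (hq : Continuous q) (hp' : Continuous p')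
    (hq' : Continuous q') {κ : ℝ → ℝ} (hkκ : ∀ t ∈ Ioc 0 x, ‖k t‖ ≤ κ t)
    (hκ : ∀ t ∈ Ioc 0 x, κ t ≤ 1) :
    ‖(∫ t in (0 : ℝ)..x, k t * (s t * a t +
        s t ^ 2 * (linePt τ ξ)⁻¹ * ((p t - q t) / (2 * Complex.I)))) -
      ∫ t in (0 : ℝ)..x, k t * (s' t * a' t +
        s' t ^ 2 * (linePt τ ξ)⁻¹ * ((p' t - q' t) / (2 * Complex.I)))‖ₑ ≤
    ‖∫ t in (0 : ℝ)..x, k t * ((s t - s' t) * a' t +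
        (s t ^ 2 - s' t ^ 2) * (linePt τ ξ)⁻¹ * ((p' t - q' t) / (2 * Complex.I)))‖ₑ +
      (∫⁻ t in Ioc 0 x, ENNReal.ofReal (κ t) * ‖s t‖ₑ * ‖a t - a' t‖ₑ) +
      ((∫⁻ t in Ioc 0 x, ENNReal.ofReal (1 / (2 * τ)) * ‖s t‖ₑ ^ 2 * ‖p t - p' t‖ₑ) +
        ∫⁻ t in Ioc 0 x, ENNReal.ofReal (1 / (2 * τ)) * ‖s t‖ₑ ^ 2 * ‖q t - q' t‖ₑ) := by
  have hT : 0 ≤ T := hx.1.trans hx.2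
  have hsub : uIcc 0 x ⊆ uIcc 0 T := by
    rw [uIcc_of_le hx.1, uIcc_of_le hT]; exact Icc_subset_Icc_right hx.2
  have is := (hs.intervalIntegrable_of_Ioo hT).mono_set hsub
  have is' := (hs'.intervalIntegrable_of_Ioo hT).mono_set hsub
  have iss := (hs.intervalIntegrable_sq_of_Ioo hT).mono_set hsub
  have iss' := (hs'.intervalIntegrable_sq_of_Ioo hT).mono_set hsub
  set r : ℂ := (linePt τ ξ)⁻¹ with hr
  have gen : ∀ {h1 h2 b e f : ℝ → ℂ}, IntervalIntegrable h1 volume 0 x →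
      IntervalIntegrable h2 volume 0 x → Continuous b → Continuous e → Continuous f →
      IntervalIntegrable (fun t => k t * (h1 t * b t + h2 t * r * ((e t - f t) / (2 * Complex.I))))
        volume 0 x := by
    intro h1 h2 b e f i1 i2 hb he hf
    refine IntervalIntegrable.continuousOn_mul ?_ hk.continuousOn
    exact (i1.mul_continuousOn hb.continuousOn).add ((i2.mul_const r).mul_continuousOn
      (by fun_prop : Continuous fun t => (e t - f t) / (2 * Complex.I)).continuousOn)
  have iA : IntervalIntegrable (fun t => k t * (s t * (a t - a' t))) volume 0 x :=
    (is.mul_continuousOn (ha.sub ha').continuousOn).continuousOn_mul hk.continuousOn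
  have iB : IntervalIntegrable (fun t => k t * (s t ^ 2 * r *
      ((p t - q t - (p' t - q' t)) / (2 * Complex.I)))) volume 0 x :=
    ((iss.mul_const r).mul_continuousOn (by fun_prop : Continuous fun t =>
      (p t - q t - (p' t - q' t)) / (2 * Complex.I)).continuousOn).continuousOn_mul hk.continuousOn
  have iC := gen (is.sub is') (iss.sub iss') ha' hp' hq'
  have heq : (∫ t in (0 : ℝ)..x, k t * (s t * a t +
        s t ^ 2 * r * ((p t - q t) / (2 * Complex.I)))) -
      ∫ t in (0 : ℝ)..x, k t * (s' t * a' t +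
        s' t ^ 2 * r * ((p' t - q' t) / (2 * Complex.I))) =
      (∫ t in (0 : ℝ)..x, k t * ((s t - s' t) * a' t +
        (s t ^ 2 - s' t ^ 2) * r * ((p' t - q' t) / (2 * Complex.I)))) +
      (∫ t in (0 : ℝ)..x, k t * (s t * (a t - a' t))) +
      ∫ t in (0 : ℝ)..x, k t * (s t ^ 2 * r *
        ((p t - q t - (p' t - q' t)) / (2 * Complex.I))) := by
    rw [← intervalIntegral.integral_sub (gen is iss ha hp hq) (gen is' iss' ha' hp' hq'),
      ← intervalIntegral.integral_add iC iA, ← intervalIntegral.integral_add (iC.add iA) iB]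
    congr 1; ext t; ring
  rw [heq]
  refine (enorm_add_le _ _).trans (add_le_add ((enorm_add_le _ _).trans (add_le_add le_rfl ?_)) ?_)
  · refine (enorm_intervalIntegral_le hx.1).trans (setLIntegral_mono_ae' measurableSet_Ioc
      (ae_of_all _ fun t ht => ?_))
    rw [enorm_mul, enorm_mul, ← mul_assoc]
    gcongr
    rw [← ofReal_norm]
    exact ENNReal.ofReal_le_ofReal (hkκ t ht)
  · have hm : volume.restrict (Ioc 0 x) ≤ volume.restrict (Ioo 0 T) := by
      rw [← restrict_Ioo_eq_restrict_Ioc]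
      exact Measure.restrict_mono_set _ (Ioo_subset_Ioo_right hx.2)
    refine (enorm_intervalIntegral_le hx.1).trans (lintegral_mul_add_le
      (((hs.aestronglyMeasurable.mono_measure hm).enorm.pow_const 2).const_mul _)
      (hp.sub hp') fun t ht => ?_)
    have h1 : ‖k t‖ₑ ≤ 1 := by
      rw [← ofReal_norm, ← ENNReal.ofReal_one]
      exact ENNReal.ofReal_le_ofReal ((hkκ t ht).trans (hκ t ht))
    have h2 : ‖(p t - q t - (p' t - q' t)) / (2 * Complex.I)‖ₑ ≤
        ENNReal.ofReal (1 / 2) * (‖p t - p' t‖ₑ + ‖q t - q' t‖ₑ) := by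
      have e : (p t - q t - (p' t - q' t)) / (2 * Complex.I) =
        (1 / (2 * Complex.I)) * ((p t - p' t) - (q t - q' t)) := by ring
      rw [e, enorm_mul]
      have e2 : ‖(1 / (2 * Complex.I) : ℂ)‖ₑ = ENNReal.ofReal (1 / 2) := by
        rw [← ofReal_norm]; simp
      rw [e2]
      gcongr
      exact enorm_sub_le
    have h3 : ENNReal.ofReal (1 / (2 * τ)) = ENNReal.ofReal (1 / τ) * ENNReal.ofReal (1 / 2) := by
      rw [← ENNReal.ofReal_mul (by positivity)]; congr 1; field_simp
    rw [enorm_mul, enorm_mul, enorm_mul, enorm_pow, ← mul_add, h3]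
    calc _ ≤ 1 * (‖s t‖ₑ ^ 2 * ENNReal.ofReal (1 / τ) *
          (ENNReal.ofReal (1 / 2) * (‖p t - p' t‖ₑ + ‖q t - q' t‖ₑ))) := by
          gcongr; exact enorm_inv_linePt_le hτ ξ
      _ = _ := by ring

/-- It remains to bound the forcing terms once this is known. The measure is left general: a Dirac
measure gives pointwise bounds, Lebesgue measure on an interval gives L₂-bounds. Bounded support is
needed since the rough bounds `bdd` are only locally uniform in ξ. -/
lemma profile_sub_le {T τ ε Ω K R : ℝ} {s s' : ℝ → ℂ} {c d : ℂ} {p q p' q' : ℝ → ℝ → ℂ}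
    (hT : 0 ≤ T) (hτ : 0 < τ) (hΩ : 0 ≤ Ω) (hK : 0 ≤ K)
    (hε1 : Ω * √(1 / (4 * τ)) ≤ ε) (hε2 : 1 / (2 * τ) * (Ω * Ω) ≤ ε)
    (hεa : ε * (3 + 2 * (Ω * √T)) ≤ 1 / 2)
    (hs : MemLp s 2 (volume.restrict (Ioo 0 T))) (hs' : MemLp s' 2 (volume.restrict (Ioo 0 T)))
    (hsΩ : eLpNorm s 2 (volume.restrict (Ioo 0 T)) ≤ ENNReal.ofReal Ω)
    (h : IsProfile T τ s c d p q) (h' : IsProfile T τ s' c d p' q')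
    {μ : Measure ℝ} [IsFiniteMeasure μ] (hR : ∀ᵐ ξ ∂μ, |ξ| ≤ R) {F G : ℝ → ℝ → ℝ≥0∞}
    (hF : ∀ x ∈ Icc 0 T, AEMeasurable (F x) μ) (hG : ∀ x ∈ Icc 0 T, AEMeasurable (G x) μ)
    (hFK : ∀ x ∈ Icc 0 T, eLpNorm (F x) 2 μ ≤ ENNReal.ofReal K)
    (hGK : ∀ x ∈ Icc 0 T, eLpNorm (G x) 2 μ ≤ ENNReal.ofReal K)
    (hFle : ∀ x ∈ Icc 0 T, ∀ᵐ ξ ∂μ, ‖∫ t in (0 : ℝ)..x, 1 * ((s t - s' t) * p' t ξ +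
      (s t ^ 2 - s' t ^ 2) * (linePt τ ξ)⁻¹ * ((p' t ξ - q' t ξ) / (2 * Complex.I)))‖ₑ ≤ F x ξ)
    (hGle : ∀ x ∈ Icc 0 T, ∀ᵐ ξ ∂μ,
      ‖∫ t in (0 : ℝ)..x, Complex.exp (2 * Complex.I * linePt τ ξ * (x - t : ℝ)) *
        ((s t - s' t) * q' t ξ + (s t ^ 2 - s' t ^ 2) * (linePt τ ξ)⁻¹ *
          ((p' t ξ - q' t ξ) / (2 * Complex.I)))‖ₑ ≤ G x ξ) :
    ∀ x ∈ Icc 0 T,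
      eLpNorm (fun ξ => p x ξ - p' x ξ) 2 μ ≤ ENNReal.ofReal (2 * (2 + Ω * √T) * K) ∧
      eLpNorm (fun ξ => q x ξ - q' x ξ) 2 μ ≤ ENNReal.ofReal (2 * (2 + Ω * √T) * K) := by
  have hIoc : volume.restrict (Ioc 0 T) = volume.restrict (Ioo 0 T) :=
    restrict_Ioo_eq_restrict_Ioc.symm
  have hm : ∀ x ∈ Icc 0 T, volume.restrict (Ioc 0 x) ≤ volume.restrict (Ioo 0 T) :=
    fun x hx => by
      rw [← hIoc]; exact Measure.restrict_mono_set _ (Ioc_subset_Ioc_right hx.2)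
  have hsm := hs.aestronglyMeasurable
  obtain ⟨M, hM⟩ := h.bdd R
  obtain ⟨M', hM'⟩ := h'.bdd R
  have hbound : ∀ {f f' : ℝ → ℝ → ℂ}, (∀ x ∈ Icc 0 T, ∀ ξ, |ξ| ≤ R → ‖f x ξ‖ ≤ M) →
      (∀ x ∈ Icc 0 T, ∀ ξ, |ξ| ≤ R → ‖f' x ξ‖ ≤ M') → ∀ x ∈ Icc 0 T,
      eLpNorm (fun ξ => f x ξ - f' x ξ) 2 μ ≤
        μ univ ^ (2 : ℝ≥0∞).toReal⁻¹ * ENNReal.ofReal (M + M') := by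
    intro f f' hf hf' x hx
    refine eLpNorm_le_of_ae_bound ?_
    filter_upwards [hR] with ξ hξ
    exact (norm_sub_le _ _).trans (add_le_add (hf x hx ξ hξ) (hf' x hx ξ hξ))
  refine stability_of_integral_inequalities (by positivity)
    (le_trans (by positivity) hε1) hK hεa
    (w₁ := fun t => ‖s t‖ₑ) (w₂ := fun t => ENNReal.ofReal (1 / (2 * τ)) * ‖s t‖ₑ ^ 2)
    (w₃ := fun x t => ENNReal.ofReal (Real.exp (-(2 * τ * (x - t)))) * ‖s t‖ₑ)
    (by rw [hIoc]; exact hsm.enorm) (by rw [hIoc]; exact (hsm.enorm.pow_const 2).const_mul _)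
    (fun x hx => AEMeasurable.mul (Measurable.aemeasurable (by fun_prop))
      (hsm.mono_measure (hm x hx)).enorm) (lintegral_enorm_le hT hsm hsΩ) ?_
    (fun x hx => ((lintegral_exp_mul_enorm_le hτ hsm hsΩ hx.2).2.trans
      (ENNReal.ofReal_le_ofReal hε1)))
    (u := fun x ξ => p x ξ - p' x ξ) (v := fun x ξ => q x ξ - q' x ξ)
    (h.measurable_p.sub h'.measurable_p) (h.measurable_q.sub h'.measurable_q)
    (M := μ univ ^ (2 : ℝ≥0∞).toReal⁻¹ * ENNReal.ofReal (M + M'))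
    (ENNReal.mul_ne_top (ENNReal.rpow_ne_top_of_nonneg (by simp) (measure_ne_top _ _))
      ENNReal.ofReal_ne_top)
    (hbound (fun x hx ξ hξ => (hM x hx ξ hξ).1) (fun x hx ξ hξ => (hM' x hx ξ hξ).1))
    (hbound (fun x hx ξ hξ => (hM x hx ξ hξ).2) (fun x hx ξ hξ => (hM' x hx ξ hξ).2))
    hF hG hFK hGK ?_ ?_
  · rw [lintegral_const_mul' _ _ ENNReal.ofReal_ne_top]
    have := lintegral_mul_enorm_sq_le hΩ hsm hsm hsΩ hsΩ
    simp_rw [sq]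
    calc _ ≤ ENNReal.ofReal (1 / (2 * τ)) * ENNReal.ofReal (Ω * Ω) := by gcongr
      _ = ENNReal.ofReal (1 / (2 * τ) * (Ω * Ω)) := by
          rw [← ENNReal.ofReal_mul (by positivity)]
      _ ≤ _ := ENNReal.ofReal_le_ofReal hε2
  · intro x hx
    filter_upwards [hFle x hx] with ξ hξ
    rw [h.eq_q ξ x hx, h'.eq_q ξ x hx, sub_sub_sub_cancel_left, enorm_sub_rev]
    refine (enorm_integral_sub_le hτ hx hs hs' ξ continuous_const (h.continuous_p ξ)
      (h'.continuous_p ξ) (h.continuous_p ξ) (h.continuous_q ξ) (h'.continuous_p ξ)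
      (h'.continuous_q ξ) (κ := fun _ => 1) (fun t _ => by simp) (fun t _ => le_rfl)).trans ?_
    simp only [ENNReal.ofReal_one, one_mul] at hξ ⊢
    gcongr
  · intro x hx
    filter_upwards [hGle x hx] with ξ hξ
    rw [h.eq_p ξ x hx, h'.eq_p ξ x hx, sub_sub_sub_cancel_left, enorm_sub_rev]
    refine (enorm_integral_sub_le hτ hx hs hs' ξ (by fun_prop) (h.continuous_q ξ)
      (h'.continuous_q ξ) (h.continuous_p ξ) (h.continuous_q ξ) (h'.continuous_p ξ)
      (h'.continuous_q ξ) (κ := fun t => Real.exp (-(2 * τ * (x - t))))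
      (fun t _ => (norm_cexp_linePt _ _ _).le) (fun t ht => Real.exp_le_one_iff.mpr ?_)).trans ?_
    · have := mul_nonneg hτ.le (sub_nonneg.mpr ht.2)
      linarith
    · gcongr

end Profile

/-! ### Fourier form of the first-order terms, large heights, closeness to the free solution. -/

section Profile

/-- On the line the exponential is e^{-2τt}e^{2iξt}; the first factor is at most one for t ≥ 0 and
is absorbed into the density `h`. -/
lemma exists_fourierTwo_eq_integral {x τ : ℝ} (hx : 0 ≤ x) (hτ : 0 < τ) {s : ℝ → ℂ}
    (hs : MemLp s 2 (volume.restrict (Ioo 0 x))) :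
    ∃ h : ℝ → ℂ, Integrable h ∧
      eLpNorm h 2 volume ≤ eLpNorm s 2 (volume.restrict (Ioo 0 x)) ∧
      ∀ ξ, ∫ t in (0 : ℝ)..x, Complex.exp (2 * Complex.I * linePt τ ξ * t) * s t =
        fourierTwo h ξ := by
  have hi : IntegrableOn s (Ioo 0 x) := by
    rw [IntegrableOn, restrict_Ioo_eq_restrict_Ioc]
    exact (intervalIntegrable_iff_integrableOn_Ioc_of_le hx).mp (hs.intervalIntegrable_of_Ioo hx)
  have hle : ∀ t ∈ Ioo 0 x, ‖((Real.exp (-(2 * τ * t)) : ℝ) : ℂ)‖ ≤ 1 := fun t ht => by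
    rw [Complex.norm_real, Real.norm_of_nonneg (Real.exp_pos _).le, Real.exp_le_one_iff]
    have := mul_pos hτ ht.1
    linarith
  have hm : AEStronglyMeasurable (fun t : ℝ => ((Real.exp (-(2 * τ * t)) : ℝ) : ℂ))
      (volume.restrict (Ioo 0 x)) := (by fun_prop : Continuous _).aestronglyMeasurable
  refine ⟨(Ioo 0 x).indicator fun t => s t * (Real.exp (-(2 * τ * t)) : ℝ),
    IntegrableOn.integrable_indicator ?_ measurableSet_Ioo, ?_, fun ξ => ?_⟩
  · exact Integrable.mul_bdd (c := 1) hi hm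
      ((ae_restrict_iff' measurableSet_Ioo).mpr (ae_of_all _ hle))
  · rw [eLpNorm_indicator_eq_eLpNorm_restrict measurableSet_Ioo]
    refine eLpNorm_mono_ae ((ae_restrict_iff' measurableSet_Ioo).mpr (ae_of_all _ fun t ht => ?_))
    rw [norm_mul]
    exact mul_le_of_le_one_right (norm_nonneg _) (hle t ht)
  · rw [fourierTwo, intervalIntegral.integral_of_le hx, ← integral_indicator measurableSet_Ioc,
      ← integral_indicator measurableSet_Ioc |>.symm, ← restrict_Ioo_eq_restrict_Ioc,
      ← integral_indicator measurableSet_Ioo]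
    congr 1
    ext t
    by_cases ht : t ∈ Ioo 0 x
    · rw [indicator_of_mem ht, indicator_of_mem ht, cexp_linePt]; ring
    · rw [indicator_of_notMem ht, indicator_of_notMem ht, zero_mul]

lemma exists_fourierTwo_eq_integral_sub {x τ : ℝ} (hx : 0 ≤ x) (hτ : 0 < τ) {s : ℝ → ℂ}
    (hs : MemLp s 2 (volume.restrict (Ioo 0 x))) :
    ∃ h : ℝ → ℂ, Integrable h ∧
      eLpNorm h 2 volume ≤ eLpNorm s 2 (volume.restrict (Ioo 0 x)) ∧
      ∀ ξ, ∫ t in (0 : ℝ)..x, Complex.exp (2 * Complex.I * linePt τ ξ * (x - t : ℝ)) * s t =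
        fourierTwo h ξ := by
  have hmp : MeasurePreserving (fun t => x - t) (volume.restrict (Ioo 0 x))
      (volume.restrict (Ioo 0 x)) := by
    have h := (Measure.measurePreserving_sub_left volume x).restrict_preimage
      (measurableSet_Ioo (a := 0) (b := x))
    have e : (fun t => x - t) ⁻¹' Ioo 0 x = Ioo 0 x := by
      ext t; simp only [mem_preimage, mem_Ioo]; constructor <;> intro h <;> constructor <;> linarith
    rwa [e] at h
  obtain ⟨h, h1, h2, h3⟩ := exists_fourierTwo_eq_integral hx hτ (hs.comp_measurePreserving hmp)
  rw [eLpNorm_comp_measurePreserving hs.aestronglyMeasurable hmp] at h2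
  refine ⟨h, h1, h2, fun ξ => ?_⟩
  rw [← h3 ξ]
  simpa using intervalIntegral.integral_comp_sub_left (a := 0) (b := x)
    (fun r : ℝ => Complex.exp (2 * Complex.I * linePt τ ξ * r) * s (x - r)) x

/-- Lower bounds on `τ` under which the solutions on the line `Im ρ = τ` are close to the free ones. -/
structure IsLargeHeight (T Ω τ ε : ℝ) : Prop where
  T_pos : 0 < T
  Ω_nonneg : 0 ≤ Ω
  one_le : 1 ≤ τ
  le₁ : Ω * √(1 / (4 * τ)) ≤ ε
  le₂ : 1 / (2 * τ) * (Ω * Ω) ≤ ε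
  -- Here 64 = 4 · 16: in `IsProfile.norm_sub_le` the error constant 2(2 + Ω√T) · 2ε has to be at
  -- most 1/16. With `exp_le`, this leaves enough room for the invariance of the cone.
  le₃ : ε * (64 * (2 + Ω * √T)) ≤ 1
  exp_le : Real.exp (-(2 * τ * T)) ≤ 1 / 16

lemma IsLargeHeight.pos {T Ω τ ε : ℝ} (h : IsLargeHeight T Ω τ ε) : 0 < τ := by linarith [h.one_le]

lemma IsLargeHeight.ε_nonneg {T Ω τ ε : ℝ} (h : IsLargeHeight T Ω τ ε) : 0 ≤ ε :=
  le_trans (mul_nonneg h.Ω_nonneg (Real.sqrt_nonneg _)) h.le₁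

lemma IsLargeHeight.le_half {T Ω τ ε : ℝ} (h : IsLargeHeight T Ω τ ε) :
    ε * (3 + 2 * (Ω * √T)) ≤ 1 / 2 := by
  have h1 := h.le₃
  have h2 := h.ε_nonneg
  have h3 : 0 ≤ Ω * √T := mul_nonneg h.Ω_nonneg (Real.sqrt_nonneg _)
  nlinarith [mul_nonneg h2 h3]

lemma eventually_isLargeHeight {T Ω : ℝ} (hT : 0 < T) (hΩ : 0 ≤ Ω) :
    ∀ᶠ τ in Filter.atTop, IsLargeHeight T Ω τ (1 / (64 * (2 + Ω * √T))) := by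
  have hpos : 0 < 64 * (2 + Ω * √T) := by positivity
  have hε : 0 < 1 / (64 * (2 + Ω * √T)) := by positivity
  have l1 : Filter.Tendsto (fun τ : ℝ => Ω * √(1 / (4 * τ))) Filter.atTop (nhds 0) := by
    have h : Filter.Tendsto (fun τ : ℝ => 1 / (4 * τ)) Filter.atTop (nhds 0) :=
      Filter.Tendsto.const_div_atTop (Filter.tendsto_id.const_mul_atTop (by norm_num)) 1
    simpa using ((Real.continuous_sqrt.tendsto 0).comp h).const_mul Ω
  have l2 : Filter.Tendsto (fun τ : ℝ => 1 / (2 * τ) * (Ω * Ω)) Filter.atTop (nhds 0) := by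
    have h : Filter.Tendsto (fun τ : ℝ => 1 / (2 * τ)) Filter.atTop (nhds 0) :=
      Filter.Tendsto.const_div_atTop (Filter.tendsto_id.const_mul_atTop (by norm_num)) 1
    simpa using h.mul_const (Ω * Ω)
  have l3 : Filter.Tendsto (fun τ : ℝ => Real.exp (-(2 * τ * T))) Filter.atTop (nhds 0) := by
    refine Real.tendsto_exp_neg_atTop_nhds_zero.comp ?_
    exact (Filter.tendsto_id.const_mul_atTop (by norm_num)).atTop_mul_const hT
  filter_upwards [Filter.eventually_ge_atTop 1, l1.eventually_le_const hε,
    l2.eventually_le_const hε, l3.eventually_le_const (by norm_num : (0 : ℝ) < 1 / 16)]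
    with τ h0 h1 h2 h3
  exact ⟨hT, hΩ, h0, h1, h2, by rw [one_div, inv_mul_cancel₀ hpos.ne'], h3⟩

variable {T Ω τ ε : ℝ} {s s' : ℝ → ℂ} {c d : ℂ} {p q p' q' : ℝ → ℝ → ℂ}

/-- The forcing term in the comparison with the free solution. In both equations the product of
kernel and free solution decays exponentially: in one through the free solution e^{2iρt}c, in the
other through the kernel e^{2iρ(x−t)}. So the linear part is at most ε m as well as the quadratic
one. -/
lemma enorm_integral_free_le {k u : ℝ → ℂ} {v w : ℝ → ℂ} {x : ℝ} {c : ℂ} {m : ℝ} (ξ : ℝ)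
    (hL : IsLargeHeight T Ω τ ε) (hs : MemLp s 2 (volume.restrict (Ioo 0 T)))
    (hsΩ : eLpNorm s 2 (volume.restrict (Ioo 0 T)) ≤ ENNReal.ofReal Ω) (hx : x ∈ Icc 0 T)
    (hk : ∀ t ∈ Ioc 0 x, ‖k t‖ ≤ 1) {κ : ℝ → ℝ} (hκ : ∀ t ∈ Ioc 0 x, ‖k t * u t‖ ≤ κ t * ‖c‖)
    (hκ0 : ∀ t, 0 ≤ κ t) (hκm : Measurable κ)
    (hκs : ∫⁻ t in Ioc 0 x, ENNReal.ofReal (κ t) * ‖s t‖ₑ ≤ ENNReal.ofReal (Ω * √(1 / (4 * τ))))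
    (hc : ‖c‖ ≤ m) (hvw : ∀ t ∈ Ioc 0 x, ‖v t‖ + ‖w t‖ ≤ m) :
    ‖∫ t in (0 : ℝ)..x, k t * (s t * u t +
      s t ^ 2 * (linePt τ ξ)⁻¹ * ((v t - w t) / (2 * Complex.I)))‖ₑ ≤
      ENNReal.ofReal (2 * ε * m) := by
  have hm : 0 ≤ m := (norm_nonneg _).trans hc
  have hmeas : volume.restrict (Ioc 0 x) ≤ volume.restrict (Ioo 0 T) := by
    rw [← restrict_Ioo_eq_restrict_Ioc]
    exact Measure.restrict_mono_set _ (Ioo_subset_Ioo_right hx.2)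
  have hsm := hs.aestronglyMeasurable.mono_measure hmeas
  have hbd : ∀ t ∈ Ioc 0 x, ‖k t * (s t * u t +
      s t ^ 2 * (linePt τ ξ)⁻¹ * ((v t - w t) / (2 * Complex.I)))‖ₑ ≤
      ENNReal.ofReal (κ t) * ‖s t‖ₑ * ENNReal.ofReal m +
        ENNReal.ofReal (1 / (2 * τ) * m) * (‖s t‖ₑ * ‖s t‖ₑ) := by
    intro t ht
    have h1 : ‖(v t - w t) / (2 * Complex.I)‖ ≤ m / 2 := by
      rw [norm_div]
      have : ‖(2 * Complex.I : ℂ)‖ = 2 := by simp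
      rw [this]
      have := (norm_sub_le (v t) (w t)).trans (hvw t ht)
      linarith
    have h2 : ‖(linePt τ ξ)⁻¹‖ ≤ 1 / τ := by
      rw [norm_inv, one_div]; exact inv_anti₀ hL.pos (le_norm_linePt τ ξ)
    have h3 : ‖k t * (s t * u t + s t ^ 2 * (linePt τ ξ)⁻¹ * ((v t - w t) / (2 * Complex.I)))‖ ≤
        κ t * ‖s t‖ * m + 1 / (2 * τ) * m * (‖s t‖ * ‖s t‖) := by
      have e : k t * (s t * u t + s t ^ 2 * (linePt τ ξ)⁻¹ * ((v t - w t) / (2 * Complex.I))) =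
        s t * (k t * u t) +
          k t * (s t ^ 2 * (linePt τ ξ)⁻¹ * ((v t - w t) / (2 * Complex.I))) := by ring
      rw [e]
      refine (norm_add_le _ _).trans (add_le_add ?_ ?_)
      · rw [norm_mul]
        calc _ ≤ ‖s t‖ * (κ t * ‖c‖) := by gcongr; exact hκ t ht
          _ ≤ ‖s t‖ * (κ t * m) := by gcongr; exact hκ0 t
          _ = _ := by ring
      · rw [norm_mul, norm_mul, norm_mul, norm_pow]
        have hτ := hL.pos
        calc _ ≤ 1 * (‖s t‖ ^ 2 * (1 / τ) * (m / 2)) := by gcongr; exact hk t ht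
          _ = _ := by field_simp
    rw [← ofReal_norm]
    refine (ENNReal.ofReal_le_ofReal h3).trans (le_of_eq ?_)
    have hτ := hL.pos
    have := hκ0 t
    rw [ENNReal.ofReal_add (by positivity) (by positivity), ENNReal.ofReal_mul (by positivity),
      ENNReal.ofReal_mul (by positivity), ENNReal.ofReal_mul (by positivity),
      ENNReal.ofReal_mul (norm_nonneg _), ofReal_norm]
  refine (enorm_intervalIntegral_le hx.1).trans ((setLIntegral_mono_ae' measurableSet_Ioc
    (ae_of_all _ hbd)).trans ?_)
  have hm1 : AEMeasurable (fun t => ENNReal.ofReal (κ t) * ‖s t‖ₑ * ENNReal.ofReal m)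
      (volume.restrict (Ioc 0 x)) :=
    ((hκm.ennreal_ofReal.aemeasurable).mul hsm.enorm).mul_const _
  rw [lintegral_add_left' hm1, lintegral_mul_const' _ _ ENNReal.ofReal_ne_top,
    lintegral_const_mul' _ _ ENNReal.ofReal_ne_top]
  have h2 : ∫⁻ t in Ioc 0 x, ‖s t‖ₑ * ‖s t‖ₑ ≤ ENNReal.ofReal (Ω * Ω) :=
    (lintegral_mono_set (Ioc_subset_Ioc_right hx.2)).trans (lintegral_mul_enorm_sq_le hL.Ω_nonneg
      hs.aestronglyMeasurable hs.aestronglyMeasurable hsΩ hsΩ)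
  have hτ := hL.pos
  have hε := hL.ε_nonneg
  have hΩ := hL.Ω_nonneg
  calc _ ≤ ENNReal.ofReal (Ω * √(1 / (4 * τ))) * ENNReal.ofReal m +
        ENNReal.ofReal (1 / (2 * τ) * m) * ENNReal.ofReal (Ω * Ω) := by gcongr
    _ = ENNReal.ofReal (Ω * √(1 / (4 * τ)) * m + 1 / (2 * τ) * (Ω * Ω) * m) := by
        rw [ENNReal.ofReal_add (mul_nonneg (mul_nonneg hL.Ω_nonneg (by positivity)) hm)
          (by positivity), ENNReal.ofReal_mul (mul_nonneg hL.Ω_nonneg (by positivity)),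
          ← ENNReal.ofReal_mul (p := 1 / (2 * τ) * m) (by positivity)]
        congr 2; ring
    _ ≤ _ := by
        refine ENNReal.ofReal_le_ofReal ?_
        have := mul_le_mul_of_nonneg_right hL.le₁ hm
        have := mul_le_mul_of_nonneg_right hL.le₂ hm
        linarith

theorem IsProfile.norm_sub_le (hL : IsLargeHeight T Ω τ ε)
    (hs : MemLp s 2 (volume.restrict (Ioo 0 T)))
    (hsΩ : eLpNorm s 2 (volume.restrict (Ioo 0 T)) ≤ ENNReal.ofReal Ω)
    (h : IsProfile T τ s c d p q) (ξ : ℝ) {x : ℝ} (hx : x ∈ Icc 0 T) :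
    ‖p x ξ - Complex.exp (2 * Complex.I * linePt τ ξ * x) * c‖ ≤ (‖c‖ + ‖d‖) / 16 ∧
      ‖q x ξ - d‖ ≤ (‖c‖ + ‖d‖) / 16 := by
  have hτ := hL.pos
  have hε := hL.ε_nonneg
  have hm : 0 ≤ ‖c‖ + ‖d‖ := by positivity
  have hexp : ∀ t : ℝ, 0 ≤ t → ∀ ξ, ‖Complex.exp (2 * Complex.I * linePt τ ξ * t)‖ ≤ 1 := fun t ht ξ => by
    rw [norm_cexp_linePt, Real.exp_le_one_iff]
    have := mul_nonneg hτ.le ht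
    linarith
  have hvw : ∀ t : ℝ, 0 ≤ t → ∀ ξ, ‖Complex.exp (2 * Complex.I * linePt τ ξ * t) * c‖ + ‖d‖ ≤
      ‖c‖ + ‖d‖ := fun t ht ξ => by
    rw [norm_mul]
    gcongr
    exact mul_le_of_le_one_left (norm_nonneg _) (hexp t ht ξ)
  -- For the Dirac measure at ξ the L₂-norm is the modulus at ξ, so the stability estimate becomes
  -- pointwise.
  have key := profile_sub_le (μ := Measure.dirac ξ) (R := |ξ|) (K := 2 * ε * (‖c‖ + ‖d‖))
    hL.T_pos.le hτ hL.Ω_nonneg (by positivity) hL.le₁ hL.le₂ hL.le_half hs MemLp.zero hsΩ h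
    (isProfile_zero hτ c d) (by simp [ae_dirac_eq])
    (F := fun _ _ => ENNReal.ofReal (2 * ε * (‖c‖ + ‖d‖)))
    (G := fun _ _ => ENNReal.ofReal (2 * ε * (‖c‖ + ‖d‖)))
    (fun x _ => aemeasurable_const) (fun x _ => aemeasurable_const)
    (fun x _ => by
      rw [eLpNorm_const _ (by norm_num) (NeZero.ne _)]; simp)
    (fun x _ => by
      rw [eLpNorm_const _ (by norm_num) (NeZero.ne _)]; simp)
    (fun x hx => ae_of_all _ fun ξ => by
      simp only [Pi.zero_apply, sub_zero, ne_eq, OfNat.ofNat_ne_zero, not_false_eq_true, zero_pow]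
      refine enorm_integral_free_le (c := c) ξ hL hs hsΩ hx (fun t ht => by simp)
        (κ := fun t => Real.exp (-(2 * τ * t))) (fun t ht => ?_) (fun t => (Real.exp_pos _).le)
        (by fun_prop) (lintegral_exp_mul_enorm_le hτ hs.aestronglyMeasurable hsΩ hx.2).1
        (by linarith [norm_nonneg d]) (fun t ht => hvw t ht.1.le ξ)
      rw [one_mul, norm_mul, norm_cexp_linePt])
    (fun x hx => ae_of_all _ fun ξ => by
      simp only [Pi.zero_apply, sub_zero, ne_eq, OfNat.ofNat_ne_zero, not_false_eq_true, zero_pow]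
      refine enorm_integral_free_le (c := d) ξ hL hs hsΩ hx
        (fun t ht => hexp _ (sub_nonneg.mpr ht.2) ξ)
        (κ := fun t => Real.exp (-(2 * τ * (x - t)))) (fun t ht => ?_)
        (fun t => (Real.exp_pos _).le)
        (by fun_prop) (lintegral_exp_mul_enorm_le hτ hs.aestronglyMeasurable hsΩ hx.2).2
        (by linarith [norm_nonneg c]) (fun t ht => hvw t ht.1.le ξ)
      rw [norm_mul, norm_cexp_linePt]) x hx
  have hfin : 2 * (2 + Ω * √T) * (2 * ε * (‖c‖ + ‖d‖)) ≤ (‖c‖ + ‖d‖) / 16 := by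
    have := mul_le_mul_of_nonneg_right hL.le₃ hm
    linarith
  have conv : ∀ {f : ℝ → ℂ}, eLpNorm f 2 (Measure.dirac ξ) ≤
      ENNReal.ofReal (2 * (2 + Ω * √T) * (2 * ε * (‖c‖ + ‖d‖))) → ‖f ξ‖ ≤ (‖c‖ + ‖d‖) / 16 := by
    intro f hf
    rw [eLpNorm_dirac f ξ (by norm_num)] at hf
    have := hf.trans (ENNReal.ofReal_le_ofReal hfin)
    rwa [← ofReal_norm, ENNReal.ofReal_le_ofReal_iff (by positivity)] at this
  exact ⟨conv key.1, conv key.2⟩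

end Profile

/-! ### Lipschitz dependence of the two components on the potential, in L₂ of the line. -/

section Profile

variable {T Ω τ ε : ℝ} {s s' : ℝ → ℂ} {c d : ℂ} {p q p' q' : ℝ → ℝ → ℂ}

/-- The forcing is split in three. The free part u₀ of the solution gives, through k u₀ = E c, a
Fourier integral of s − s'; the deviation u − u₀ gives the second term; the quadratic part, with s²
− s'² = (s + s')(s − s'), gives a constant multiple of 1/ρ. -/
lemma enorm_forcing_le {x κ M : ℝ} (hΩ0 : 0 ≤ Ω) (hκ0 : 0 ≤ κ) (hM : 0 ≤ M)
    (hs : MemLp s 2 (volume.restrict (Ioo 0 T)))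
    (hs' : MemLp s' 2 (volume.restrict (Ioo 0 T)))
    (hsΩ : eLpNorm s 2 (volume.restrict (Ioo 0 T)) ≤ ENNReal.ofReal Ω)
    (hsΩ' : eLpNorm s' 2 (volume.restrict (Ioo 0 T)) ≤ ENNReal.ofReal Ω)
    (hκ : eLpNorm (fun t => s t - s' t) 2 (volume.restrict (Ioo 0 T)) ≤ ENNReal.ofReal κ)
    (hx : x ∈ Icc 0 T) (ξ : ℝ) {k E u u₀ v w : ℝ → ℂ} (hkc : Continuous k)
    (hE : Continuous E) (huc : Continuous u) (hvc : Continuous v) (hwc : Continuous w)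
    (hk : ∀ t ∈ Ioc 0 x, ‖k t‖ ≤ 1) (hkE : ∀ t, k t * u₀ t = E t * c)
    (hv : ∀ t ∈ Ioc 0 x, ‖v t‖ ≤ M) (hw : ∀ t ∈ Ioc 0 x, ‖w t‖ ≤ M) :
    ‖∫ t in (0 : ℝ)..x, k t * ((s t - s' t) * u t +
        (s t ^ 2 - s' t ^ 2) * (linePt τ ξ)⁻¹ * ((v t - w t) / (2 * Complex.I)))‖ₑ ≤
      ‖c * ∫ t in (0 : ℝ)..x, E t * (s t - s' t)‖ₑ +
        (∫⁻ t in Ioc 0 x, ‖s t - s' t‖ₑ * ‖u t - u₀ t‖ₑ) +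
        ‖((2 * Ω * κ * M : ℝ) : ℂ) * (linePt τ ξ)⁻¹‖ₑ := by
  have hT : 0 ≤ T := hx.1.trans hx.2
  have hsub : uIcc 0 x ⊆ uIcc 0 T := by
    rw [uIcc_of_le hx.1, uIcc_of_le hT]; exact Icc_subset_Icc_right hx.2
  have is := (hs.intervalIntegrable_of_Ioo hT).mono_set hsub
  have is' := (hs'.intervalIntegrable_of_Ioo hT).mono_set hsub
  have iss := (hs.intervalIntegrable_sq_of_Ioo hT).mono_set hsub
  have iss' := (hs'.intervalIntegrable_sq_of_Ioo hT).mono_set hsub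
  have hmeas : volume.restrict (Ioc 0 x) ≤ volume.restrict (Ioo 0 T) := by
    rw [← restrict_Ioo_eq_restrict_Ioc]
    exact Measure.restrict_mono_set _ (Ioo_subset_Ioo_right hx.2)
  have hsm := hs.aestronglyMeasurable
  have hsm' := hs'.aestronglyMeasurable
  set r : ℂ := (linePt τ ξ)⁻¹ with hr
  have i1 : IntervalIntegrable (fun t => k t * ((s t - s' t) * u t +
      (s t ^ 2 - s' t ^ 2) * r * ((v t - w t) / (2 * Complex.I)))) volume 0 x := by
    refine IntervalIntegrable.continuousOn_mul ?_ hkc.continuousOn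
    exact ((is.sub is').mul_continuousOn huc.continuousOn).add
      (((iss.sub iss').mul_const r).mul_continuousOn
      (by fun_prop : Continuous fun t => (v t - w t) / (2 * Complex.I)).continuousOn)
  have i2 : IntervalIntegrable (fun t => E t * (s t - s' t)) volume 0 x :=
    (is.sub is').continuousOn_mul hE.continuousOn
  have i3 : IntervalIntegrable (fun t => c * (E t * (s t - s' t))) volume 0 x := i2.const_mul c
  have hsplit : (∫ t in (0 : ℝ)..x, k t * ((s t - s' t) * u t +
        (s t ^ 2 - s' t ^ 2) * r * ((v t - w t) / (2 * Complex.I)))) =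
      c * (∫ t in (0 : ℝ)..x, E t * (s t - s' t)) +
      ∫ t in (0 : ℝ)..x, (k t * ((s t - s' t) * u t +
        (s t ^ 2 - s' t ^ 2) * r * ((v t - w t) / (2 * Complex.I))) -
          c * (E t * (s t - s' t))) := by
    rw [intervalIntegral.integral_sub i1 i3, intervalIntegral.integral_const_mul]; ring
  rw [hsplit, add_assoc]
  refine (enorm_add_le _ _).trans (add_le_add le_rfl ?_)
  have hpt : ∀ t ∈ Ioc 0 x, ‖k t * ((s t - s' t) * u t +
        (s t ^ 2 - s' t ^ 2) * r * ((v t - w t) / (2 * Complex.I))) -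
          c * (E t * (s t - s' t))‖ₑ ≤ ‖s t - s' t‖ₑ * ‖u t - u₀ t‖ₑ +
        ENNReal.ofReal M * ‖r‖ₑ * (‖s t‖ₑ * ‖s t - s' t‖ₑ + ‖s' t‖ₑ * ‖s t - s' t‖ₑ) := by
    intro t ht
    have hk1 : ‖k t‖ₑ ≤ 1 := by
      rw [← ofReal_norm, ← ENNReal.ofReal_one]; exact ENNReal.ofReal_le_ofReal (hk t ht)
    have hvw : ‖(v t - w t) / (2 * Complex.I)‖ₑ ≤ ENNReal.ofReal M := by
      rw [← ofReal_norm]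
      refine ENNReal.ofReal_le_ofReal ?_
      have h2 : ‖(2 * Complex.I : ℂ)‖ = 2 := by simp
      rw [norm_div, h2]
      have := (norm_sub_le (v t) (w t)).trans (add_le_add (hv t ht) (hw t ht))
      linarith
    have e : k t * ((s t - s' t) * u t +
        (s t ^ 2 - s' t ^ 2) * r * ((v t - w t) / (2 * Complex.I))) - c * (E t * (s t - s' t)) =
        k t * ((s t - s' t) * (u t - u₀ t)) +
        k t * ((s t * (s t - s' t) + s' t * (s t - s' t)) * r *
          ((v t - w t) / (2 * Complex.I))) := by
      linear_combination (s t - s' t) * hkE t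
    rw [e]
    refine (enorm_add_le _ _).trans (add_le_add ?_ ?_)
    · rw [enorm_mul, enorm_mul]
      exact mul_le_of_le_one_left zero_le hk1
    · rw [enorm_mul, enorm_mul, enorm_mul]
      calc _ ≤ 1 * (‖s t * (s t - s' t) + s' t * (s t - s' t)‖ₑ * ‖r‖ₑ * ENNReal.ofReal M) := by
            gcongr
        _ ≤ 1 * ((‖s t‖ₑ * ‖s t - s' t‖ₑ + ‖s' t‖ₑ * ‖s t - s' t‖ₑ) * ‖r‖ₑ *
            ENNReal.ofReal M) := by
            gcongr
            refine (enorm_add_le _ _).trans ?_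
            rw [enorm_mul, enorm_mul]
        _ = _ := by ring
  refine (enorm_intervalIntegral_le hx.1).trans ((setLIntegral_mono_ae' measurableSet_Ioc
    (ae_of_all _ hpt)).trans ?_)
  have hm : AEMeasurable (fun t => ENNReal.ofReal M * ‖r‖ₑ * (‖s t‖ₑ * ‖s t - s' t‖ₑ +
      ‖s' t‖ₑ * ‖s t - s' t‖ₑ)) (volume.restrict (Ioc 0 x)) := by
    have a1 := hsm.enorm.mono_measure hmeas
    have a2 := hsm'.enorm.mono_measure hmeas
    have a3 := (hsm.sub hsm').enorm.mono_measure hmeas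
    exact ((a1.mul a3).add (a2.mul a3)).const_mul _
  rw [lintegral_add_right' _ hm]
  refine add_le_add le_rfl ?_
  have a4 : AEMeasurable (fun t => ‖s t‖ₑ * ‖s t - s' t‖ₑ) (volume.restrict (Ioc 0 x)) :=
    (hsm.enorm.mono_measure hmeas).mul ((hsm.sub hsm').enorm.mono_measure hmeas)
  rw [lintegral_const_mul' _ _ (ENNReal.mul_ne_top ENNReal.ofReal_ne_top enorm_ne_top),
    lintegral_add_left' a4]
  have b1 : ∫⁻ t in Ioc 0 x, ‖s t‖ₑ * ‖s t - s' t‖ₑ ≤ ENNReal.ofReal (Ω * κ) :=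
    (lintegral_mono_set (Ioc_subset_Ioc_right hx.2)).trans
      (lintegral_mul_enorm_sq_le hΩ0 hsm (hsm.sub hsm') hsΩ hκ)
  have b2 : ∫⁻ t in Ioc 0 x, ‖s' t‖ₑ * ‖s t - s' t‖ₑ ≤ ENNReal.ofReal (Ω * κ) :=
    (lintegral_mono_set (Ioc_subset_Ioc_right hx.2)).trans
      (lintegral_mul_enorm_sq_le hΩ0 hsm' (hsm.sub hsm') hsΩ' hκ)
  calc _ ≤ ENNReal.ofReal M * ‖r‖ₑ * (ENNReal.ofReal (Ω * κ) + ENNReal.ofReal (Ω * κ)) := by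
        gcongr
    _ = _ := by
        have hpos : 0 ≤ 2 * Ω * κ * M := by positivity
        rw [enorm_mul, ← ofReal_norm ((2 * Ω * κ * M : ℝ) : ℂ), Complex.norm_real,
          Real.norm_of_nonneg hpos, ← ENNReal.ofReal_add (by positivity) (by positivity),
          mul_right_comm, ← ENNReal.ofReal_mul hM]
        congr 2; ring

/-- The three pieces of `enorm_forcing_le` are estimated by Plancherel's inequality, by Minkowski's
inequality with the L₂-distance D of the solution from the free one, and by `eLpNorm_inv_linePt_le`.
They contribute 2m, √T D and 8Ωm, each times κ. -/
lemma exists_forcing_bound {x κ m D : ℝ} {μ : Measure ℝ} [SFinite μ] (hμ : μ ≤ volume)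
    (hL : IsLargeHeight T Ω τ ε) (hκ0 : 0 ≤ κ) (hD0 : 0 ≤ D)
    (hs : MemLp s 2 (volume.restrict (Ioo 0 T)))
    (hs' : MemLp s' 2 (volume.restrict (Ioo 0 T)))
    (hsΩ : eLpNorm s 2 (volume.restrict (Ioo 0 T)) ≤ ENNReal.ofReal Ω)
    (hsΩ' : eLpNorm s' 2 (volume.restrict (Ioo 0 T)) ≤ ENNReal.ofReal Ω)
    (hκ : eLpNorm (fun t => s t - s' t) 2 (volume.restrict (Ioo 0 T)) ≤ ENNReal.ofReal κ)
    (hx : x ∈ Icc 0 T) (hc : ‖c‖ ≤ m) {k E u u₀ v w : ℝ → ℝ → ℂ} (hkc : ∀ ξ, Continuous (k ξ))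
    (hE : ∀ ξ, Continuous (E ξ)) (huc : ∀ ξ, Continuous fun t => u t ξ)
    (hvc : ∀ ξ, Continuous fun t => v t ξ) (hwc : ∀ ξ, Continuous fun t => w t ξ)
    (hum : Measurable (Function.uncurry u)) (hum₀ : Measurable (Function.uncurry u₀))
    (hk : ∀ ξ, ∀ t ∈ Ioc 0 x, ‖k ξ t‖ ≤ 1) (hkE : ∀ ξ t, k ξ t * u₀ t ξ = E ξ t * c)
    (hv : ∀ ξ, ∀ t ∈ Ioc 0 x, ‖v t ξ‖ ≤ 2 * m) (hw : ∀ ξ, ∀ t ∈ Ioc 0 x, ‖w t ξ‖ ≤ 2 * m)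
    (hD : ∀ t ∈ Icc 0 T, eLpNorm (fun ξ => u t ξ - u₀ t ξ) 2 μ ≤ ENNReal.ofReal D)
    {h : ℝ → ℂ} (hi : Integrable h) (hh : eLpNorm h 2 volume ≤ ENNReal.ofReal κ)
    (hEh : ∀ ξ, ∫ t in (0 : ℝ)..x, E ξ t * (s t - s' t) = fourierTwo h ξ) :
    ∃ F : ℝ → ℝ≥0∞, AEMeasurable F μ ∧
      eLpNorm F 2 μ ≤ ENNReal.ofReal (κ * (2 * m + √T * D + 8 * Ω * m)) ∧
      ∀ ξ, ‖∫ t in (0 : ℝ)..x, k ξ t * ((s t - s' t) * u t ξ +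
        (s t ^ 2 - s' t ^ 2) * (linePt τ ξ)⁻¹ * ((v t ξ - w t ξ) / (2 * Complex.I)))‖ₑ ≤ F ξ := by
  have hm : 0 ≤ m := (norm_nonneg _).trans hc
  have hΩ := hL.Ω_nonneg
  have hmeas : volume.restrict (Ioc 0 x) ≤ volume.restrict (Ioo 0 T) := by
    rw [← restrict_Ioo_eq_restrict_Ioc]
    exact Measure.restrict_mono_set _ (Ioo_subset_Ioo_right hx.2)
  have hsm : AEMeasurable (fun t => ‖s t - s' t‖ₑ) (volume.restrict (Ioc 0 x)) :=
    (hs.aestronglyMeasurable.sub hs'.aestronglyMeasurable).enorm.mono_measure hmeas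
  have hdm : Measurable (Function.uncurry fun t ξ => u t ξ - u₀ t ξ) := hum.sub hum₀
  have hF1 : Continuous fun ξ => ‖c * fourierTwo h ξ‖ₑ :=
    (continuous_const.mul (continuous_fourierTwo hi)).enorm
  have hF2 : AEMeasurable (fun ξ => ∫⁻ t in Ioc 0 x, ‖s t - s' t‖ₑ * ‖u t ξ - u₀ t ξ‖ₑ) μ :=
    aemeasurable_lintegral_mul_enorm hsm hdm
  have hF3 : Measurable fun ξ => ‖((2 * Ω * κ * (2 * m) : ℝ) : ℂ) * (linePt τ ξ)⁻¹‖ₑ :=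
    ((continuous_linePt τ).measurable.inv.const_mul _).enorm
  refine ⟨_, (hF1.measurable.aemeasurable.add hF2).add hF3.aemeasurable, ?_, fun ξ =>
    (enorm_forcing_le (M := 2 * m) hΩ hκ0 (by positivity) hs hs' hsΩ hsΩ' hκ hx ξ (hkc ξ)
      (hE ξ) (huc ξ) (hvc ξ) (hwc ξ) (hk ξ) (hkE ξ) (hv ξ) (hw ξ)).trans (le_of_eq (by
        rw [hEh]; rfl))⟩
  have h12 : (1 : ℝ≥0∞) ≤ 2 := by norm_num
  have b1 : eLpNorm (fun ξ => ‖c * fourierTwo h ξ‖ₑ) 2 μ ≤ ENNReal.ofReal (2 * m * κ) := by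
    rw [eLpNorm_enorm]
    refine (eLpNorm_mono_measure _ hμ).trans ?_
    calc _ ≤ ‖c‖ₑ * eLpNorm (fourierTwo h) 2 volume := eLpNorm_const_smul_le (c := c)
      _ ≤ ENNReal.ofReal m * (ENNReal.ofReal 2 * ENNReal.ofReal κ) := by
          gcongr
          · rw [← ofReal_norm]; exact ENNReal.ofReal_le_ofReal hc
          · exact (eLpNorm_fourierTwo_le hi).trans (by gcongr)
      _ = _ := by
          rw [← ENNReal.ofReal_mul (by norm_num), ← ENNReal.ofReal_mul hm]; congr 1; ring
  have b2 : eLpNorm (fun ξ => ∫⁻ t in Ioc 0 x, ‖s t - s' t‖ₑ * ‖u t ξ - u₀ t ξ‖ₑ) 2 μ ≤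
      ENNReal.ofReal (κ * √T * D) := by
    rw [ENNReal.ofReal_mul (by positivity)]
    refine eLpNorm_two_le_of_le_lintegral hsm hdm (ae_of_all _ fun ξ => le_rfl)
      ((lintegral_mono_set (Ioc_subset_Ioc_right hx.2)).trans (lintegral_enorm_le hL.T_pos.le
        (hs.aestronglyMeasurable.sub hs'.aestronglyMeasurable) hκ)) ?_
    exact (ae_restrict_iff' measurableSet_Ioc).mpr (ae_of_all _ fun t ht =>
      hD t ⟨ht.1.le, ht.2.trans hx.2⟩)
  have b3 : eLpNorm (fun ξ => ‖((2 * Ω * κ * (2 * m) : ℝ) : ℂ) * (linePt τ ξ)⁻¹‖ₑ) 2 μ ≤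
      ENNReal.ofReal (8 * Ω * κ * m) := by
    rw [eLpNorm_enorm]
    refine (eLpNorm_mono_measure _ hμ).trans ?_
    have hpos : 0 ≤ 2 * Ω * κ * (2 * m) := by positivity
    calc _ ≤ ‖((2 * Ω * κ * (2 * m) : ℝ) : ℂ)‖ₑ * eLpNorm (fun ξ => (linePt τ ξ)⁻¹) 2 volume :=
          eLpNorm_const_smul_le (c := ((2 * Ω * κ * (2 * m) : ℝ) : ℂ))
      _ ≤ ENNReal.ofReal (2 * Ω * κ * (2 * m)) * ENNReal.ofReal 2 := by
          gcongr
          · rw [← ofReal_norm, Complex.norm_real, Real.norm_of_nonneg hpos]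
          · exact eLpNorm_inv_linePt_le hL.one_le
      _ = _ := by rw [← ENNReal.ofReal_mul hpos]; congr 1; ring
  refine (eLpNorm_add_le (hF1.measurable.aemeasurable.add hF2).aestronglyMeasurable
    hF3.aestronglyMeasurable h12).trans ?_
  refine (add_le_add (eLpNorm_add_le hF1.measurable.aestronglyMeasurable hF2.aestronglyMeasurable
    h12) le_rfl).trans ?_
  refine (add_le_add (add_le_add b1 b2) b3).trans (le_of_eq ?_)
  rw [← ENNReal.ofReal_add (by positivity) (by positivity),
    ← ENNReal.ofReal_add (by positivity) (by positivity)]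
  congr 1; ring

lemma IsProfile.eLpNorm_sub_le_of_close {κ m D R : ℝ} {μ : Measure ℝ} [IsFiniteMeasure μ]
    (hμ : μ ≤ volume) (hR : ∀ᵐ ξ ∂μ, |ξ| ≤ R)
    (hL : IsLargeHeight T Ω τ ε) (hκ0 : 0 ≤ κ) (hD0 : 0 ≤ D)
    (hs : MemLp s 2 (volume.restrict (Ioo 0 T)))
    (hs' : MemLp s' 2 (volume.restrict (Ioo 0 T)))
    (hsΩ : eLpNorm s 2 (volume.restrict (Ioo 0 T)) ≤ ENNReal.ofReal Ω)
    (hsΩ' : eLpNorm s' 2 (volume.restrict (Ioo 0 T)) ≤ ENNReal.ofReal Ω)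
    (hκ : eLpNorm (fun t => s t - s' t) 2 (volume.restrict (Ioo 0 T)) ≤ ENNReal.ofReal κ)
    (hc : ‖c‖ ≤ m) (hd : ‖d‖ ≤ m) (h : IsProfile T τ s c d p q) (h' : IsProfile T τ s' c d p' q')
    (hp' : ∀ ξ, ∀ t ∈ Icc 0 T, ‖p' t ξ‖ ≤ 2 * m) (hq' : ∀ ξ, ∀ t ∈ Icc 0 T, ‖q' t ξ‖ ≤ 2 * m)
    (hDp : ∀ t ∈ Icc 0 T, eLpNorm (fun ξ => p' t ξ -
      Complex.exp (2 * Complex.I * linePt τ ξ * t) * c) 2 μ ≤ ENNReal.ofReal D)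
    (hDq : ∀ t ∈ Icc 0 T, eLpNorm (fun ξ => q' t ξ - d) 2 μ ≤ ENNReal.ofReal D) :
    ∀ x ∈ Icc 0 T,
      eLpNorm (fun ξ => p x ξ - p' x ξ) 2 μ ≤
        ENNReal.ofReal (2 * (2 + Ω * √T) * (κ * (2 * m + √T * D + 8 * Ω * m))) ∧
      eLpNorm (fun ξ => q x ξ - q' x ξ) 2 μ ≤
        ENNReal.ofReal (2 * (2 + Ω * √T) * (κ * (2 * m + √T * D + 8 * Ω * m))) := by
  have hm : 0 ≤ m := (norm_nonneg _).trans hc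
  have hΩ := hL.Ω_nonneg
  have hτ := hL.pos
  have hexp : ∀ t : ℝ, 0 ≤ t → ∀ ξ, ‖Complex.exp (2 * Complex.I * linePt τ ξ * t)‖ ≤ 1 :=
    fun t ht ξ => by
      rw [norm_cexp_linePt, Real.exp_le_one_iff]
      have := mul_nonneg hτ.le ht
      linarith
  have hcl := continuous_linePt τ
  have hfree : Measurable (Function.uncurry fun (t ξ : ℝ) =>
      Complex.exp (2 * Complex.I * linePt τ ξ * t) * c) := (isProfile_zero (T := T) hτ c d).measurable_p
  have hmono : ∀ x ∈ Icc 0 T, volume.restrict (Ioo 0 x) ≤ volume.restrict (Ioo 0 T) :=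
    fun x hx => Measure.restrict_mono_set _ (Ioo_subset_Ioo_right hx.2)
  have hF : ∀ x ∈ Icc 0 T, ∃ F : ℝ → ℝ≥0∞, AEMeasurable F μ ∧
      eLpNorm F 2 μ ≤ ENNReal.ofReal (κ * (2 * m + √T * D + 8 * Ω * m)) ∧
      ∀ ξ, ‖∫ t in (0 : ℝ)..x, 1 * ((s t - s' t) * p' t ξ + (s t ^ 2 - s' t ^ 2) *
        (linePt τ ξ)⁻¹ * ((p' t ξ - q' t ξ) / (2 * Complex.I)))‖ₑ ≤ F ξ := by
    intro x hx
    have hsx : MemLp (fun t => s t - s' t) 2 (volume.restrict (Ioo 0 x)) :=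
      (hs.sub hs').mono_measure (hmono x hx)
    obtain ⟨h0, i0, n0, e0⟩ := exists_fourierTwo_eq_integral hx.1 hτ hsx
    exact exists_forcing_bound hμ hL hκ0 hD0 hs hs' hsΩ hsΩ' hκ hx hc (k := fun _ _ => 1)
      (fun ξ => continuous_const) (fun ξ => by fun_prop) h'.continuous_p h'.continuous_p
      h'.continuous_q h'.measurable_p hfree (fun ξ t _ => by simp)
      (fun ξ t => by rw [one_mul])
      (fun ξ t ht => hp' ξ t ⟨ht.1.le, ht.2.trans hx.2⟩)
      (fun ξ t ht => hq' ξ t ⟨ht.1.le, ht.2.trans hx.2⟩) hDp i0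
      (n0.trans ((eLpNorm_mono_measure _ (hmono x hx)).trans hκ)) e0
  have hG : ∀ x ∈ Icc 0 T, ∃ F : ℝ → ℝ≥0∞, AEMeasurable F μ ∧
      eLpNorm F 2 μ ≤ ENNReal.ofReal (κ * (2 * m + √T * D + 8 * Ω * m)) ∧
      ∀ ξ, ‖∫ t in (0 : ℝ)..x, Complex.exp (2 * Complex.I * linePt τ ξ * (x - t : ℝ)) *
        ((s t - s' t) * q' t ξ + (s t ^ 2 - s' t ^ 2) *
        (linePt τ ξ)⁻¹ * ((p' t ξ - q' t ξ) / (2 * Complex.I)))‖ₑ ≤ F ξ := by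
    intro x hx
    have hsx : MemLp (fun t => s t - s' t) 2 (volume.restrict (Ioo 0 x)) :=
      (hs.sub hs').mono_measure (hmono x hx)
    obtain ⟨h0, i0, n0, e0⟩ := exists_fourierTwo_eq_integral_sub hx.1 hτ hsx
    exact exists_forcing_bound hμ hL hκ0 hD0 hs hs' hsΩ hsΩ' hκ hx hd
      (k := fun ξ t => Complex.exp (2 * Complex.I * linePt τ ξ * (x - t : ℝ)))
      (u₀ := fun _ _ => d)
      (fun ξ => by fun_prop) (fun ξ => by fun_prop) h'.continuous_q h'.continuous_p
      h'.continuous_q h'.measurable_q measurable_const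
      (fun ξ t ht => hexp _ (sub_nonneg.mpr ht.2) ξ) (fun ξ t => rfl)
      (fun ξ t ht => hp' ξ t ⟨ht.1.le, ht.2.trans hx.2⟩)
      (fun ξ t ht => hq' ξ t ⟨ht.1.le, ht.2.trans hx.2⟩) hDq i0
      (n0.trans ((eLpNorm_mono_measure _ (hmono x hx)).trans hκ)) e0
  choose! F hF1 hF2 hF3 using hF
  choose! G hG1 hG2 hG3 using hG
  exact profile_sub_le hL.T_pos.le hτ hΩ (by positivity) hL.le₁ hL.le₂ hL.le_half hs hs' hsΩ h h'
    hR hF1 hG1 hF2 hG2 (fun x hx => ae_of_all _ (hF3 x hx)) (fun x hx => ae_of_all _ (hG3 x hx))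

lemma IsProfile.norm_le_two_mul (hL : IsLargeHeight T Ω τ ε)
    (hs : MemLp s 2 (volume.restrict (Ioo 0 T)))
    (hsΩ : eLpNorm s 2 (volume.restrict (Ioo 0 T)) ≤ ENNReal.ofReal Ω)
    (h : IsProfile T τ s c d p q) (ξ : ℝ) {x : ℝ} (hx : x ∈ Icc 0 T) :
    ‖p x ξ‖ ≤ 2 * (‖c‖ + ‖d‖) ∧ ‖q x ξ‖ ≤ 2 * (‖c‖ + ‖d‖) := by
  obtain ⟨h1, h2⟩ := h.norm_sub_le hL hs hsΩ ξ hx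
  have h3 : ‖Complex.exp (2 * Complex.I * linePt τ ξ * x) * c‖ ≤ ‖c‖ := by
    rw [norm_mul, norm_cexp_linePt]
    refine mul_le_of_le_one_left (norm_nonneg _) (Real.exp_le_one_iff.mpr ?_)
    have := mul_nonneg hL.pos.le hx.1
    linarith
  have h4 := norm_le_insert' (p x ξ) (Complex.exp (2 * Complex.I * linePt τ ξ * x) * c)
  have h5 := norm_le_insert' (q x ξ) d
  constructor <;> linarith [norm_nonneg c, norm_nonneg d]

/-- The comparison of two close profiles is used twice. Applied to s' and the zero potential, where
the deviation from the free solution is zero and κ = Ω, it gives the L₂-distance D of the second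
profile from the free one. With this D it is then applied to s and s'. Both steps take place on [−n,
n], with constants independent of n. -/
theorem IsProfile.eLpNorm_sub_le {κ : ℝ} (hL : IsLargeHeight T Ω τ ε) (hκ0 : 0 ≤ κ)
    (hs : MemLp s 2 (volume.restrict (Ioo 0 T)))
    (hs' : MemLp s' 2 (volume.restrict (Ioo 0 T)))
    (hsΩ : eLpNorm s 2 (volume.restrict (Ioo 0 T)) ≤ ENNReal.ofReal Ω)
    (hsΩ' : eLpNorm s' 2 (volume.restrict (Ioo 0 T)) ≤ ENNReal.ofReal Ω)
    (hκ : eLpNorm (fun t => s t - s' t) 2 (volume.restrict (Ioo 0 T)) ≤ ENNReal.ofReal κ)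
    (h : IsProfile T τ s c d p q) (h' : IsProfile T τ s' c d p' q') {x : ℝ} (hx : x ∈ Icc 0 T) :
    eLpNorm (fun ξ => p x ξ - p' x ξ) 2 volume ≤ ENNReal.ofReal
      (2 * (2 + Ω * √T) * (2 + 8 * Ω) * (1 + √T * (2 * (2 + Ω * √T) * Ω)) * (‖c‖ + ‖d‖) * κ) ∧
    eLpNorm (fun ξ => q x ξ - q' x ξ) 2 volume ≤ ENNReal.ofReal
      (2 * (2 + Ω * √T) * (2 + 8 * Ω) * (1 + √T * (2 * (2 + Ω * √T) * Ω)) * (‖c‖ + ‖d‖) * κ) := by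
  set m := ‖c‖ + ‖d‖ with hm
  have hm0 : 0 ≤ m := by positivity
  have hcm : ‖c‖ ≤ m := by linarith [norm_nonneg d]
  have hdm : ‖d‖ ≤ m := by linarith [norm_nonneg c]
  have hΩ := hL.Ω_nonneg
  set D := 2 * (2 + Ω * √T) * (Ω * (2 * m + √T * 0 + 8 * Ω * m)) with hD
  have hD0 : 0 ≤ D := by positivity
  have key : ∀ n : ℕ, _ := fun n => by
    have hR : ∀ᵐ ξ : ℝ ∂(volume.restrict (Icc (-n : ℝ) n)), |ξ| ≤ (n : ℝ) := by
      filter_upwards [ae_restrict_mem measurableSet_Icc] with ξ hξ using abs_le.mpr hξ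
    have hμ : volume.restrict (Icc (-n : ℝ) n) ≤ volume := Measure.restrict_le_self
    have h0 := isProfile_zero hL.pos c d (T := T)
    have z0 : eLpNorm (0 : ℝ → ℂ) 2 (volume.restrict (Ioo 0 T)) ≤ ENNReal.ofReal Ω := by simp
    have step1 := h'.eLpNorm_sub_le_of_close hμ hR hL hΩ le_rfl hs' MemLp.zero hsΩ' z0
      (by simpa using hsΩ') hcm hdm h0
      (fun ξ t ht => (h0.norm_le_two_mul hL MemLp.zero z0 ξ ht).1)
      (fun ξ t ht => (h0.norm_le_two_mul hL MemLp.zero z0 ξ ht).2)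
      (fun t ht => by simp) (fun t ht => by simp)
    exact h.eLpNorm_sub_le_of_close hμ hR hL hκ0 hD0 hs hs' hsΩ hsΩ' hκ hcm hdm h'
      (fun ξ t ht => (h'.norm_le_two_mul hL hs' hsΩ' ξ ht).1)
      (fun ξ t ht => (h'.norm_le_two_mul hL hs' hsΩ' ξ ht).2)
      (fun t ht => (step1 t ht).1) (fun t ht => (step1 t ht).2) x hx
  have e : 2 * (2 + Ω * √T) * (κ * (2 * m + √T * D + 8 * Ω * m)) =
      2 * (2 + Ω * √T) * (2 + 8 * Ω) * (1 + √T * (2 * (2 + Ω * √T) * Ω)) * m * κ := by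
    rw [hD]; ring
  rw [e] at key
  have hpair : Measurable fun ξ : ℝ => (x, ξ) := measurable_const.prodMk measurable_id
  exact ⟨eLpNorm_two_le_of_forall_restrict
      ((h.measurable_p.comp hpair).sub (h'.measurable_p.comp hpair)).aestronglyMeasurable
      fun n => (key n).1,
    eLpNorm_two_le_of_forall_restrict
      ((h.measurable_q.comp hpair).sub (h'.measurable_q.comp hpair)).aestronglyMeasurable
      fun n => (key n).2⟩

end Profile

/-! ### Construction of the components from solutions of the Sturm-Liouville equation. -/

section Profile

variable {T τ : ℝ} {s : ℝ → ℂ} {ρ : ℂ} {y y1 : ℝ → ℂ}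

lemma hasDerivAt_cexp_mul (a : ℂ) (x : ℝ) :
    HasDerivAt (fun t : ℝ => Complex.exp (a * t)) (a * Complex.exp (a * x)) x := by
  have := ((hasDerivAt_id x).ofReal_comp.const_mul a).cexp
  simpa [mul_comm] using this

lemma absolutelyContinuousOnInterval_cexp_mul (a : ℂ) (T : ℝ) :
    AbsolutelyContinuousOnInterval (fun t : ℝ => Complex.exp (a * t)) 0 T := by
  refine ContDiffOn.absolutelyContinuousOnInterval (ContDiff.contDiffOn ?_)
  exact (contDiff_const.mul Complex.ofRealCLM.contDiff).cexp

/-- In the free case y^{[1]}/ρ − iy is a multiple of e^{-iρx}, so the factor e^{iρx} removes the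
oscillation. With λ = ρ² all terms without the potential cancel in the derivative, which leaves an
equation with kernel 1. -/
lemma IsSLSolution.profile_eq_q (h : IsSLSolution T s (ρ ^ 2) y y1) (hρ : ρ ≠ 0)
    (hs : MemLp s 2 (volume.restrict (Ioo 0 T))) (hy : Continuous y) (hy1 : Continuous y1)
    {x : ℝ} (hx : x ∈ Icc 0 T) :
    Complex.exp (Complex.I * ρ * x) * (y1 x * ρ⁻¹ - Complex.I * y x) =
      y1 0 * ρ⁻¹ - Complex.I * y 0 - ∫ t in (0 : ℝ)..x, 1 *
        (s t * (Complex.exp (Complex.I * ρ * t) * (y1 t * ρ⁻¹ + Complex.I * y t)) +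
          s t ^ 2 * ρ⁻¹ * ((Complex.exp (Complex.I * ρ * t) * (y1 t * ρ⁻¹ + Complex.I * y t) -
            Complex.exp (Complex.I * ρ * t) * (y1 t * ρ⁻¹ - Complex.I * y t)) /
              (2 * Complex.I))) := by
  have hT : 0 ≤ T := hx.1.trans hx.2
  have hr : ρ * ρ⁻¹ = 1 := mul_inv_cancel₀ hρ
  set r := ρ⁻¹
  have hac : AbsolutelyContinuousOnInterval
      (fun t : ℝ => Complex.exp (Complex.I * ρ * t) * (y1 t * r - Complex.I * y t)) 0 T := by
    refine (absolutelyContinuousOnInterval_cexp_mul _ T).smul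
      ((?_ : AbsolutelyContinuousOnInterval _ 0 T).sub (h.ac.const_smul Complex.I))
    simpa [mul_comm] using h.ac_quasi.const_smul r
  have is := hs.intervalIntegrable_of_Ioo hT
  have iss := hs.intervalIntegrable_sq_of_Ioo hT
  have hi : IntervalIntegrable (fun t : ℝ => -(1 *
        (s t * (Complex.exp (Complex.I * ρ * t) * (y1 t * r + Complex.I * y t)) +
          s t ^ 2 * r * ((Complex.exp (Complex.I * ρ * t) * (y1 t * r + Complex.I * y t) -
            Complex.exp (Complex.I * ρ * t) * (y1 t * r - Complex.I * y t)) /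
              (2 * Complex.I))))) volume 0 T := by
    refine (((is.mul_continuousOn ?_).add ((iss.mul_const r).mul_continuousOn ?_)).const_mul 1).neg
    · exact (by fun_prop : Continuous _).continuousOn
    · exact (by fun_prop : Continuous _).continuousOn
  have key := hac.integral_eq_sub_of_ae_hasDerivAt hi (by
    rw [← ae_restrict_Ioo_iff hT]
    filter_upwards [h.quasi_deriv, h.equation] with t a b
    refine ((hasDerivAt_cexp_mul (Complex.I * ρ) t).fun_mul
      ((b.mul_const r).fun_sub (a.const_mul Complex.I))).congr_deriv ?_
    have hpq : (Complex.exp (Complex.I * ρ * t) * (y1 t * r + Complex.I * y t) -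
            Complex.exp (Complex.I * ρ * t) * (y1 t * r - Complex.I * y t)) /
              (2 * Complex.I) = Complex.exp (Complex.I * ρ * t) * y t := by
      field_simp; ring
    rw [hpq]
    linear_combination (Complex.I * Complex.exp (Complex.I * ρ * t) * y1 t -
      ρ * Complex.exp (Complex.I * ρ * t) * y t) * hr -
      ρ * Complex.exp (Complex.I * ρ * t) * y t * Complex.I_sq) x (by rwa [uIcc_of_le hT])
  rw [intervalIntegral.integral_neg] at key
  simp only [Complex.ofReal_zero, mul_zero, Complex.exp_zero, one_mul] at key ⊢
  linear_combination -key

/-- The combination y^{[1]}/ρ + iy oscillates as e^{iρx}, so e^{-iρx} is the factor under which the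
derivative simplifies. Multiplication by e^{2iρx} restores the common factor e^{iρx} of both
components and produces the kernel e^{2iρ(x−t)}. -/
lemma IsSLSolution.profile_eq_p (h : IsSLSolution T s (ρ ^ 2) y y1) (hρ : ρ ≠ 0)
    (hs : MemLp s 2 (volume.restrict (Ioo 0 T))) (hy : Continuous y) (hy1 : Continuous y1)
    {x : ℝ} (hx : x ∈ Icc 0 T) :
    Complex.exp (Complex.I * ρ * x) * (y1 x * ρ⁻¹ + Complex.I * y x) =
      Complex.exp (2 * Complex.I * ρ * x) * (y1 0 * ρ⁻¹ + Complex.I * y 0) -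
        ∫ t in (0 : ℝ)..x, Complex.exp (2 * Complex.I * ρ * (x - t : ℝ)) *
        (s t * (Complex.exp (Complex.I * ρ * t) * (y1 t * ρ⁻¹ - Complex.I * y t)) +
          s t ^ 2 * ρ⁻¹ * ((Complex.exp (Complex.I * ρ * t) * (y1 t * ρ⁻¹ + Complex.I * y t) -
            Complex.exp (Complex.I * ρ * t) * (y1 t * ρ⁻¹ - Complex.I * y t)) /
              (2 * Complex.I))) := by
  have hT : 0 ≤ T := hx.1.trans hx.2
  have hr : ρ * ρ⁻¹ = 1 := mul_inv_cancel₀ hρ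
  set r := ρ⁻¹
  have hac : AbsolutelyContinuousOnInterval
      (fun t : ℝ => Complex.exp (-(Complex.I * ρ) * t) * (y1 t * r + Complex.I * y t)) 0 T := by
    refine (absolutelyContinuousOnInterval_cexp_mul _ T).smul
      ((?_ : AbsolutelyContinuousOnInterval _ 0 T).add (h.ac.const_smul Complex.I))
    simpa [mul_comm] using h.ac_quasi.const_smul r
  have is := hs.intervalIntegrable_of_Ioo hT
  have iss := hs.intervalIntegrable_sq_of_Ioo hT
  have hi : IntervalIntegrable (fun t : ℝ => -(Complex.exp (-(Complex.I * ρ) * t) *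
        (s t * (y1 t * r - Complex.I * y t) + s t ^ 2 * r * y t))) volume 0 T := by
    refine (((is.mul_continuousOn ?_).add ((iss.mul_const r).mul_continuousOn
      hy.continuousOn)).continuousOn_mul ?_).neg
    · exact (by fun_prop : Continuous _).continuousOn
    · exact (by fun_prop : Continuous _).continuousOn
  have key := hac.integral_eq_sub_of_ae_hasDerivAt hi (by
    rw [← ae_restrict_Ioo_iff hT]
    filter_upwards [h.quasi_deriv, h.equation] with t a b
    refine ((hasDerivAt_cexp_mul (-(Complex.I * ρ)) t).fun_mul
      ((b.mul_const r).fun_add (a.const_mul Complex.I))).congr_deriv ?_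
    linear_combination (-Complex.I * Complex.exp (-(Complex.I * ρ) * t) * y1 t -
      ρ * Complex.exp (-(Complex.I * ρ) * t) * y t) * hr -
      ρ * Complex.exp (-(Complex.I * ρ) * t) * y t * Complex.I_sq) x (by rwa [uIcc_of_le hT])
  have hE : Complex.exp (2 * Complex.I * ρ * x) * Complex.exp (-(Complex.I * ρ) * x) =
      Complex.exp (Complex.I * ρ * x) := by rw [← Complex.exp_add]; congr 1; ring
  have hint : (∫ t in (0 : ℝ)..x, Complex.exp (2 * Complex.I * ρ * (x - t : ℝ)) *
        (s t * (Complex.exp (Complex.I * ρ * t) * (y1 t * r - Complex.I * y t)) +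
          s t ^ 2 * r * ((Complex.exp (Complex.I * ρ * t) * (y1 t * r + Complex.I * y t) -
            Complex.exp (Complex.I * ρ * t) * (y1 t * r - Complex.I * y t)) /
              (2 * Complex.I)))) = -(Complex.exp (2 * Complex.I * ρ * x) *
      ∫ t in (0 : ℝ)..x, -(Complex.exp (-(Complex.I * ρ) * t) *
        (s t * (y1 t * r - Complex.I * y t) + s t ^ 2 * r * y t))) := by
    rw [intervalIntegral.integral_neg, mul_neg, neg_neg, ← intervalIntegral.integral_const_mul]
    congr 1; ext t
    have hpq : (Complex.exp (Complex.I * ρ * t) * (y1 t * r + Complex.I * y t) -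
            Complex.exp (Complex.I * ρ * t) * (y1 t * r - Complex.I * y t)) /
              (2 * Complex.I) = Complex.exp (Complex.I * ρ * t) * y t := by
      field_simp; ring
    have hE2 : Complex.exp (2 * Complex.I * ρ * (x - t : ℝ)) * Complex.exp (Complex.I * ρ * t) =
        Complex.exp (2 * Complex.I * ρ * x) * Complex.exp (-(Complex.I * ρ) * t) := by
      rw [← Complex.exp_add, ← Complex.exp_add]; congr 1; push_cast; ring
    rw [hpq]
    linear_combination (s t * (y1 t * r - Complex.I * y t) + s t ^ 2 * r * y t) * hE2
  rw [hint, key]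
  simp only [Complex.ofReal_zero, mul_zero, Complex.exp_zero, one_mul]
  linear_combination -(y1 x * r + Complex.I * y x) * hE

lemma norm_cexp_I_mul_linePt (τ ξ x : ℝ) :
    ‖Complex.exp (Complex.I * linePt τ ξ * x)‖ = Real.exp (-(τ * x)) := by
  rw [Complex.norm_exp]
  congr 1
  simp [linePt]

/-- The solution has the initial values y(0) = α and y^{[1]}(0) = ρβ. With this scaling y^{[1]}/ρ
starts at β, so the initial data of both components do not depend on ρ. -/
theorem exists_isProfile (hT : 0 ≤ T) (hτ : 0 < τ) (hs : MemLp s 2 (volume.restrict (Ioo 0 T)))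
    (α β : ℂ) :
    ∃ p q : ℝ → ℝ → ℂ, IsProfile T τ s (β + Complex.I * α) (β - Complex.I * α) p q ∧
      ∀ ξ, (p T ξ - q T ξ) / (2 * Complex.I) = Complex.exp (Complex.I * linePt τ ξ * T) *
          (edgeCharFun T s .neumann .dirichlet (linePt τ ξ ^ 2) * α +
            linePt τ ξ * edgeCharFun T s .dirichlet .dirichlet (linePt τ ξ ^ 2) * β) ∧
        (p T ξ + q T ξ) / 2 = Complex.exp (Complex.I * linePt τ ξ * T) *
          ((linePt τ ξ)⁻¹ * edgeCharFun T s .neumann .neumann (linePt τ ξ ^ 2) * α +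
            edgeCharFun T s .dirichlet .neumann (linePt τ ξ ^ 2) * β) := by
  obtain ⟨Y, hYc, hYs, hY0, hYd⟩ := exists_isSLSolution hT hs 1 0
  obtain ⟨Z, hZc, hZs, hZ0, hZd⟩ := exists_isSLSolution hT hs 0 1
  have hcl := continuous_linePt τ
  set y : ℝ → ℝ → ℂ := fun x ξ => α * (Y (linePt τ ξ ^ 2) x).1 +
    linePt τ ξ * β * (Z (linePt τ ξ ^ 2) x).1 with hy
  set y1 : ℝ → ℝ → ℂ := fun x ξ => α * (Y (linePt τ ξ ^ 2) x).2 +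
    linePt τ ξ * β * (Z (linePt τ ξ ^ 2) x).2 with hy1
  have hsol : ∀ ξ, IsSLSolution T s (linePt τ ξ ^ 2) (fun x => y x ξ) (fun x => y1 x ξ) :=
    fun ξ => ((hYs _).const_mul α).add ((hZs _).const_mul (linePt τ ξ * β))
  have hyc : ∀ ξ, Continuous fun x => y x ξ := fun ξ => by
    have := continuous_fst.comp (hYc (linePt τ ξ ^ 2))
    have := continuous_fst.comp (hZc (linePt τ ξ ^ 2))
    simp only [hy]; fun_prop
  have hy1c : ∀ ξ, Continuous fun x => y1 x ξ := fun ξ => by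
    have := continuous_snd.comp (hYc (linePt τ ξ ^ 2))
    have := continuous_snd.comp (hZc (linePt τ ξ ^ 2))
    simp only [hy1]; fun_prop
  have hym : ∀ x, Continuous fun ξ => y x ξ := fun x => by
    have := continuous_fst.comp ((hYd x).continuous.comp (hcl.pow 2))
    have := continuous_fst.comp ((hZd x).continuous.comp (hcl.pow 2))
    simp only [hy]
    exact (continuous_const.mul ‹_›).add ((hcl.mul continuous_const).mul ‹_›)
  have hy1m : ∀ x, Continuous fun ξ => y1 x ξ := fun x => by
    have := continuous_snd.comp ((hYd x).continuous.comp (hcl.pow 2))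
    have := continuous_snd.comp ((hZd x).continuous.comp (hcl.pow 2))
    simp only [hy1]
    exact (continuous_const.mul ‹_›).add ((hcl.mul continuous_const).mul ‹_›)
  have h0 : ∀ ξ, y 0 ξ = α := fun ξ => by simp [hy, hY0, hZ0]
  have h1 : ∀ ξ, y1 0 ξ = linePt τ ξ * β := fun ξ => by simp [hy1, hY0, hZ0]
  have hne : ∀ ξ, linePt τ ξ ≠ 0 := linePt_ne_zero hτ
  have hinv : Continuous fun ξ => (linePt τ ξ)⁻¹ := hcl.inv₀ hne
  have hbdd : ∀ R : ℝ, ∃ M : ℝ, ∀ x ∈ Icc 0 T, ∀ ξ, |ξ| ≤ R →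
      ‖y1 x ξ * (linePt τ ξ)⁻¹‖ + ‖y x ξ‖ ≤ M := by
    intro R
    -- This dominates |ρ| for |ξ| ≤ R, as the growth estimate requires |λ| ≤ κ².
    set κ := 1 + |R| + τ with hκ
    have hκ1 : 1 ≤ κ := by linarith [abs_nonneg R]
    have hκ0 : 0 < κ := by linarith
    set N := 2 * max ‖α‖ ‖β‖ * Real.exp (2 * ∫ t in (0 : ℝ)..T, (κ + ‖s t‖ + ‖s t‖ ^ 2)) with hN
    refine ⟨N * κ * τ⁻¹ + N, fun x hx ξ hξ => ?_⟩
    have hρκ : ‖linePt τ ξ‖ ≤ κ := by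
      refine (norm_add_le _ _).trans ?_
      rw [norm_mul, Complex.norm_I, mul_one, Complex.norm_real, Complex.norm_real,
        Real.norm_eq_abs, Real.norm_of_nonneg hτ.le]
      linarith [le_abs_self R]
    have hb := (hsol ξ).norm_le hT hs hκ1 (by rw [norm_pow]; gcongr) hx
    have hmax : max ‖y 0 ξ‖ (‖y1 0 ξ‖ / κ) ≤ max ‖α‖ ‖β‖ := by
      rw [h0, h1]
      refine max_le_max le_rfl ?_
      rw [div_le_iff₀ hκ0, norm_mul, mul_comm]
      gcongr
    have hb' : max ‖y x ξ‖ (‖y1 x ξ‖ / κ) ≤ N := hb.trans (by rw [hN]; gcongr)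
    have b1 := (le_max_left _ _).trans hb'
    have b2 := (le_max_right _ _).trans hb'
    rw [div_le_iff₀ hκ0] at b2
    refine add_le_add ?_ b1
    rw [norm_mul, norm_inv]
    exact mul_le_mul b2 (inv_anti₀ hτ (le_norm_linePt τ ξ)) (by positivity)
      ((norm_nonneg _).trans b2)
  have hexp1 : ∀ x : ℝ, 0 ≤ x → ∀ ξ, ‖Complex.exp (Complex.I * linePt τ ξ * x)‖ ≤ 1 :=
    fun x hx ξ => by
      rw [norm_cexp_I_mul_linePt, Real.exp_le_one_iff]
      have := mul_nonneg hτ.le hx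
      linarith
  refine ⟨fun x ξ => Complex.exp (Complex.I * linePt τ ξ * x) *
      (y1 x ξ * (linePt τ ξ)⁻¹ + Complex.I * y x ξ),
    fun x ξ => Complex.exp (Complex.I * linePt τ ξ * x) *
      (y1 x ξ * (linePt τ ξ)⁻¹ - Complex.I * y x ξ), ⟨?_, ?_, ?_, ?_, ?_, ?_, ?_⟩, ?_⟩
  · refine measurable_uncurry_of_continuous_of_measurable (fun ξ => ?_) fun x => ?_
    · have := hyc ξ; have := hy1c ξ; fun_prop
    · have := hym x; have := hy1m x
      exact Continuous.measurable (by fun_prop)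
  · refine measurable_uncurry_of_continuous_of_measurable (fun ξ => ?_) fun x => ?_
    · have := hyc ξ; have := hy1c ξ; fun_prop
    · have := hym x; have := hy1m x
      exact Continuous.measurable (by fun_prop)
  · intro ξ; have := hyc ξ; have := hy1c ξ; fun_prop
  · intro ξ; have := hyc ξ; have := hy1c ξ; fun_prop
  · intro R
    obtain ⟨M, hM⟩ := hbdd R
    refine ⟨M, fun x hx ξ hξ => ⟨?_, ?_⟩⟩
    · rw [norm_mul]
      refine (mul_le_of_le_one_left (norm_nonneg _) (hexp1 x hx.1 ξ)).trans
        ((norm_add_le _ _).trans ?_)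
      rw [norm_mul Complex.I, Complex.norm_I, one_mul]
      exact hM x hx ξ hξ
    · rw [norm_mul]
      refine (mul_le_of_le_one_left (norm_nonneg _) (hexp1 x hx.1 ξ)).trans
        ((norm_sub_le _ _).trans ?_)
      rw [norm_mul Complex.I, Complex.norm_I, one_mul]
      exact hM x hx ξ hξ
  · intro ξ x hx
    have := (hsol ξ).profile_eq_q (hne ξ) hs (hyc ξ) (hy1c ξ) hx
    rw [h0, h1, mul_comm (linePt τ ξ) β, mul_assoc β, mul_inv_cancel₀ (hne ξ), mul_one] at this
    exact this
  · intro ξ x hx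
    have := (hsol ξ).profile_eq_p (hne ξ) hs (hyc ξ) (hy1c ξ) hx
    rw [h0, h1, mul_comm (linePt τ ξ) β, mul_assoc β, mul_inv_cancel₀ (hne ξ), mul_one] at this
    exact this
  · intro ξ
    have eY := slSolution_eq (hYs (linePt τ ξ ^ 2)) hT hs
    have eZ := slSolution_eq (hZs (linePt τ ξ ^ 2)) hT hs
    simp only [hY0, hZ0] at eY eZ
    have hr := mul_inv_cancel₀ (hne ξ)
    simp only [edgeCharFun, eY.1, eY.2, eZ.1, eZ.2, hy, hy1]
    constructor
    · field_simp; ring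
    · linear_combination Complex.exp (Complex.I * linePt τ ξ * T) * β *
        (Z (linePt τ ξ ^ 2) T).2 * hr

end Profile

/-! ### Edge functions on a horizontal line: boundedness, invariant cone, stability. -/

section EdgeEstimates

/-- The order of the derivative in a boundary condition. -/
def BoundaryCond.order : BoundaryCond → ℤ
  | .dirichlet => 0
  | .neumann => 1

/-- The characteristic function of an edge as a function of `ρ = √λ`, multiplied by the power of `ρ`
which makes it bounded on horizontal lines. -/
noncomputable def normEdgeChar (T : ℝ) (s : ℝ → ℂ) (b b' : BoundaryCond) (ρ : ℂ) : ℂ :=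
  ρ ^ (1 - b.order - b'.order) * edgeCharFun T s b b' (ρ ^ 2)

/-- The solutions whose logarithmic derivative `y^{[1]}/(ρy)` lies in the lower half-plane. -/
def InCone (y w : ℂ) : Prop := (w * (starRingEnd ℂ) y).im ≤ 0

/-- The squares of the two norms differ by 4 Im(w conj y). Up to the common factor e^{iρx} the norms
are |p| and |q|, so the cone consists of the data in which the component q dominates. -/
lemma inCone_iff {y w : ℂ} : InCone y w ↔ ‖w + Complex.I * y‖ ≤ ‖w - Complex.I * y‖ := by
  rw [InCone, ← abs_of_nonneg (norm_nonneg (w + Complex.I * y)),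
    ← abs_of_nonneg (norm_nonneg (w - Complex.I * y)), ← sq_le_sq, ← Complex.normSq_eq_norm_sq,
    ← Complex.normSq_eq_norm_sq, Complex.normSq_apply, Complex.normSq_apply]
  simp only [Complex.mul_im, Complex.conj_re, Complex.conj_im, Complex.add_re, Complex.mul_re,
    Complex.I_re, zero_mul, Complex.I_im, one_mul, zero_sub, Complex.add_im, zero_add,
    Complex.sub_re, Complex.sub_im]
  constructor <;> intro h <;> nlinarith

/-- Joining two branches multiplies the values and adds the logarithmic derivatives w/y, whose
imaginary parts are non-positive. The form without division needs no y ≠ 0. -/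
lemma InCone.mul {y w y' w' : ℂ} (h : InCone y w) (h' : InCone y' w') :
    InCone (y * y') (w * y' + y * w') := by
  have e : ((w * y' + y * w') * (starRingEnd ℂ) (y * y')).im =
      (w * (starRingEnd ℂ) y).im * Complex.normSq y' +
        (w' * (starRingEnd ℂ) y').im * Complex.normSq y := by
    simp only [map_mul, Complex.mul_im, Complex.mul_re, Complex.add_re, Complex.add_im,
      Complex.conj_re, Complex.conj_im, Complex.normSq_apply]
    ring
  rw [InCone, e]
  have := mul_nonneg (neg_nonneg.mpr h) (Complex.normSq_nonneg y')
  have := mul_nonneg (neg_nonneg.mpr h') (Complex.normSq_nonneg y)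
  nlinarith

lemma InCone.prod {ι : Type*} [DecidableEq ι] (A : Finset ι) {y w : ι → ℂ}
    (h : ∀ i ∈ A, InCone (y i) (w i)) :
    InCone (∏ i ∈ A, y i) (∑ i ∈ A, w i * ∏ j ∈ A.erase i, y j) := by
  induction A using Finset.induction_on with
  | empty => simp [InCone]
  | insert a A ha ih =>
    have h1 := (h a (Finset.mem_insert_self a A)).mul
      (ih fun i hi => h i (Finset.mem_insert_of_mem hi))
    rw [Finset.prod_insert ha, Finset.sum_insert ha, Finset.erase_insert ha]
    convert h1 using 2
    rw [Finset.mul_sum]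
    refine Finset.sum_congr rfl fun i hi => ?_
    have hia : i ≠ a := fun h => ha (h ▸ hi)
    rw [Finset.erase_insert_of_ne hia.symm, Finset.prod_insert (by simp [ha])]
    ring

variable {T Ω τ ε : ℝ} {s s' : ℝ → ℂ}

lemma exists_isProfile_normEdgeChar (hT : 0 ≤ T) (hτ : 0 < τ)
    (hs : MemLp s 2 (volume.restrict (Ioo 0 T))) (α β : ℂ) :
    ∃ p q : ℝ → ℝ → ℂ, IsProfile T τ s (β + Complex.I * α) (β - Complex.I * α) p q ∧
      ∀ ξ, (p T ξ - q T ξ) / (2 * Complex.I) = Complex.exp (Complex.I * linePt τ ξ * T) *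
          (normEdgeChar T s .neumann .dirichlet (linePt τ ξ) * α +
            normEdgeChar T s .dirichlet .dirichlet (linePt τ ξ) * β) ∧
        (p T ξ + q T ξ) / 2 = Complex.exp (Complex.I * linePt τ ξ * T) *
          (normEdgeChar T s .neumann .neumann (linePt τ ξ) * α +
            normEdgeChar T s .dirichlet .neumann (linePt τ ξ) * β) := by
  simpa [normEdgeChar, BoundaryCond.order] using exists_isProfile hT hτ hs α β

lemma norm_sub_div_le {a b : ℂ} {M : ℝ} (ha : ‖a‖ ≤ M) (hb : ‖b‖ ≤ M) :
    ‖(a - b) / (2 * Complex.I)‖ ≤ M ∧ ‖(a + b) / 2‖ ≤ M := by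
  have h2 : ‖(2 * Complex.I : ℂ)‖ = 2 := by simp
  have h3 : ‖(2 : ℂ)‖ = 2 := by simp
  rw [norm_div, norm_div, h2, h3]
  constructor
  · linarith [norm_sub_le a b]
  · linarith [norm_add_le a b]

lemma norm_le_exp_mul {ξ M : ℝ} {z : ℂ}
    (h : ‖Complex.exp (Complex.I * linePt τ ξ * T) * z‖ ≤ M) : ‖z‖ ≤ Real.exp (τ * T) * M := by
  rw [norm_mul, norm_cexp_I_mul_linePt] at h
  calc ‖z‖ = Real.exp (τ * T) * (Real.exp (-(τ * T)) * ‖z‖) := by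
        rw [← mul_assoc, ← Real.exp_add, add_neg_cancel, Real.exp_zero, one_mul]
    _ ≤ _ := by gcongr

theorem norm_normEdgeChar_le (hL : IsLargeHeight T Ω τ ε)
    (hs : MemLp s 2 (volume.restrict (Ioo 0 T)))
    (hsΩ : eLpNorm s 2 (volume.restrict (Ioo 0 T)) ≤ ENNReal.ofReal Ω) (b b' : BoundaryCond)
    (ξ : ℝ) : ‖normEdgeChar T s b b' (linePt τ ξ)‖ ≤ Real.exp (τ * T) * 4 := by
  have hTT : T ∈ Icc 0 T := ⟨hL.T_pos.le, le_rfl⟩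
  cases b
  · obtain ⟨p, q, h, e⟩ := exists_isProfile_normEdgeChar hL.T_pos.le hL.pos hs 0 1
    obtain ⟨h1, h2⟩ := h.norm_le_two_mul hL hs hsΩ ξ hTT
    have hn : 2 * (‖(1 : ℂ) + Complex.I * 0‖ + ‖(1 : ℂ) - Complex.I * 0‖) = 4 := by norm_num
    rw [hn] at h1 h2
    obtain ⟨h3, h4⟩ := norm_sub_div_le h1 h2
    cases b'
    · exact norm_le_exp_mul (by simpa [(e ξ).1] using h3)
    · exact norm_le_exp_mul (by simpa [(e ξ).2] using h4)
  · obtain ⟨p, q, h, e⟩ := exists_isProfile_normEdgeChar hL.T_pos.le hL.pos hs 1 0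
    obtain ⟨h1, h2⟩ := h.norm_le_two_mul hL hs hsΩ ξ hTT
    have hn : 2 * (‖(0 : ℂ) + Complex.I * 1‖ + ‖(0 : ℂ) - Complex.I * 1‖) = 4 := by norm_num
    rw [hn] at h1 h2
    obtain ⟨h3, h4⟩ := norm_sub_div_le h1 h2
    cases b'
    · exact norm_le_exp_mul (by simpa [(e ξ).1] using h3)
    · exact norm_le_exp_mul (by simpa [(e ξ).2] using h4)

/-- In the cone the initial data satisfy |c| ≤ |d|. At the end of the edge the free part of p has
shrunk to at most |d|/16 and the errors of p and q are at most |d|/8, so |p| ≤ 3|d|/16 and |q| ≥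
7|d|/8. Hence the cone is preserved, and 2|y| ≥ |q| − |p| ≥ 11|d|/16 for the new value y. -/
theorem inCone_normEdgeChar (hL : IsLargeHeight T Ω τ ε)
    (hs : MemLp s 2 (volume.restrict (Ioo 0 T)))
    (hsΩ : eLpNorm s 2 (volume.restrict (Ioo 0 T)) ≤ ENNReal.ofReal Ω) (ξ : ℝ) {y w : ℂ}
    (h : InCone y w) :
    InCone (normEdgeChar T s .neumann .dirichlet (linePt τ ξ) * y +
        normEdgeChar T s .dirichlet .dirichlet (linePt τ ξ) * w)
      (normEdgeChar T s .neumann .neumann (linePt τ ξ) * y +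
        normEdgeChar T s .dirichlet .neumann (linePt τ ξ) * w) ∧
    ‖w - Complex.I * y‖ / 4 ≤ ‖normEdgeChar T s .neumann .dirichlet (linePt τ ξ) * y +
        normEdgeChar T s .dirichlet .dirichlet (linePt τ ξ) * w‖ := by
  rw [inCone_iff] at h
  obtain ⟨p, q, hp, e⟩ := exists_isProfile_normEdgeChar hL.T_pos.le hL.pos hs y w
  obtain ⟨h1, h2⟩ := hp.norm_sub_le hL hs hsΩ ξ (x := T) ⟨hL.T_pos.le, le_rfl⟩
  obtain ⟨e1, e2⟩ := e ξ
  set y' := normEdgeChar T s .neumann .dirichlet (linePt τ ξ) * y +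
    normEdgeChar T s .dirichlet .dirichlet (linePt τ ξ) * w
  set w' := normEdgeChar T s .neumann .neumann (linePt τ ξ) * y +
    normEdgeChar T s .dirichlet .neumann (linePt τ ξ) * w
  set c := w + Complex.I * y
  set d := w - Complex.I * y
  set E := Complex.exp (Complex.I * linePt τ ξ * T) with hE
  have hEn : ‖E‖ = Real.exp (-(τ * T)) := norm_cexp_I_mul_linePt τ ξ T
  have hE0 : 0 < ‖E‖ := by rw [hEn]; exact Real.exp_pos _
  have hE1 : ‖E‖ ≤ 1 := by
    rw [hEn, Real.exp_le_one_iff]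
    have := mul_pos hL.pos hL.T_pos
    linarith
  have hec : ‖Complex.exp (2 * Complex.I * linePt τ ξ * T) * c‖ ≤ ‖d‖ / 16 := by
    rw [norm_mul, norm_cexp_linePt]
    calc _ ≤ 1 / 16 * ‖d‖ := mul_le_mul hL.exp_le h (norm_nonneg _) (by norm_num)
      _ = _ := by ring
  have hpn : ‖p T ξ‖ ≤ 3 / 16 * ‖d‖ := by
    have := norm_le_insert' (p T ξ) (Complex.exp (2 * Complex.I * linePt τ ξ * T) * c)
    linarith
  have hqn : 7 / 8 * ‖d‖ ≤ ‖q T ξ‖ := by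
    have := norm_le_insert' d (q T ξ)
    have := norm_sub_rev (q T ξ) d
    linarith
  have hpe : p T ξ = E * (w' + Complex.I * y') := by
    have : p T ξ = (p T ξ + q T ξ) / 2 + Complex.I * ((p T ξ - q T ξ) / (2 * Complex.I)) := by
      field_simp; ring
    rw [this, e1, e2]; ring
  have hqe : q T ξ = E * (w' - Complex.I * y') := by
    have : q T ξ = (p T ξ + q T ξ) / 2 - Complex.I * ((p T ξ - q T ξ) / (2 * Complex.I)) := by
      field_simp; ring
    rw [this, e1, e2]; ring
  have hd := norm_nonneg d
  refine ⟨inCone_iff.mpr (le_of_mul_le_mul_left ?_ hE0), ?_⟩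
  · rw [← norm_mul, ← norm_mul, ← hpe, ← hqe]; linarith
  · have h3 : ‖q T ξ‖ - ‖p T ξ‖ ≤ 2 * (‖E‖ * ‖y'‖) := by
      have h4 := norm_sub_norm_le (q T ξ) (p T ξ)
      have h5 : q T ξ - p T ξ = -(2 * Complex.I) * (E * y') := by rw [hpe, hqe]; ring
      rw [h5, norm_mul, norm_neg, norm_mul E] at h4
      simpa using h4
    have h6 : ‖E‖ * ‖y'‖ ≤ ‖y'‖ := mul_le_of_le_one_left (norm_nonneg _) hE1
    linarith

lemma eLpNorm_sub_div_le {f g : ℝ → ℂ} {K : ℝ≥0∞} {ζ : ℝ → ℂ} {c c' : ℂ} (hc : ‖c‖ₑ ≤ 1 / 2)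
    (hc' : ‖c'‖ₑ ≤ 1 / 2)
    (hfm : AEStronglyMeasurable f volume) (hgm : AEStronglyMeasurable g volume)
    (hf : eLpNorm f 2 volume ≤ K) (hg : eLpNorm g 2 volume ≤ K)
    (h : ∀ ξ, Complex.exp (Complex.I * linePt τ ξ * T) * ζ ξ = c * f ξ + c' * g ξ) :
    eLpNorm ζ 2 volume ≤ ENNReal.ofReal (Real.exp (τ * T)) * K := by
  have e1 : ∀ ξ, ‖ζ ξ‖ ≤ Real.exp (τ * T) * ‖(c • f + c' • g) ξ‖ := fun ξ =>
    norm_le_exp_mul (by rw [h ξ]; rfl)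
  have e2 := eLpNorm_le_mul_eLpNorm_of_ae_le_mul (ae_of_all volume e1) 2
  refine e2.trans ?_
  gcongr
  calc _ ≤ eLpNorm (c • f) 2 volume + eLpNorm (c' • g) 2 volume :=
        eLpNorm_add_le (hfm.const_smul c) (hgm.const_smul c') (by norm_num)
    _ ≤ 1 / 2 * K + 1 / 2 * K := by
        refine add_le_add (eLpNorm_const_smul_le.trans ?_) (eLpNorm_const_smul_le.trans ?_) <;>
        gcongr
    _ = K := by rw [← add_mul, ENNReal.add_halves, one_mul]

theorem eLpNorm_normEdgeChar_sub_le (hL : IsLargeHeight T Ω τ ε)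
    (hs : MemLp s 2 (volume.restrict (Ioo 0 T)))
    (hs' : MemLp s' 2 (volume.restrict (Ioo 0 T)))
    (hsΩ : eLpNorm s 2 (volume.restrict (Ioo 0 T)) ≤ ENNReal.ofReal Ω)
    (hsΩ' : eLpNorm s' 2 (volume.restrict (Ioo 0 T)) ≤ ENNReal.ofReal Ω) (b b' : BoundaryCond) :
    eLpNorm (fun ξ => normEdgeChar T s b b' (linePt τ ξ) - normEdgeChar T s' b b' (linePt τ ξ))
      2 volume ≤ ENNReal.ofReal (Real.exp (τ * T) * (4 * (2 + Ω * √T) * (2 + 8 * Ω) *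
        (1 + √T * (2 * (2 + Ω * √T) * Ω)))) *
          eLpNorm (fun t => s t - s' t) 2 (volume.restrict (Ioo 0 T)) := by
  have hTT : T ∈ Icc 0 T := ⟨hL.T_pos.le, le_rfl⟩
  have hΩ := hL.Ω_nonneg
  set κ := eLpNorm (fun t => s t - s' t) 2 (volume.restrict (Ioo 0 T)) with hκ
  have hκt : κ ≠ ∞ := (hs.sub hs').2.ne
  set A := 2 * (2 + Ω * √T) * (2 + 8 * Ω) * (1 + √T * (2 * (2 + Ω * √T) * Ω)) with hA
  have hA0 : 0 ≤ A := by positivity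
  have fin : ENNReal.ofReal (Real.exp (τ * T)) * ENNReal.ofReal (A * 2 * κ.toReal) =
      ENNReal.ofReal (Real.exp (τ * T) * (4 * (2 + Ω * √T) * (2 + 8 * Ω) *
        (1 + √T * (2 * (2 + Ω * √T) * Ω)))) * κ := by
    nth_rewrite 2 [← ENNReal.ofReal_toReal hκt]
    rw [← ENNReal.ofReal_mul (by positivity), ← ENNReal.ofReal_mul (by positivity)]
    congr 1; rw [hA]; ring
  have hpair : Measurable fun ξ : ℝ => (T, ξ) := measurable_const.prodMk measurable_id
  -- The pairs (0, 1) and (1, 0) isolate the Dirichlet and the Neumann solution; both have data of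
  -- total size 2.
  have main : ∀ α β : ℂ, ‖β + Complex.I * α‖ + ‖β - Complex.I * α‖ = 2 →
      eLpNorm (fun ξ => normEdgeChar T s .neumann .dirichlet (linePt τ ξ) * α +
          normEdgeChar T s .dirichlet .dirichlet (linePt τ ξ) * β -
          (normEdgeChar T s' .neumann .dirichlet (linePt τ ξ) * α +
          normEdgeChar T s' .dirichlet .dirichlet (linePt τ ξ) * β)) 2 volume ≤
        ENNReal.ofReal (Real.exp (τ * T)) * ENNReal.ofReal (A * 2 * κ.toReal) ∧
      eLpNorm (fun ξ => normEdgeChar T s .neumann .neumann (linePt τ ξ) * α +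
          normEdgeChar T s .dirichlet .neumann (linePt τ ξ) * β -
          (normEdgeChar T s' .neumann .neumann (linePt τ ξ) * α +
          normEdgeChar T s' .dirichlet .neumann (linePt τ ξ) * β)) 2 volume ≤
        ENNReal.ofReal (Real.exp (τ * T)) * ENNReal.ofReal (A * 2 * κ.toReal) := by
    intro α β hαβ
    obtain ⟨p, q, h, e⟩ := exists_isProfile_normEdgeChar hL.T_pos.le hL.pos hs α β
    obtain ⟨p', q', h', e'⟩ := exists_isProfile_normEdgeChar hL.T_pos.le hL.pos hs' α β
    obtain ⟨n1, n2⟩ := h.eLpNorm_sub_le hL ENNReal.toReal_nonneg hs hs' hsΩ hsΩ'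
      (ENNReal.ofReal_toReal hκt).ge h' hTT
    rw [hαβ] at n1 n2
    have m1 := ((h.measurable_p.comp hpair).sub
      (h'.measurable_p.comp hpair)).aestronglyMeasurable (μ := volume)
    have m2 := ((h.measurable_q.comp hpair).sub
      (h'.measurable_q.comp hpair)).aestronglyMeasurable (μ := volume)
    have hhalf : ∀ c : ℂ, ‖c‖ = 1 / 2 → ‖c‖ₑ ≤ 1 / 2 := fun c hc => by
      rw [← ofReal_norm, hc, one_div, one_div,
        ENNReal.ofReal_inv_of_pos (by norm_num), ENNReal.ofReal_ofNat]
    refine ⟨eLpNorm_sub_div_le (T := T) (τ := τ) (c := 1 / (2 * Complex.I))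
        (c' := -(1 / (2 * Complex.I))) (hhalf _ (by simp)) (hhalf _ (by simp))
        m1 m2 n1 n2 fun ξ => ?_,
      eLpNorm_sub_div_le (T := T) (τ := τ) (c := 1 / 2) (c' := 1 / 2) (hhalf _ (by simp))
        (hhalf _ (by simp)) m1 m2 n1 n2 fun ξ => ?_⟩
    · rw [mul_sub, ← (e ξ).1, ← (e' ξ).1]
      simp only [Function.comp_apply, Function.uncurry_apply_pair, Pi.sub_apply]
      ring
    · rw [mul_sub, ← (e ξ).2, ← (e' ξ).2]
      simp only [Function.comp_apply, Function.uncurry_apply_pair, Pi.sub_apply]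
      ring
  rw [← fin]
  have g1 := main 0 1 (by norm_num)
  have g2 := main 1 0 (by norm_num)
  simp only [mul_zero, mul_one, zero_add, add_zero] at g1 g2
  cases b <;> cases b'
  · exact g1.1
  · exact g1.2
  · exact g2.1
  · exact g2.2

end EdgeEstimates

/-! ### Combinatorics of splitting a tree into branches. -/

namespace MetricTree

variable {m : ℕ} (G : MetricTree m) {F : Finset (Fin m)} {u v : Fin (m + 1)} {e f : Fin m}

lemma mem_edgesAt : e ∈ G.edgesAt F v ↔ e ∈ F ∧ (e.castSucc = v ∨ G.parent e = v) := by
  simp [edgesAt]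

/-- Adjacency of edges of `F` through a vertex other than `u`. -/
def AdjAvoiding (F : Finset (Fin m)) (u : Fin (m + 1)) (a b : Fin m) : Prop :=
  b ∈ F ∧ ∃ v, v ≠ u ∧ a ∈ G.edgesAt F v ∧ b ∈ G.edgesAt F v

/-- Adjacency of edges of `F`. -/
def Adj (F : Finset (Fin m)) (a b : Fin m) : Prop :=
  ∃ v, a ∈ G.edgesAt F v ∧ b ∈ G.edgesAt F v

/-- The subgraph with edge set `F` is connected. -/
def Connected (F : Finset (Fin m)) : Prop :=
  F.Nonempty ∧ ∀ a ∈ F, ∀ b ∈ F, Relation.ReflTransGen (G.Adj F) a b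

variable {G}

lemma mem_branch : f ∈ G.branch F u e ↔ f ∈ F ∧ Relation.ReflTransGen (G.AdjAvoiding F u) e f := by
  classical
  simp only [branch, Finset.mem_filter]
  rfl

lemma branch_subset : G.branch F u e ⊆ F := fun _ h => (mem_branch.mp h).1

lemma mem_branch_self (he : e ∈ F) : e ∈ G.branch F u e := mem_branch.mpr ⟨he, .refl⟩

lemma AdjAvoiding.symm {a b : Fin m} (h : G.AdjAvoiding F u a b) : G.AdjAvoiding F u b a := by
  obtain ⟨-, v, hv, ha, hb⟩ := h
  exact ⟨(G.mem_edgesAt.mp ha).1, v, hv, hb, ha⟩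

lemma mem_branch_symm (he : e ∈ F) (h : f ∈ G.branch F u e) : e ∈ G.branch F u f := by
  rw [mem_branch] at h ⊢
  refine ⟨he, ?_⟩
  have := h.2
  clear h
  induction this with
  | refl => exact .refl
  | tail _ h ih => exact .head h.symm ih

lemma mem_branch_trans {g : Fin m} (h : f ∈ G.branch F u e) (h' : g ∈ G.branch F u f) :
    g ∈ G.branch F u e := by
  rw [mem_branch] at *
  exact ⟨h'.1, h.2.trans h'.2⟩

lemma mem_branch_of_edgesAt (hv : v ≠ u) (he : e ∈ G.edgesAt F v) (hf : f ∈ G.edgesAt F v) :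
    f ∈ G.branch F u e :=
  mem_branch.mpr ⟨(G.mem_edgesAt.mp hf).1, .single ⟨(G.mem_edgesAt.mp hf).1, v, hv, he, hf⟩⟩

/-- `v` can be reached from `v'` by passing to parents. -/
def Above (G : MetricTree m) (v' v : Fin (m + 1)) : Prop :=
  Relation.ReflTransGen (fun a b : Fin (m + 1) => ∃ i : Fin m, a = i.castSucc ∧ b = G.parent i) v' v

lemma Above.le {v' : Fin (m + 1)} (h : G.Above v' v) : v' ≤ v := by
  induction h with
  | refl => exact le_rfl
  | tail _ h ih =>
    obtain ⟨i, rfl, rfl⟩ := h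
    exact ih.trans (G.lt_parent i).le

lemma Above.parent_of_ne (h : G.Above e.castSucc v) (hv : e.castSucc ≠ v) :
    G.Above (G.parent e) v := by
  rcases h.cases_head with h | ⟨c, ⟨i, hi, rfl⟩, h⟩
  · exact absurd h hv
  · rw [Fin.castSucc_inj] at hi
    exact hi ▸ h

lemma above_of_parent (h : G.Above (G.parent e) v) : G.Above e.castSucc v :=
  Relation.ReflTransGen.head ⟨e, rfl, rfl⟩ h

lemma above_of_edgesAt (h : G.Above v u) (he : e ∈ G.edgesAt F v) : G.Above e.castSucc u := by
  rcases (G.mem_edgesAt.mp he).2 with h' | h'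
  · rwa [h']
  · exact above_of_parent (h' ▸ h)

/-- If the cut is the upper end of e, a path from e that avoids it never leaves the edges below e:
the only way out leads through the cut. -/
lemma above_of_mem_branch (he : G.parent e = u) (hf : f ∈ G.branch F u e) :
    G.Above f.castSucc e.castSucc := by
  have := (mem_branch.mp hf).2
  clear hf
  induction this with
  | refl => exact .refl
  | @tail a b _ h ih =>
    obtain ⟨-, v, hv, ha, hb⟩ := h
    refine above_of_edgesAt (?_ : G.Above v _) hb
    rcases (G.mem_edgesAt.mp ha).2 with h' | h'
    · exact h' ▸ ih
    · have hne : a.castSucc ≠ e.castSucc := fun h => by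
        rw [Fin.castSucc_inj] at h
        exact hv (by rw [← h', h, he])
      exact h' ▸ ih.parent_of_ne hne

lemma eq_of_above_of_edgesAt (he : G.parent e = u) (hf : f ∈ G.edgesAt F u)
    (h : G.Above f.castSucc e.castSucc) : f = e := by
  by_contra hne
  have hlt : e.castSucc < u := he ▸ G.lt_parent e
  rcases (G.mem_edgesAt.mp hf).2 with h' | h'
  · exact absurd (h' ▸ h.le) (not_le.mpr hlt)
  · have := (h.parent_of_ne fun h => hne (Fin.castSucc_inj.mp h)).le
    exact absurd (h' ▸ this) (not_le.mpr hlt)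

/-- Different edges at `u` belong to different parts. -/
lemma eq_of_mem_branch (he : e ∈ G.edgesAt F u) (hf : f ∈ G.edgesAt F u)
    (h : f ∈ G.branch F u e) : f = e := by
  -- At most one edge leaves u upwards, so two different edges at u include one that comes from
  -- below, and `above_of_mem_branch` applies to it.
  rcases (G.mem_edgesAt.mp he).2 with he' | he'
  · rcases (G.mem_edgesAt.mp hf).2 with hf' | hf'
    · exact Fin.castSucc_inj.mp (hf'.trans he'.symm)
    · exact (eq_of_above_of_edgesAt hf' he (above_of_mem_branch hf'
        (mem_branch_symm (G.mem_edgesAt.mp he).1 h))).symm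
  · exact eq_of_above_of_edgesAt he' hf (above_of_mem_branch he' h)

lemma disjoint_branch (he : e ∈ G.edgesAt F u) (hf : f ∈ G.edgesAt F u) (hne : e ≠ f) :
    Disjoint (G.branch F u e) (G.branch F u f) := by
  rw [Finset.disjoint_left]
  intro g hg hg'
  exact hne (eq_of_mem_branch he hf (mem_branch_trans hg
    (mem_branch_symm (G.mem_edgesAt.mp hf).1 hg'))).symm

lemma edgesAt_branch_self (he : e ∈ G.edgesAt F u) : G.edgesAt (G.branch F u e) u = {e} := by
  ext f
  rw [Finset.mem_singleton]
  constructor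
  · intro hf
    rw [mem_edgesAt] at hf
    exact eq_of_mem_branch he (G.mem_edgesAt.mpr ⟨branch_subset hf.1, hf.2⟩) hf.1
  · rintro rfl
    exact G.mem_edgesAt.mpr ⟨mem_branch_self (G.mem_edgesAt.mp he).1, (G.mem_edgesAt.mp he).2⟩

lemma edgesAt_branch_of_ne (hv : v ≠ u) (hf : f ∈ G.edgesAt (G.branch F u e) v) :
    G.edgesAt (G.branch F u e) v = G.edgesAt F v := by
  ext g
  constructor
  · intro hg
    exact G.mem_edgesAt.mpr ⟨branch_subset (G.mem_edgesAt.mp hg).1, (G.mem_edgesAt.mp hg).2⟩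
  · intro hg
    rw [mem_edgesAt] at hf
    exact G.mem_edgesAt.mpr ⟨mem_branch_trans hf.1 (mem_branch_of_edgesAt hv
      (G.mem_edgesAt.mpr ⟨branch_subset hf.1, hf.2⟩) hg), (G.mem_edgesAt.mp hg).2⟩

lemma connected_branch (he : e ∈ F) : G.Connected (G.branch F u e) := by
  refine ⟨⟨e, mem_branch_self he⟩, ?_⟩
  have key : ∀ a ∈ G.branch F u e, ∀ b ∈ G.branch F u a,
      Relation.ReflTransGen (G.Adj (G.branch F u e)) a b := by
    intro a ha b hb
    have := (mem_branch.mp hb).2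
    clear hb
    induction this with
    | refl => exact .refl
    | @tail b c h h' ih =>
      refine ih.tail ?_
      have hbF : b ∈ F := by
        obtain ⟨-, v, -, hb, -⟩ := h'
        exact (G.mem_edgesAt.mp hb).1
      have hb : b ∈ G.branch F u e := mem_branch_trans ha (mem_branch.mpr ⟨hbF, h⟩)
      have hc : c ∈ G.branch F u e := mem_branch_trans hb (mem_branch.mpr ⟨h'.1, .single h'⟩)
      obtain ⟨-, v, -, hb', hc'⟩ := h'
      exact ⟨v, G.mem_edgesAt.mpr ⟨hb, (G.mem_edgesAt.mp hb').2⟩,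
        G.mem_edgesAt.mpr ⟨hc, (G.mem_edgesAt.mp hc').2⟩⟩
  intro a ha b hb
  exact key a ha b (mem_branch_trans (mem_branch_symm he ha) hb)

/-- Along a path from f to an edge at u, the part before the first passage through u stays in one
branch. -/
lemma Connected.exists_mem_branch (hF : G.Connected F) (hu : (G.edgesAt F u).Nonempty)
    (hf : f ∈ F) : ∃ e ∈ G.edgesAt F u, f ∈ G.branch F u e := by
  obtain ⟨a, ha⟩ := hu
  have := hF.2 f hf a (G.mem_edgesAt.mp ha).1
  clear hf
  induction this using Relation.ReflTransGen.head_induction_on with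
  | refl => exact ⟨a, ha, mem_branch_self (G.mem_edgesAt.mp ha).1⟩
  | @head b c h _ ih =>
    obtain ⟨v, hb, hc⟩ := h
    by_cases hv : v = u
    · subst hv
      exact ⟨b, hb, mem_branch_self (G.mem_edgesAt.mp hb).1⟩
    · obtain ⟨e, he, hce⟩ := ih
      exact ⟨e, he, mem_branch_trans hce (mem_branch_of_edgesAt hv hc hb)⟩

lemma Connected.biUnion_branch (hF : G.Connected F) (hu : (G.edgesAt F u).Nonempty) :
    (G.edgesAt F u).biUnion (G.branch F u) = F := by
  ext f
  rw [Finset.mem_biUnion]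
  exact ⟨fun ⟨e, _, h⟩ => branch_subset h, hF.exists_mem_branch hu⟩

lemma card_branch_lt (hu : 2 ≤ G.degree F u) (he : e ∈ G.edgesAt F u) :
    (G.branch F u e).card < F.card := by
  obtain ⟨a, ha, hne⟩ := Finset.exists_mem_ne (s := G.edgesAt F u) hu e
  refine Finset.card_lt_card ⟨branch_subset, fun h => hne ?_⟩
  exact eq_of_mem_branch he ha (h (G.mem_edgesAt.mp ha).1)

lemma edgesAt_singleton_subset (e : Fin m) (v : Fin (m + 1)) : G.edgesAt {e} v ⊆ {e} :=
  Finset.filter_subset _ _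

lemma degree_singleton_le (e : Fin m) (v : Fin (m + 1)) : G.degree {e} v ≤ 1 :=
  (Finset.card_le_card (edgesAt_singleton_subset e v)).trans (by simp)

lemma Connected.eq_singleton (hF : G.Connected F) (h : ∀ v, ¬ 2 ≤ G.degree F v) :
    ∃ e, F = {e} := by
  obtain ⟨e, he⟩ := hF.1
  refine ⟨e, Finset.eq_singleton_iff_unique_mem.mpr ⟨he, fun f hf => ?_⟩⟩
  have := hF.2 e he f hf
  clear hf
  induction this with
  | refl => rfl
  | tail _ h' ih =>
    obtain ⟨v, hb, hc⟩ := h'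
    have := h v
    rw [← ih]
    exact Finset.card_le_one.mp (by unfold degree at this; omega) _ hc _ hb

/-- Induction on connected subgraphs: single edges, and splitting by an internal vertex. -/
theorem Connected.induction {P : Finset (Fin m) → Prop} (single : ∀ e, P {e})
    (split : ∀ F u, G.Connected F → 2 ≤ G.degree F u →
      (∀ e ∈ G.edgesAt F u, P (G.branch F u e)) → P F) : ∀ F, G.Connected F → P F := by
  intro F
  induction F using Finset.strongInductionOn with
  | _ F ih =>
    intro hF
    by_cases h : ∃ u, 2 ≤ G.degree F u
    · obtain ⟨u, hu⟩ := h
      refine split F u hF hu fun e he => ih _ ⟨branch_subset, fun h => ?_⟩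
        (connected_branch (G.mem_edgesAt.mp he).1)
      exact absurd (Finset.card_le_card h) (not_le.mpr (card_branch_lt hu he))
    · obtain ⟨e, rfl⟩ := hF.eq_singleton fun v hv => h ⟨v, hv⟩
      exact single e

/-! ### Boundary vertices -/

lemma mem_boundary : v ∈ G.boundary F ↔ (G.edgesAt F v).card = 1 := by
  rw [boundary, Finset.mem_filter]
  simp [degree]

lemma degree_branch_self (he : e ∈ G.edgesAt F u) : G.degree (G.branch F u e) u = 1 := by
  rw [degree, edgesAt_branch_self he, Finset.card_singleton]

lemma Connected.exists_edgesAt_branch (hF : G.Connected F) (hu : (G.edgesAt F u).Nonempty)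
    (hv : v ≠ u) (hne : (G.edgesAt F v).Nonempty) :
    ∃ e ∈ G.edgesAt F u, G.edgesAt (G.branch F u e) v = G.edgesAt F v := by
  obtain ⟨f, hf⟩ := hne
  obtain ⟨e, he, h⟩ := hF.exists_mem_branch hu (G.mem_edgesAt.mp hf).1
  exact ⟨e, he, edgesAt_branch_of_ne hv (G.mem_edgesAt.mpr ⟨h, (G.mem_edgesAt.mp hf).2⟩)⟩

lemma eq_of_edgesAt_branch (he : e ∈ G.edgesAt F u) (hf : f ∈ G.edgesAt F u) (hv : v ≠ u)
    (h : (G.edgesAt (G.branch F u e) v).Nonempty) (h' : (G.edgesAt (G.branch F u f) v).Nonempty) :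
    e = f := by
  by_contra hne
  obtain ⟨a, ha⟩ := h
  obtain ⟨b, hb⟩ := h'
  have hab : a ∈ G.edgesAt (G.branch F u f) v := by
    rw [edgesAt_branch_of_ne hv hb, ← edgesAt_branch_of_ne hv ha]; exact ha
  exact Finset.disjoint_left.mp (disjoint_branch he hf hne) (G.mem_edgesAt.mp ha).1
    (G.mem_edgesAt.mp hab).1

/-- Splitting by u only turns u into a boundary vertex of every branch; any other vertex keeps its
degree in the one branch containing it. The weight `g` is general because it will encode the
boundary conditions. -/
lemma Connected.sum_boundary (hF : G.Connected F) (hu : 2 ≤ G.degree F u)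
    (g : Fin (m + 1) → ℤ) : ∑ v ∈ G.boundary F, g v =
      ∑ e ∈ G.edgesAt F u, ∑ v ∈ (G.boundary (G.branch F u e)).erase u, g v := by
  have hne : (G.edgesAt F u).Nonempty := Finset.card_pos.mp (by unfold degree at hu; omega)
  rw [← Finset.sum_biUnion]
  · refine Finset.sum_congr ?_ fun _ _ => rfl
    ext v
    simp only [Finset.mem_biUnion, Finset.mem_erase, mem_boundary]
    constructor
    · intro hv
      have hvu : v ≠ u := by rintro rfl; unfold degree at hu; omega
      obtain ⟨e, he, h⟩ := hF.exists_edgesAt_branch hne hvu (Finset.card_pos.mp (by omega))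
      exact ⟨e, he, hvu, by rw [h, hv]⟩
    · rintro ⟨e, he, hvu, h⟩
      obtain ⟨f, hf⟩ : (G.edgesAt (G.branch F u e) v).Nonempty := Finset.card_pos.mp (by omega)
      rw [← edgesAt_branch_of_ne hvu hf, h]
  · intro e he f hf hef
    refine Finset.disjoint_left.mpr fun v hv hv' => hef ?_
    rw [Finset.mem_erase, mem_boundary] at hv hv'
    exact eq_of_edgesAt_branch he hf hv.1 (Finset.card_pos.mp (by omega))
      (Finset.card_pos.mp (by omega))

lemma mem_boundary_branch (he : e ∈ G.edgesAt F u) : u ∈ G.boundary (G.branch F u e) := by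
  rw [mem_boundary]; exact degree_branch_self he

/-! ### The whole tree and the subtrees at an internal vertex -/

lemma connected_univ (k : Fin m) : G.Connected Finset.univ := by
  refine ⟨⟨k, Finset.mem_univ k⟩, ?_⟩
  have hsymm : ∀ a b, Relation.ReflTransGen (G.Adj Finset.univ) a b →
      Relation.ReflTransGen (G.Adj Finset.univ) b a := by
    intro a b h
    induction h with
    | refl => exact .refl
    | tail _ h ih =>
      obtain ⟨v, h1, h2⟩ := h
      exact .head ⟨v, h2, h1⟩ ih
  -- Every edge is joined upwards to the edge at the root, which is unique by `root_edge`.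
  have hroot : ∀ n : ℕ, ∀ a r : Fin m, (a : ℕ) + n = m → (r : ℕ) + 1 = m →
      Relation.ReflTransGen (G.Adj Finset.univ) a r := by
    intro n
    induction n using Nat.strong_induction_on with
    | _ n ih =>
      intro a r ha hr
      by_cases h : G.parent a = Fin.last m
      · have := G.root_edge a h
        have : a = r := Fin.ext (by omega)
        exact this ▸ .refl
      · obtain ⟨b, hb⟩ := Fin.exists_castSucc_eq.mpr h
        have hlt := G.lt_parent a
        rw [← hb, Fin.castSucc_lt_castSucc_iff, Fin.lt_def] at hlt
        refine .head ⟨b.castSucc, ?_, ?_⟩ (ih (m - b) (by omega) b r (by omega) hr)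
        · exact G.mem_edgesAt.mpr ⟨Finset.mem_univ _, .inr hb.symm⟩
        · exact G.mem_edgesAt.mpr ⟨Finset.mem_univ _, .inl rfl⟩
  intro a _ b _
  have hm : 0 < m := k.pos
  let r : Fin m := ⟨m - 1, by omega⟩
  have hr : (r : ℕ) + 1 = m := by simp [r]; omega
  exact (hroot (m - a) a r (by omega) hr).trans (hsymm _ _ (hroot (m - b) b r (by omega) hr))

lemma mem_below : f ∈ G.below v ↔ f.castSucc ≠ v ∧ G.Above f.castSucc v := by
  classical
  simp only [below, Finset.mem_filter, Finset.mem_univ, true_and]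
  constructor
  · intro h
    refine ⟨?_, h.to_reflTransGen⟩
    obtain ⟨c, ⟨i, hi, rfl⟩, h'⟩ := Relation.TransGen.head'_iff.mp h
    have h1 : G.parent i ≤ v := Above.le h'
    have h2 := G.lt_parent i
    rw [hi]
    exact (h2.trans_le h1).ne
  · rintro ⟨hne, h⟩
    exact Relation.TransGen.head' ⟨f, rfl, rfl⟩ (h.parent_of_ne hne)

/-- Every edge at v_p other than e_p comes from below, so its branch lies in g_p; what is left is
the branch of e_p. -/
lemma branch_univ_eq_above (p : Fin m) :
    G.branch Finset.univ p.castSucc p = G.above p.castSucc := by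
  have hp : p ∈ G.edgesAt Finset.univ p.castSucc :=
    G.mem_edgesAt.mpr ⟨Finset.mem_univ _, .inl rfl⟩
  ext f
  rw [above, Finset.mem_compl, mem_below]
  constructor
  · intro hf
    have := (mem_branch.mp hf).2
    clear hf
    induction this with
    | refl => simp
    | @tail a b _ h ih =>
      obtain ⟨-, v, hv, ha, hb⟩ := h
      rintro ⟨h1, h2⟩
      have hva : G.Above v p.castSucc := by
        rcases (G.mem_edgesAt.mp hb).2 with h' | h'
        · exact h' ▸ h2
        · exact h' ▸ h2.parent_of_ne h1
      refine ih ⟨?_, above_of_edgesAt hva ha⟩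
      intro hap
      rcases (G.mem_edgesAt.mp ha).2 with h' | h'
      · exact hv (h'.symm.trans hap)
      · rw [Fin.castSucc_inj] at hap
        have h3 := G.lt_parent a
        rw [h', hap] at h3
        exact absurd hva.le (not_le.mpr h3)
  · intro hf
    obtain ⟨e, he, hfe⟩ := (connected_univ p).exists_mem_branch ⟨p, hp⟩ (Finset.mem_univ f)
    rcases (G.mem_edgesAt.mp he).2 with h' | h'
    · rwa [Fin.castSucc_inj.mp h'] at hfe
    · have h1 := above_of_mem_branch h' hfe
      refine absurd ⟨?_, h1.trans (above_of_parent (h' ▸ .refl))⟩ hf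
      have := G.lt_parent e
      rw [h'] at this
      exact (h1.le.trans_lt this).ne

/-- A path from e that avoids u could only continue through the other end w, where e is the only
edge. -/
lemma branch_eq_singleton {w : Fin (m + 1)} (he : e ∈ F)
    (h1 : e.castSucc = u ∧ G.parent e = w ∨ e.castSucc = w ∧ G.parent e = u)
    (hw : G.edgesAt F w = {e}) : G.branch F u e = {e} := by
  refine Finset.eq_singleton_iff_unique_mem.mpr ⟨mem_branch_self he, fun f hf => ?_⟩
  have := (mem_branch.mp hf).2
  clear hf
  induction this with
  | refl => rfl
  | tail _ h ih =>
    obtain ⟨-, v, hv, ha, hb⟩ := h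
    rw [ih] at ha
    have hvw : v = w := by
      rcases (G.mem_edgesAt.mp ha).2 with h' | h' <;> rcases h1 with ⟨h2, h3⟩ | ⟨h2, h3⟩
      · exact absurd (h'.symm.trans h2) hv
      · exact h'.symm.trans h2
      · exact h'.symm.trans h3
      · exact absurd (h'.symm.trans h3) hv
    rw [hvw, hw] at hb
    exact Finset.mem_singleton.mp hb

end MetricTree

/-! ### A closed formula for characteristic functions and their independence of the splittings. -/

namespace MetricTree

variable {m : ℕ} (G : MetricTree m) {F : Finset (Fin m)} {u v : Fin (m + 1)} {e f : Fin m}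

/-- An edge at every internal vertex of `F`. -/
def vertexChoices (F : Finset (Fin m)) (v : Fin (m + 1)) : Finset (Option (Fin m)) :=
  -- Other vertices have the single choice `none`, on which `condAt` falls back to the given
  -- boundary condition.
  if 2 ≤ G.degree F v then (G.edgesAt F v).image some else {none}

/-- The condition for the edge `e` at the vertex `v`: the Neumann condition for the chosen edge at an
internal vertex and the Dirichlet condition for the other ones. -/
def condAt (bc : Fin (m + 1) → BoundaryCond) (c : Fin (m + 1) → Option (Fin m)) (e : Fin m)
    (v : Fin (m + 1)) : BoundaryCond :=
  match c v with
  | none => bc v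
  | some f => if e = f then .neumann else .dirichlet

/-- The product of the characteristic functions of the edges for a given choice. -/
noncomputable def edgeProd (χ : Fin m → BoundaryCond → BoundaryCond → ℂ) (F : Finset (Fin m))
    (bc : Fin (m + 1) → BoundaryCond) (c : Fin (m + 1) → Option (Fin m)) : ℂ :=
  ∏ e ∈ F, χ e (condAt bc c e e.castSucc) (condAt bc c e (G.parent e))

/-- The closed formula for the characteristic function. -/
noncomputable def charSum (χ : Fin m → BoundaryCond → BoundaryCond → ℂ) (F : Finset (Fin m))
    (bc : Fin (m + 1) → BoundaryCond) : ℂ :=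
  ∑ c ∈ Fintype.piFinset (G.vertexChoices F), G.edgeProd χ F bc c

variable {G} {χ : Fin m → BoundaryCond → BoundaryCond → ℂ} {bc : Fin (m + 1) → BoundaryCond}

lemma charSum_singleton (e : Fin m) :
    G.charSum χ {e} bc = χ e (bc e.castSucc) (bc (G.parent e)) := by
  have h : G.vertexChoices {e} = fun v => {(fun _ => none : Fin (m + 1) → Option (Fin m)) v} := by
    funext v
    rw [vertexChoices, if_neg (by have := G.degree_singleton_le e v; omega)]
  rw [charSum, h, Fintype.piFinset_singleton, Finset.sum_singleton, edgeProd,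
    Finset.prod_singleton]
  rfl

lemma mem_vertexChoices_of_not (h : ¬ 2 ≤ G.degree F v) {o : Option (Fin m)} :
    o ∈ G.vertexChoices F v ↔ o = none := by
  rw [vertexChoices, if_neg h, Finset.mem_singleton]

lemma vertexChoices_branch (he : e ∈ G.edgesAt F u) (h : 2 ≤ G.degree (G.branch F u e) v) :
    v ≠ u ∧ 2 ≤ G.degree F v ∧ G.vertexChoices (G.branch F u e) v = G.vertexChoices F v := by
  have hv : v ≠ u := by
    rintro rfl
    rw [degree_branch_self he] at h
    omega
  obtain ⟨f, hf⟩ : (G.edgesAt (G.branch F u e) v).Nonempty :=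
    Finset.card_pos.mp (by unfold degree at h; omega)
  have heq := edgesAt_branch_of_ne hv hf
  have hdeg : G.degree (G.branch F u e) v = G.degree F v := by rw [degree, degree, heq]
  refine ⟨hv, hdeg ▸ h, ?_⟩
  rw [vertexChoices, vertexChoices, hdeg, heq]

lemma Connected.exists_branch_degree (hF : G.Connected F) (hu : (G.edgesAt F u).Nonempty)
    (hv : v ≠ u) (h : 2 ≤ G.degree F v) :
    ∃ e ∈ G.edgesAt F u, 2 ≤ G.degree (G.branch F u e) v := by
  obtain ⟨e, he, h'⟩ := hF.exists_edgesAt_branch hu hv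
    (Finset.card_pos.mp (by unfold degree at h; omega))
  exact ⟨e, he, by rw [degree, h']; exact h⟩

lemma condAt_restrict {o : Option (Fin m)} (he : e ∈ G.edgesAt F u)
    (hf : f ∈ G.edgesAt (G.branch F u e) v) {c c' : Fin (m + 1) → Option (Fin m)}
    (hc : c ∈ Fintype.piFinset (G.vertexChoices F)) (hcu : c u = o) (ho : o ≠ none)
    (hc' : ∀ w, 2 ≤ G.degree (G.branch F u e) w → c' w = c w)
    (hc'' : ∀ w, ¬ 2 ≤ G.degree (G.branch F u e) w → c' w = none) :
    condAt bc c f v =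
      condAt (Function.update bc u (if o = some e then .neumann else .dirichlet)) c' f v := by
  by_cases hv : v = u
  · subst hv
    have hfe : f = e := by
      rw [edgesAt_branch_self he] at hf
      exact Finset.mem_singleton.mp hf
    subst hfe
    have h1 := hc'' v (by rw [degree_branch_self he]; omega)
    obtain ⟨i, hi⟩ := Option.ne_none_iff_exists'.mp ho
    subst hi
    simp only [condAt, hcu, h1, Function.update_self, Option.some.injEq, eq_comm]
  · by_cases hd : 2 ≤ G.degree (G.branch F u e) v
    · rw [condAt, condAt, hc' v hd, Function.update_of_ne hv]
    · have heq := edgesAt_branch_of_ne hv hf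
      have hd' : ¬ 2 ≤ G.degree F v := by rwa [degree, ← heq]
      have h2 := (mem_vertexChoices_of_not hd').mp (Fintype.mem_piFinset.mp hc v)
      rw [condAt, condAt, hc'' v hd, h2, Function.update_of_ne hv]

lemma edgeProd_split {o : Option (Fin m)} (hF : G.Connected F) (hu : (G.edgesAt F u).Nonempty)
    {c : Fin (m + 1) → Option (Fin m)} {p : Fin m → Fin (m + 1) → Option (Fin m)}
    (hc : c ∈ Fintype.piFinset (G.vertexChoices F)) (hcu : c u = o) (ho : o ≠ none)
    (hp : ∀ e ∈ G.edgesAt F u, ∀ w, 2 ≤ G.degree (G.branch F u e) w → p e w = c w)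
    (hp' : ∀ e ∈ G.edgesAt F u, ∀ w, ¬ 2 ≤ G.degree (G.branch F u e) w → p e w = none) :
    G.edgeProd χ F bc c = ∏ e ∈ G.edgesAt F u, G.edgeProd χ (G.branch F u e)
      (Function.update bc u (if o = some e then .neumann else .dirichlet)) (p e) := by
  have h1 : G.edgeProd χ F bc c = ∏ e ∈ G.edgesAt F u, G.edgeProd χ (G.branch F u e) bc c := by
    unfold edgeProd
    rw [← Finset.prod_biUnion fun e he f hf hef => disjoint_branch he hf hef, hF.biUnion_branch hu]
  rw [h1]
  refine Finset.prod_congr rfl fun e he => Finset.prod_congr rfl fun f hf => ?_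
  rw [condAt_restrict he (G.mem_edgesAt.mpr ⟨hf, .inl rfl⟩) hc hcu ho (hp e he) (hp' e he),
    condAt_restrict he (G.mem_edgesAt.mpr ⟨hf, .inr rfl⟩) hc hcu ho (hp e he) (hp' e he)]

/-- Every internal vertex other than u is internal in exactly one branch (its `owner`). So a choice
on F is the same as a choice o at u together with independent choices on the branches, and o decides
which branch gets the Neumann condition at u. -/
lemma Connected.charSum_split_aux (hF : G.Connected F) (hu : 2 ≤ G.degree F u) :
    G.charSum χ F bc = ∑ o ∈ (G.edgesAt F u).image some, ∏ e : {e // e ∈ G.edgesAt F u},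
      G.charSum χ (G.branch F u e)
        (Function.update bc u (if o = some (e : Fin m) then .neumann else .dirichlet)) := by
  classical
  have hne : (G.edgesAt F u).Nonempty := Finset.card_pos.mp (by unfold degree at hu; omega)
  -- the part that contains a given internal vertex
  have howner : ∀ v, ∃ e : {e // e ∈ G.edgesAt F u}, v ≠ u → 2 ≤ G.degree F v →
      2 ≤ G.degree (G.branch F u e) v := by
    intro v
    by_cases h : v ≠ u ∧ 2 ≤ G.degree F v
    · obtain ⟨e, he, h'⟩ := hF.exists_branch_degree hne h.1 h.2
      exact ⟨⟨e, he⟩, fun _ _ => h'⟩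
    · obtain ⟨e, he⟩ := hne
      exact ⟨⟨e, he⟩, fun h1 h2 => absurd ⟨h1, h2⟩ h⟩
  choose owner howner using howner
  have howner_eq : ∀ (e : {e // e ∈ G.edgesAt F u}) v, 2 ≤ G.degree (G.branch F u e) v →
      owner v = e := by
    intro e v h
    obtain ⟨h1, h2, -⟩ := vertexChoices_branch e.2 h
    have h3 := howner v h1 h2
    exact Subtype.ext (eq_of_edgesAt_branch (owner v).2 e.2 h1
      (Finset.card_pos.mp (by unfold degree at h3; omega))
      (Finset.card_pos.mp (by unfold degree at h; omega)))
  unfold charSum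
  simp_rw [Finset.prod_univ_sum]
  rw [← Finset.sum_product']
  symm
  have hmem : ∀ o ∈ (G.edgesAt F u).image some, ∀ p ∈ Fintype.piFinset
      fun e : {e // e ∈ G.edgesAt F u} => Fintype.piFinset (G.vertexChoices (G.branch F u e)),
      (fun v => if v = u then o else p (owner v) v) ∈ Fintype.piFinset (G.vertexChoices F) := by
    intro o ho p hp
    rw [Fintype.mem_piFinset]
    intro v
    by_cases hv : v = u
    · rw [if_pos hv, hv, vertexChoices, if_pos hu]; exact ho
    · rw [if_neg hv]
      have hpv := Fintype.mem_piFinset.mp (Fintype.mem_piFinset.mp hp (owner v)) v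
      by_cases hd : 2 ≤ G.degree (G.branch F u (owner v)) v
      · rwa [(vertexChoices_branch (owner v).2 hd).2.2] at hpv
      · have hd' : ¬ 2 ≤ G.degree F v := fun h => hd (howner v hv h)
        rw [mem_vertexChoices_of_not hd] at hpv
        exact (mem_vertexChoices_of_not hd').mpr hpv
  have hval : ∀ (o : Option (Fin m)) (p : {e // e ∈ G.edgesAt F u} → Fin (m + 1) → Option (Fin m)),
      (∀ e : {e // e ∈ G.edgesAt F u},
        p e ∈ Fintype.piFinset (G.vertexChoices (G.branch F u e))) →
      ∀ (e : {e // e ∈ G.edgesAt F u}) v, (2 ≤ G.degree (G.branch F u e) v →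
        p e v = if v = u then o else p (owner v) v) ∧
      (¬ 2 ≤ G.degree (G.branch F u e) v → p e v = none) := by
    intro o p hp e v
    refine ⟨fun h => ?_, fun h => ?_⟩
    · rw [if_neg (vertexChoices_branch e.2 h).1, howner_eq e v h]
    · exact (mem_vertexChoices_of_not h).mp (Fintype.mem_piFinset.mp (hp e) v)
  refine Finset.sum_bij'
    (fun x _ => fun v => if v = u then x.1 else x.2 (owner v) v)
    (fun c _ => (c u, fun e v => if 2 ≤ G.degree (G.branch F u e) v then c v else none))
    ?_ ?_ ?_ ?_ ?_
  · rintro ⟨o, p⟩ hx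
    obtain ⟨ho, hp⟩ := Finset.mem_product.mp hx
    exact hmem o ho p hp
  · intro c hc
    have hc' := Fintype.mem_piFinset.mp hc
    refine Finset.mem_product.mpr ⟨?_, ?_⟩
    · have := hc' u
      rwa [vertexChoices, if_pos hu] at this
    · refine Fintype.mem_piFinset.mpr fun e => Fintype.mem_piFinset.mpr fun v => ?_
      dsimp only
      by_cases h : 2 ≤ G.degree (G.branch F u e) v
      · rw [if_pos h, (vertexChoices_branch e.2 h).2.2]; exact hc' v
      · rw [if_neg h, mem_vertexChoices_of_not h]
  · rintro ⟨o, p⟩ hx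
    obtain ⟨-, hp⟩ := Finset.mem_product.mp hx
    have hv := hval o p (Fintype.mem_piFinset.mp hp)
    refine Prod.ext (by simp) (funext fun e => funext fun v => ?_)
    dsimp only
    by_cases h : 2 ≤ G.degree (G.branch F u e) v
    · rw [if_pos h, (hv e v).1 h]
    · rw [if_neg h, (hv e v).2 h]
  · intro c hc
    funext v
    dsimp only
    by_cases hv : v = u
    · rw [if_pos hv, hv]
    · rw [if_neg hv]
      by_cases h : 2 ≤ G.degree (G.branch F u (owner v)) v
      · rw [if_pos h]
      · rw [if_neg h]
        exact ((mem_vertexChoices_of_not fun h' => h (howner v hv h')).mp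
          (Fintype.mem_piFinset.mp hc v)).symm
  · rintro ⟨o, p⟩ hx
    obtain ⟨ho, hp⟩ := Finset.mem_product.mp hx
    have hv := hval o p (Fintype.mem_piFinset.mp hp)
    have hon : o ≠ none := by
      obtain ⟨i, -, rfl⟩ := Finset.mem_image.mp (show o ∈ (G.edgesAt F u).image some from ho)
      simp
    rw [edgeProd_split (o := o) hF hne (hmem o ho p hp) (if_pos rfl) hon
      (p := fun e => if h : e ∈ G.edgesAt F u then p ⟨e, h⟩ else fun _ => none)
      (fun e he w hw => by rw [dif_pos he]; exact (hv ⟨e, he⟩ w).1 hw)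
      (fun e he w hw => by rw [dif_pos he]; exact (hv ⟨e, he⟩ w).2 hw)]
    refine Eq.trans (Finset.prod_congr rfl fun e _ => ?_) (Finset.prod_coe_sort (G.edgesAt F u) _)
    rw [dif_pos e.2]

/-- The recursive relation holds for every internal vertex. -/
theorem Connected.charSum_split (hF : G.Connected F) (hu : 2 ≤ G.degree F u) :
    G.charSum χ F bc = ∑ e ∈ G.edgesAt F u,
      G.charSum χ (G.branch F u e) (Function.update bc u .neumann) *
        ∏ f ∈ (G.edgesAt F u).erase e,
          G.charSum χ (G.branch F u f) (Function.update bc u .dirichlet) := by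
  rw [hF.charSum_split_aux hu, Finset.sum_image fun _ _ _ _ h => Option.some_injective _ h]
  refine Finset.sum_congr rfl fun e he => ?_
  rw [Finset.prod_coe_sort (G.edgesAt F u) fun f => G.charSum χ (G.branch F u f)
    (Function.update bc u (if some e = some f then .neumann else .dirichlet)),
    ← Finset.mul_prod_erase _ _ he, if_pos rfl]
  congr 1
  refine Finset.prod_congr rfl fun f hf => ?_
  rw [if_neg fun h => Finset.ne_of_mem_erase hf (Option.some_injective _ h).symm]

/-! ### Characteristic functions -/

variable {σ : Fin m → ℝ → ℂ}

/-- The values of the characteristic functions of the edges. -/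
noncomputable def edgeValue (G : MetricTree m) (σ : Fin m → ℝ → ℂ) (lam : ℂ) (e : Fin m)
    (b b' : BoundaryCond) : ℂ := edgeCharFun (G.len e) (σ e) b b' lam

/-- The recursion determines its value whatever vertices are used, because the closed formula
satisfies the splitting relation at each of them. This justifies the choice made in `charFun`. -/
lemma IsCharFun.eq_charSum {Δ : ℂ → ℂ} (h : G.IsCharFun σ F bc Δ) (hF : G.Connected F) (lam : ℂ) :
    Δ lam = G.charSum (G.edgeValue σ lam) F bc := by
  induction h generalizing lam with
  | single e bc => rw [charSum_singleton]; rfl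
  | split F bc u hu ΔD ΔN hD hN ihD ihN =>
    rw [hF.charSum_split hu]
    refine Finset.sum_congr rfl fun e he => ?_
    rw [ihN e he (connected_branch (G.mem_edgesAt.mp he).1)]
    congr 1
    refine Finset.prod_congr rfl fun f hf => ?_
    have hf' := Finset.mem_of_mem_erase hf
    rw [ihD f hf' (connected_branch (G.mem_edgesAt.mp hf').1)]

lemma Connected.exists_isCharFun (hF : G.Connected F) :
    ∀ bc, ∃ Δ, G.IsCharFun σ F bc Δ := by
  refine Connected.induction (P := fun F => ∀ bc, ∃ Δ, G.IsCharFun σ F bc Δ)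
    (fun e bc => ⟨_, .single e bc⟩) (fun F u _ hu ih bc => ?_) F hF
  choose! Δ hΔ using ih
  exact ⟨_, .split F bc u hu (fun e => Δ e (Function.update bc u .dirichlet))
    (fun e => Δ e (Function.update bc u .neumann)) (fun e he => hΔ e he _) fun e he => hΔ e he _⟩

theorem Connected.charFun_eq (hF : G.Connected F) (lam : ℂ) :
    G.charFun σ F bc lam = G.charSum (G.edgeValue σ lam) F bc :=
  (Classical.epsilon_spec (hF.exists_isCharFun bc)).eq_charSum hF lam

end MetricTree

/-! ### Edge functions as entire functions of ρ. -/

section EdgeEntire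

variable {T : ℝ} {s : ℝ → ℂ}

lemma differentiable_edgeCharFun (hT : 0 ≤ T) (hs : MemLp s 2 (volume.restrict (Ioo 0 T)))
    (b b' : BoundaryCond) : Differentiable ℂ (edgeCharFun T s b b') := by
  have key : ∀ α β : ℂ, Differentiable ℂ (fun lam => (slSolution T s lam α β).1 T) ∧
      Differentiable ℂ (fun lam => (slSolution T s lam α β).2 T) := by
    intro α β
    obtain ⟨Y, -, hY, h0, hd⟩ := exists_isSLSolution hT hs α β
    have e : ∀ lam, _ := fun lam => slSolution_eq (hY lam) hT hs
    simp only [h0] at e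
    simp only [fun lam => (e lam).1, fun lam => (e lam).2]
    exact ⟨(hd T).fst, (hd T).snd⟩
  cases b <;> cases b'
  · exact (key 0 1).1
  · exact (key 0 1).2
  · exact (key 1 0).1
  · exact (key 1 0).2

/-- The type 2T comes from the growth estimate with κ = 1 + |ρ|; the additional 1 absorbs the factor
κ lost for the quasi-derivative. Only finiteness of the type matters. -/
lemma hasExpType_edgeCharFun (hT : 0 ≤ T) (hs : MemLp s 2 (volume.restrict (Ioo 0 T)))
    (b b' : BoundaryCond) :
    HasExpType (2 * T + 1) fun ρ => edgeCharFun T s b b' (ρ ^ 2) := by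
  have key : ∀ α β : ℂ, ‖α‖ ≤ 1 → ‖β‖ ≤ 1 → ∃ C : ℝ, ∀ ρ : ℂ,
      ‖(slSolution T s (ρ ^ 2) α β).1 T‖ ≤ C * Real.exp ((2 * T + 1) * ‖ρ‖) ∧
      ‖(slSolution T s (ρ ^ 2) α β).2 T‖ ≤ C * Real.exp ((2 * T + 1) * ‖ρ‖) := by
    intro α β hα hβ
    set A := ∫ t in (0 : ℝ)..T, (1 + ‖s t‖ + ‖s t‖ ^ 2) with hA
    refine ⟨2 * Real.exp (2 * A), fun ρ => ?_⟩
    obtain ⟨hY, h0, h1⟩ := slSolution_spec hT hs (ρ ^ 2) α β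
    set κ := 1 + ‖ρ‖ with hκ
    have hκ1 : 1 ≤ κ := by linarith [norm_nonneg ρ]
    have hκ0 : 0 < κ := by linarith
    have hb := hY.norm_le hT hs hκ1 (by rw [norm_pow, hκ]; gcongr; linarith) (x := T) ⟨hT, le_rfl⟩
    rw [h0, h1] at hb
    have hmax : max ‖α‖ (‖β‖ / κ) ≤ 1 :=
      max_le hα ((div_le_one hκ0).mpr (hβ.trans hκ1))
    have hint : ∫ t in (0 : ℝ)..T, (κ + ‖s t‖ + ‖s t‖ ^ 2) = T * ‖ρ‖ + A := by
      have i1 := (hs.intervalIntegrable_of_Ioo hT).norm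
      have i2 : IntervalIntegrable (fun t => ‖s t‖ ^ 2) volume 0 T := by
        simpa using (hs.intervalIntegrable_sq_of_Ioo hT).norm
      have i3 : IntervalIntegrable (fun t => 1 + ‖s t‖ + ‖s t‖ ^ 2) volume 0 T :=
        (intervalIntegrable_const.add i1).add i2
      have e : ∀ t, κ + ‖s t‖ + ‖s t‖ ^ 2 = ‖ρ‖ + (1 + ‖s t‖ + ‖s t‖ ^ 2) := fun t => by
        rw [hκ]; ring
      simp_rw [e]
      rw [intervalIntegral.integral_add intervalIntegrable_const i3,
        intervalIntegral.integral_const]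
      simp [hA]
    have hexp : Real.exp (2 * (T * ‖ρ‖ + A)) =
        Real.exp (2 * A) * Real.exp (2 * T * ‖ρ‖) := by
      rw [← Real.exp_add]; congr 1; ring
    have hb' : max ‖(slSolution T s (ρ ^ 2) α β).1 T‖
        (‖(slSolution T s (ρ ^ 2) α β).2 T‖ / κ) ≤
          2 * Real.exp (2 * A) * Real.exp (2 * T * ‖ρ‖) := by
      refine hb.trans ?_
      rw [hint, hexp]
      calc _ ≤ 2 * 1 * (Real.exp (2 * A) * Real.exp (2 * T * ‖ρ‖)) := by gcongr
        _ = _ := by ring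
    have hκe : κ ≤ Real.exp ‖ρ‖ := by rw [hκ, add_comm]; exact Real.add_one_le_exp _
    have hsplit : Real.exp ((2 * T + 1) * ‖ρ‖) = Real.exp (2 * T * ‖ρ‖) * Real.exp ‖ρ‖ := by
      rw [← Real.exp_add]; congr 1; ring
    have b1 := (le_max_left _ _).trans hb'
    have b2 := (le_max_right _ _).trans hb'
    rw [div_le_iff₀ hκ0] at b2
    rw [hsplit, ← mul_assoc]
    constructor
    · refine b1.trans (le_mul_of_one_le_right (by positivity) (hκ1.trans hκe))
    · refine b2.trans (by gcongr)
  refine ⟨(differentiable_edgeCharFun hT hs b b').comp (differentiable_id.pow 2), ?_⟩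
  obtain ⟨C, hC⟩ := key 0 1 (by simp) (by simp)
  obtain ⟨C', hC'⟩ := key 1 0 (by simp) (by simp)
  cases b <;> cases b'
  · exact ⟨C, fun ρ => (hC ρ).1⟩
  · exact ⟨C, fun ρ => (hC ρ).2⟩
  · exact ⟨C', fun ρ => (hC' ρ).1⟩
  · exact ⟨C', fun ρ => (hC' ρ).2⟩

lemma edgeCharFun_wronskian (hT : 0 ≤ T) (hs : MemLp s 2 (volume.restrict (Ioo 0 T))) (lam : ℂ) :
    edgeCharFun T s .neumann .dirichlet lam * edgeCharFun T s .dirichlet .neumann lam -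
      edgeCharFun T s .neumann .neumann lam * edgeCharFun T s .dirichlet .dirichlet lam = 1 := by
  obtain ⟨h, h0, h1⟩ := slSolution_spec hT hs lam 1 0
  obtain ⟨h', h0', h1'⟩ := slSolution_spec hT hs lam 0 1
  have := h.wronskian h' hT
  rw [h0, h1, h0', h1'] at this
  simpa [edgeCharFun] using this

lemma continuous_normEdgeChar_linePt {τ : ℝ} (hτ : 0 < τ) (hT : 0 ≤ T)
    (hs : MemLp s 2 (volume.restrict (Ioo 0 T))) (b b' : BoundaryCond) :
    Continuous fun ξ => normEdgeChar T s b b' (linePt τ ξ) := by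
  unfold normEdgeChar
  exact ((continuous_linePt τ).zpow₀ _ fun ξ => .inl (linePt_ne_zero hτ ξ)).mul
    ((differentiable_edgeCharFun hT hs b b').continuous.comp ((continuous_linePt τ).pow 2))

lemma normEdgeChar_wronskian (hT : 0 ≤ T) (hs : MemLp s 2 (volume.restrict (Ioo 0 T))) {ρ : ℂ}
    (hρ : ρ ≠ 0) :
    normEdgeChar T s .neumann .dirichlet ρ * normEdgeChar T s .dirichlet .neumann ρ -
      normEdgeChar T s .neumann .neumann ρ * normEdgeChar T s .dirichlet .dirichlet ρ = 1 := by
  have h := edgeCharFun_wronskian hT hs (ρ ^ 2)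
  simp only [normEdgeChar, BoundaryCond.order, sub_zero, sub_self, zpow_zero, one_mul, zpow_one,
    zero_sub, zpow_neg]
  rw [← h]
  field_simp

end EdgeEntire

/-! ### Normalized characteristic functions of subtrees and their splitting. -/

namespace MetricTree

variable {m : ℕ} {G : MetricTree m} {F F' : Finset (Fin m)} {u v : Fin (m + 1)} {e f : Fin m}
  {χ : Fin m → BoundaryCond → BoundaryCond → ℂ} {bc bc' : Fin (m + 1) → BoundaryCond}

lemma charSum_congr (h : ∀ v ∈ G.boundary F, bc v = bc' v) :
    G.charSum χ F bc = G.charSum χ F bc' := by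
  refine Finset.sum_congr rfl fun c hc => Finset.prod_congr rfl fun e he => ?_
  have key : ∀ v, e ∈ G.edgesAt F v → condAt bc c e v = condAt bc' c e v := by
    intro v hv
    by_cases hd : 2 ≤ G.degree F v
    · have := Fintype.mem_piFinset.mp hc v
      rw [vertexChoices, if_pos hd] at this
      obtain ⟨i, -, hi⟩ := Finset.mem_image.mp this
      simp only [condAt, ← hi]
    · have hpos : 0 < (G.edgesAt F v).card := Finset.card_pos.mpr ⟨e, hv⟩
      have hb : v ∈ G.boundary F := by
        rw [mem_boundary]; unfold degree at hd; omega
      simp only [condAt, h v hb]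
  rw [key _ (G.mem_edgesAt.mpr ⟨he, .inl rfl⟩), key _ (G.mem_edgesAt.mpr ⟨he, .inr rfl⟩)]

variable (G) in
/-- The power of `ρ` which makes the characteristic function bounded on horizontal lines. -/
def expo (F : Finset (Fin m)) (bc : Fin (m + 1) → BoundaryCond) : ℤ :=
  ∑ v ∈ G.boundary F, (1 - (bc v).order) - 1

variable (G) in
/-- The characteristic function as a function of `ρ = √λ`, multiplied by a power of `ρ`. -/
noncomputable def normChar (σ : Fin m → ℝ → ℂ) (F : Finset (Fin m))
    (bc : Fin (m + 1) → BoundaryCond) (ρ : ℂ) : ℂ :=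
  ρ ^ G.expo F bc * G.charSum (G.edgeValue σ (ρ ^ 2)) F bc

variable {σ : Fin m → ℝ → ℂ} {ρ : ℂ}

lemma normChar_congr (h : ∀ v ∈ G.boundary F, bc v = bc' v) :
    G.normChar σ F bc ρ = G.normChar σ F bc' ρ := by
  rw [normChar, normChar, charSum_congr h, expo, expo,
    Finset.sum_congr rfl fun v hv => by rw [h v hv]]

lemma boundary_singleton (e : Fin m) : G.boundary {e} = {e.castSucc, G.parent e} := by
  ext v
  rw [mem_boundary, Finset.mem_insert, Finset.mem_singleton]
  constructor
  · intro h
    obtain ⟨f, hf⟩ := Finset.card_pos.mp (by omega : 0 < (G.edgesAt {e} v).card)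
    rw [mem_edgesAt, Finset.mem_singleton] at hf
    obtain ⟨rfl, hv⟩ := hf
    exact hv.imp Eq.symm Eq.symm
  · intro h
    have h1 := G.degree_singleton_le e v
    have h2 : 0 < (G.edgesAt {e} v).card := Finset.card_pos.mpr
      ⟨e, G.mem_edgesAt.mpr ⟨Finset.mem_singleton_self e, h.imp Eq.symm Eq.symm⟩⟩
    unfold degree at h1
    omega

lemma normChar_singleton (e : Fin m) : G.normChar σ {e} bc ρ =
    normEdgeChar (G.len e) (σ e) (bc e.castSucc) (bc (G.parent e)) ρ := by
  rw [normChar, charSum_singleton, normEdgeChar, expo, boundary_singleton,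
    Finset.sum_pair (G.lt_parent e).ne, edgeValue]
  congr 2
  ring

/-- In a branch the new boundary vertex u contributes 1 minus the order of its condition, and the 1
cancels the −1 in `expo`. Hence the exponents add up over the branches when exactly one of them
carries the Neumann condition, and the normalized functions satisfy the same splitting relation. -/
lemma expo_branch (he : e ∈ G.edgesAt F u) (b : BoundaryCond) :
    G.expo (G.branch F u e) (Function.update bc u b) =
      ∑ v ∈ (G.boundary (G.branch F u e)).erase u, (1 - (bc v).order) - b.order := by
  rw [expo, ← Finset.add_sum_erase _ _ (mem_boundary_branch he), Function.update_self,
    Finset.sum_congr rfl fun v hv => by rw [Function.update_of_ne (Finset.ne_of_mem_erase hv)]]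
  ring

lemma zpow_sum {ι : Type*} {x : ℂ} (hx : x ≠ 0) (A : Finset ι) (n : ι → ℤ) :
    x ^ ∑ i ∈ A, n i = ∏ i ∈ A, x ^ n i := by
  classical
  induction A using Finset.induction_on with
  | empty => simp
  | insert a A ha ih => rw [Finset.sum_insert ha, Finset.prod_insert ha, zpow_add₀ hx, ih]

theorem Connected.normChar_split (hF : G.Connected F) (hu : 2 ≤ G.degree F u) (hρ : ρ ≠ 0) :
    G.normChar σ F bc ρ = ∑ e ∈ G.edgesAt F u,
      G.normChar σ (G.branch F u e) (Function.update bc u .neumann) ρ *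
        ∏ f ∈ (G.edgesAt F u).erase e,
          G.normChar σ (G.branch F u f) (Function.update bc u .dirichlet) ρ := by
  rw [normChar, hF.charSum_split hu, Finset.mul_sum]
  refine Finset.sum_congr rfl fun e he => ?_
  have hexp : G.expo F bc = G.expo (G.branch F u e) (Function.update bc u .neumann) +
      ∑ f ∈ (G.edgesAt F u).erase e,
        G.expo (G.branch F u f) (Function.update bc u .dirichlet) := by
    rw [expo, hF.sum_boundary hu, ← Finset.add_sum_erase _ _ he, expo_branch he,
      Finset.sum_congr rfl fun f hf => expo_branch (Finset.mem_of_mem_erase hf) .dirichlet]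
    simp only [BoundaryCond.order, sub_zero]
    ring
  rw [hexp, zpow_add₀ hρ, zpow_sum hρ]
  simp only [normChar, Finset.prod_mul_distrib]
  ring

/-- The relation at an internal vertex with one of the edges singled out. -/
theorem Connected.normChar_split_at (hF : G.Connected F) (hu : 2 ≤ G.degree F u) (hρ : ρ ≠ 0)
    (he : e ∈ G.edgesAt F u) :
    G.normChar σ F bc ρ = G.normChar σ (G.branch F u e) (Function.update bc u .neumann) ρ *
        ∏ f ∈ (G.edgesAt F u).erase e,
          G.normChar σ (G.branch F u f) (Function.update bc u .dirichlet) ρ +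
      G.normChar σ (G.branch F u e) (Function.update bc u .dirichlet) ρ *
        ∑ f ∈ (G.edgesAt F u).erase e,
          G.normChar σ (G.branch F u f) (Function.update bc u .neumann) ρ *
            ∏ g ∈ ((G.edgesAt F u).erase e).erase f,
              G.normChar σ (G.branch F u g) (Function.update bc u .dirichlet) ρ := by
  rw [hF.normChar_split hu hρ, ← Finset.add_sum_erase _ _ he, Finset.mul_sum]
  congr 1
  refine Finset.sum_congr rfl fun f hf => ?_
  have hfe : e ∈ (G.edgesAt F u).erase f :=
    Finset.mem_erase.mpr ⟨(Finset.ne_of_mem_erase hf).symm, he⟩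
  rw [← Finset.mul_prod_erase _ _ hfe, Finset.erase_right_comm]
  ring

lemma notMem_boundary_of_edgesAt (hsub : F' ⊆ F) (hv : G.edgesAt F v = {e}) (he : e ∉ F') :
    v ∉ G.boundary F' := by
  rw [mem_boundary]
  intro h
  obtain ⟨f, hf⟩ := Finset.card_pos.mp (by omega : 0 < (G.edgesAt F' v).card)
  rw [mem_edgesAt] at hf
  have : f ∈ G.edgesAt F v := G.mem_edgesAt.mpr ⟨hsub hf.1, hf.2⟩
  rw [hv, Finset.mem_singleton] at this
  exact he (this ▸ hf.1)

end MetricTree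

/-! ### Stability of normalized characteristic functions on a horizontal line. -/

namespace MetricTree

variable {m : ℕ} {G : MetricTree m} {F F' : Finset (Fin m)} {Ω τ : ℝ} {σ σ' : Fin m → ℝ → ℂ}

lemma l2Norm_mono (h : F ⊆ F') : G.l2Norm F σ ≤ G.l2Norm F' σ := by
  unfold l2Norm
  gcongr

lemma l2Norm_singleton (j : Fin m) :
    G.l2Norm {j} σ = eLpNorm (σ j) 2 (volume.restrict (Ioo 0 (G.len j))) := by
  rw [l2Norm, Finset.sum_singleton, ← ENNReal.rpow_natCast, ← ENNReal.rpow_mul]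
  norm_num

lemma InBall.eLpNorm_le (h : G.InBall Ω σ) (j : Fin m) :
    eLpNorm (σ j) 2 (volume.restrict (Ioo 0 (G.len j))) ≤ ENNReal.ofReal Ω := by
  rw [← l2Norm_singleton]
  exact (l2Norm_mono (Finset.subset_univ _)).trans h.2

variable (G) in
/-- Functions of `ξ` depending on the potential, bounded uniformly on the ball of radius `Ω` and
Lipschitz continuous as functions of the potential on `F`, with values in `L₂(ℝ)`. -/
def Stable (Ω : ℝ) (F : Finset (Fin m)) (A : (Fin m → ℝ → ℂ) → ℝ → ℂ) : Prop :=
  ∃ C : ℝ≥0, ∀ σ, G.InBall Ω σ → Continuous (A σ) ∧ (∀ ξ, ‖A σ ξ‖ ≤ C) ∧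
    ∀ σ', G.InBall Ω σ' → eLpNorm (fun ξ => A σ ξ - A σ' ξ) 2 volume ≤
      C * G.l2Norm F (fun j x => σ j x - σ' j x)

lemma eLpNorm_bdd_mul_le {f g : ℝ → ℂ} {C : ℝ≥0} (hf : ∀ ξ, ‖f ξ‖ ≤ C) :
    eLpNorm (fun ξ => f ξ * g ξ) 2 volume ≤ C * eLpNorm g 2 volume := by
  have h := eLpNorm_le_nnreal_smul_eLpNorm_of_ae_le_mul (μ := volume) (c := C)
    (f := fun ξ => f ξ * g ξ) (g := g) (ae_of_all _ fun ξ => by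
      rw [← NNReal.coe_le_coe, NNReal.coe_mul, coe_nnnorm, coe_nnnorm, norm_mul]
      exact mul_le_mul_of_nonneg_right (hf ξ) (norm_nonneg _)) 2
  rwa [ENNReal.smul_def, smul_eq_mul] at h

variable {A B : (Fin m → ℝ → ℂ) → ℝ → ℂ}

lemma Stable.mono (h : G.Stable Ω F A) (hF : F ⊆ F') : G.Stable Ω F' A := by
  obtain ⟨C, hC⟩ := h
  refine ⟨C, fun σ hσ => ⟨(hC σ hσ).1, (hC σ hσ).2.1, fun σ' hσ' => ?_⟩⟩
  exact ((hC σ hσ).2.2 σ' hσ').trans (by gcongr; exact l2Norm_mono hF)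

lemma Stable.congr (h : G.Stable Ω F A) (hAB : ∀ σ ξ, A σ ξ = B σ ξ) : G.Stable Ω F B := by
  obtain rfl : A = B := funext fun σ => funext fun ξ => hAB σ ξ
  exact h

lemma stable_const (c : ℂ) : G.Stable Ω F fun _ _ => c :=
  ⟨‖c‖₊, fun _ _ => ⟨continuous_const, fun _ => le_rfl, fun _ _ => by simp⟩⟩

/-- Uniform boundedness is part of `Stable` for the sake of this product rule: bounded factors
multiply differences lying in L₂. -/
lemma Stable.mul (hA : G.Stable Ω F A) (hB : G.Stable Ω F B) :
    G.Stable Ω F fun σ ξ => A σ ξ * B σ ξ := by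
  obtain ⟨C, hC⟩ := hA
  obtain ⟨D, hD⟩ := hB
  refine ⟨2 * C * D, fun σ hσ => ?_⟩
  obtain ⟨a1, a2, a3⟩ := hC σ hσ
  obtain ⟨b1, b2, b3⟩ := hD σ hσ
  refine ⟨a1.mul b1, fun ξ => ?_, fun σ' hσ' => ?_⟩
  · rw [norm_mul]
    push_cast
    have := mul_le_mul (a2 ξ) (b2 ξ) (norm_nonneg _) C.2
    have hn : (0 : ℝ) ≤ (C : ℝ) * D := by positivity
    linarith
  · obtain ⟨a1', a2', -⟩ := hC σ' hσ'
    obtain ⟨b1', b2', -⟩ := hD σ' hσ'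
    have e : (fun ξ => A σ ξ * B σ ξ - A σ' ξ * B σ' ξ) =
        (fun ξ => A σ ξ * (B σ ξ - B σ' ξ)) + fun ξ => B σ' ξ * (A σ ξ - A σ' ξ) := by
      ext ξ; simp only [Pi.add_apply]; ring
    rw [e]
    refine (eLpNorm_add_le (a1.mul (b1.sub b1')).aestronglyMeasurable
      (b1'.mul (a1.sub a1')).aestronglyMeasurable (by norm_num)).trans ?_
    calc _ ≤ C * (D * G.l2Norm F (fun j x => σ j x - σ' j x)) +
          D * (C * G.l2Norm F (fun j x => σ j x - σ' j x)) :=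
          add_le_add ((eLpNorm_bdd_mul_le a2).trans (by gcongr; exact b3 σ' hσ'))
            ((eLpNorm_bdd_mul_le b2').trans (by gcongr; exact a3 σ' hσ'))
      _ = _ := by push_cast; ring

lemma Stable.add (hA : G.Stable Ω F A) (hB : G.Stable Ω F B) :
    G.Stable Ω F fun σ ξ => A σ ξ + B σ ξ := by
  obtain ⟨C, hC⟩ := hA
  obtain ⟨D, hD⟩ := hB
  refine ⟨C + D, fun σ hσ => ?_⟩
  obtain ⟨a1, a2, a3⟩ := hC σ hσ
  obtain ⟨b1, b2, b3⟩ := hD σ hσ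
  refine ⟨a1.add b1, fun ξ => ?_, fun σ' hσ' => ?_⟩
  · push_cast
    exact (norm_add_le _ _).trans (add_le_add (a2 ξ) (b2 ξ))
  · obtain ⟨a1', -, -⟩ := hC σ' hσ'
    obtain ⟨b1', -, -⟩ := hD σ' hσ'
    have e : (fun ξ => A σ ξ + B σ ξ - (A σ' ξ + B σ' ξ)) =
        (fun ξ => A σ ξ - A σ' ξ) + fun ξ => B σ ξ - B σ' ξ := by
      ext ξ; simp only [Pi.add_apply]; ring
    rw [e, ENNReal.coe_add, add_mul]
    exact (eLpNorm_add_le (a1.sub a1').aestronglyMeasurable (b1.sub b1').aestronglyMeasurable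
      (by norm_num)).trans (add_le_add (a3 σ' hσ') (b3 σ' hσ'))

lemma Stable.sum {ι : Type*} (s : Finset ι) {A : ι → (Fin m → ℝ → ℂ) → ℝ → ℂ}
    (h : ∀ i ∈ s, G.Stable Ω F (A i)) : G.Stable Ω F fun σ ξ => ∑ i ∈ s, A i σ ξ := by
  classical
  induction s using Finset.induction_on with
  | empty => simpa using stable_const 0
  | insert a s ha ih =>
    simp only [Finset.sum_insert ha]
    exact (h a (Finset.mem_insert_self a s)).add
      (ih fun i hi => h i (Finset.mem_insert_of_mem hi))

lemma Stable.prod {ι : Type*} (s : Finset ι) {A : ι → (Fin m → ℝ → ℂ) → ℝ → ℂ}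
    (h : ∀ i ∈ s, G.Stable Ω F (A i)) : G.Stable Ω F fun σ ξ => ∏ i ∈ s, A i σ ξ := by
  classical
  induction s using Finset.induction_on with
  | empty => simpa using stable_const 1
  | insert a s ha ih =>
    simp only [Finset.prod_insert ha]
    exact (h a (Finset.mem_insert_self a s)).mul
      (ih fun i hi => h i (Finset.mem_insert_of_mem hi))

variable {ε : Fin m → ℝ}

lemma stable_normEdgeChar (hL : ∀ j, IsLargeHeight (G.len j) Ω τ (ε j)) (e : Fin m)
    (b b' : BoundaryCond) :
    G.Stable Ω {e} fun σ ξ => normEdgeChar (G.len e) (σ e) b b' (linePt τ ξ) := by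
  set C₁ : ℝ := Real.exp (τ * G.len e) * 4
  set C₂ : ℝ := Real.exp (τ * G.len e) * (4 * (2 + Ω * √(G.len e)) * (2 + 8 * Ω) *
        (1 + √(G.len e) * (2 * (2 + Ω * √(G.len e)) * Ω)))
  refine ⟨(max C₁ C₂).toNNReal, fun σ hσ => ⟨continuous_normEdgeChar_linePt (hL e).pos
    (G.len_pos e).le (hσ.1 e) b b', fun ξ => ?_, fun σ' hσ' => ?_⟩⟩
  · exact (norm_normEdgeChar_le (hL e) (hσ.1 e) (hσ.eLpNorm_le e) b b' ξ).trans
      ((le_max_left _ _).trans (Real.le_coe_toNNReal _))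
  · refine (eLpNorm_normEdgeChar_sub_le (hL e) (hσ.1 e) (hσ'.1 e) (hσ.eLpNorm_le e)
      (hσ'.eLpNorm_le e) b b').trans ?_
    rw [l2Norm_singleton]
    gcongr
    exact ENNReal.ofReal_le_ofReal (le_max_right _ _)

theorem Connected.stable_normChar (hL : ∀ j, IsLargeHeight (G.len j) Ω τ (ε j))
    (hF : G.Connected F) :
    ∀ bc, G.Stable Ω F fun σ ξ => G.normChar σ F bc (linePt τ ξ) := by
  refine Connected.induction
    (P := fun F => ∀ bc, G.Stable Ω F fun σ ξ => G.normChar σ F bc (linePt τ ξ))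
    (fun e bc => ?_) (fun F u hF hu ih bc => ?_) F hF
  · exact (stable_normEdgeChar hL e _ _).congr fun σ ξ => (normChar_singleton e).symm
  · have hτ : 0 < τ := by
      obtain ⟨e, -⟩ := hF.1
      exact (hL e).pos
    refine Stable.congr (Stable.sum (G.edgesAt F u) fun e he => ?_) fun σ ξ =>
      (hF.normChar_split hu (linePt_ne_zero hτ ξ)).symm
    exact ((ih e he _).mono branch_subset).mul (Stable.prod _ fun f hf =>
      (ih f (Finset.mem_of_mem_erase hf) _).mono branch_subset)

/-! ### The lower bound -/

/-- The subtree has e as its top edge, with Dirichlet conditions below. By induction the branches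
under e have data in the cone; so has the joined pair (P, Q), by `InCone.prod`, and it is the
initial datum of the solution on e. Passing along e preserves the cone and gives a value of modulus
at least |Q − iP|/4. Since 2|P| ≤ |Q + iP| + |Q − iP| ≤ 2|Q − iP|, this is at least |P|/4. -/
theorem exists_le_norm_normChar (hL : ∀ j, IsLargeHeight (G.len j) Ω τ (ε j)) :
    ∀ (F : Finset (Fin m)) (e : Fin m), G.Connected F → e ∈ F →
      (∀ f ∈ F, G.Above f.castSucc e.castSucc) →
      ∃ δ : ℝ, 0 < δ ∧ ∀ σ, G.InBall Ω σ → ∀ ξ,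
        InCone (G.normChar σ F allDirichlet (linePt τ ξ))
          (G.normChar σ F (neumannAt (G.parent e)) (linePt τ ξ)) ∧
        δ ≤ ‖G.normChar σ F allDirichlet (linePt τ ξ)‖ := by
  intro F
  induction F using Finset.strongInductionOn with
  | _ F ih =>
  intro e hF heF htop
  set u := e.castSucc with hu
  set w := G.parent e with hw
  have huw : u ≠ w := (G.lt_parent e).ne
  have he : e ∈ G.edgesAt F u := G.mem_edgesAt.mpr ⟨heF, .inl rfl⟩
  have hew : G.edgesAt F w = {e} := by
    refine Finset.eq_singleton_iff_unique_mem.mpr ⟨G.mem_edgesAt.mpr ⟨heF, .inr rfl⟩,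
      fun f hf => ?_⟩
    exact eq_of_above_of_edgesAt rfl hf (htop f (G.mem_edgesAt.mp hf).1)
  have hbranch : G.branch F u e = {e} := branch_eq_singleton heF (.inl ⟨rfl, rfl⟩) hew
  have hDu : (allDirichlet : Fin (m + 1) → BoundaryCond) u = .dirichlet := rfl
  have hNu : (neumannAt w : Fin (m + 1) → BoundaryCond) u = .dirichlet := by
    rw [neumannAt, Function.update_of_ne huw]; rfl
  have hNw : (neumannAt w : Fin (m + 1) → BoundaryCond) w = .neumann := Function.update_self ..
  by_cases hdeg : 2 ≤ G.degree F u
  · have hsing : ∀ f ∈ (G.edgesAt F u).erase e, ∃ δ : ℝ, 0 < δ ∧ ∀ σ, G.InBall Ω σ → ∀ ξ,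
        InCone (G.normChar σ (G.branch F u f) allDirichlet (linePt τ ξ))
          (G.normChar σ (G.branch F u f) (neumannAt u) (linePt τ ξ)) ∧
        δ ≤ ‖G.normChar σ (G.branch F u f) allDirichlet (linePt τ ξ)‖ := by
      intro f hf
      obtain ⟨hfe, hf⟩ := Finset.mem_erase.mp hf
      have hfF := (G.mem_edgesAt.mp hf).1
      have hfu : G.parent f = u := by
        rcases (G.mem_edgesAt.mp hf).2 with h | h
        · exact absurd (Fin.castSucc_inj.mp h) hfe
        · exact h
      have := ih (G.branch F u f) ⟨branch_subset, fun h => absurd (Finset.card_le_card h)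
        (not_le.mpr (card_branch_lt hdeg hf))⟩ f (connected_branch hfF) (mem_branch_self hfF)
        fun g hg => above_of_mem_branch hfu hg
      rwa [hfu] at this
    choose! δ hδ0 hδ using hsing
    refine ⟨(∏ f ∈ (G.edgesAt F u).erase e, δ f) / 4,
      div_pos (Finset.prod_pos hδ0) (by norm_num), fun σ hσ ξ => ?_⟩
    have hρ := linePt_ne_zero (hL e).pos ξ
    have hw_not : ∀ f ∈ (G.edgesAt F u).erase e, w ∉ G.boundary (G.branch F u f) := by
      intro f hf
      obtain ⟨hfe, hf⟩ := Finset.mem_erase.mp hf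
      refine notMem_boundary_of_edgesAt branch_subset hew fun h => ?_
      exact hfe (eq_of_mem_branch hf he h).symm
    set P := ∏ f ∈ (G.edgesAt F u).erase e,
      G.normChar σ (G.branch F u f) allDirichlet (linePt τ ξ) with hP
    set Q := ∑ f ∈ (G.edgesAt F u).erase e,
      G.normChar σ (G.branch F u f) (neumannAt u) (linePt τ ξ) *
        ∏ g ∈ ((G.edgesAt F u).erase e).erase f,
          G.normChar σ (G.branch F u g) allDirichlet (linePt τ ξ) with hQ
    have hcone : InCone P Q := InCone.prod _ fun f hf => (hδ f hf σ hσ ξ).1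
    have key : ∀ bc : Fin (m + 1) → BoundaryCond, (∀ v, v ≠ w → bc v = .dirichlet) →
        G.normChar σ F bc (linePt τ ξ) =
          normEdgeChar (G.len e) (σ e) .neumann (bc w) (linePt τ ξ) * P +
          normEdgeChar (G.len e) (σ e) .dirichlet (bc w) (linePt τ ξ) * Q := by
      intro bc hbc
      have c1 : ∀ f ∈ (G.edgesAt F u).erase e,
          G.normChar σ (G.branch F u f) (Function.update bc u .dirichlet) (linePt τ ξ) =
            G.normChar σ (G.branch F u f) allDirichlet (linePt τ ξ) := fun f hf => by
        refine normChar_congr fun v hv => ?_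
        have hvw : v ≠ w := fun h => hw_not f hf (h ▸ hv)
        by_cases hvu : v = u
        · rw [hvu, Function.update_self]; rfl
        · rw [Function.update_of_ne hvu, hbc v hvw]; rfl
      have c2 : ∀ f ∈ (G.edgesAt F u).erase e,
          G.normChar σ (G.branch F u f) (Function.update bc u .neumann) (linePt τ ξ) =
            G.normChar σ (G.branch F u f) (neumannAt u) (linePt τ ξ) := fun f hf => by
        refine normChar_congr fun v hv => ?_
        have hvw : v ≠ w := fun h => hw_not f hf (h ▸ hv)
        by_cases hvu : v = u
        · rw [hvu, neumannAt, Function.update_self, Function.update_self]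
        · rw [neumannAt, Function.update_of_ne hvu, Function.update_of_ne hvu, hbc v hvw]; rfl
      rw [hF.normChar_split_at hdeg hρ he, hbranch, normChar_singleton, normChar_singleton,
        ← hu, ← hw, Function.update_self, Function.update_self,
        Function.update_of_ne huw.symm, Function.update_of_ne huw.symm,
        Finset.prod_congr rfl c1, hP, hQ]
      congr 2
      refine Finset.sum_congr rfl fun f hf => ?_
      rw [c2 f hf, Finset.prod_congr rfl fun g hg => c1 g (Finset.mem_of_mem_erase hg)]
    have kD := key allDirichlet fun v _ => rfl
    have kN := key (neumannAt w) fun v hv => by rw [neumannAt, Function.update_of_ne hv]; rfl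
    rw [hNw] at kN
    obtain ⟨h1, h2⟩ := inCone_normEdgeChar (hL e) (hσ.1 e) (hσ.eLpNorm_le e) ξ hcone
    rw [kD, kN]
    refine ⟨h1, le_trans ?_ h2⟩
    have hPn : ∏ f ∈ (G.edgesAt F u).erase e, δ f ≤ ‖P‖ := by
      rw [hP, norm_prod]
      exact Finset.prod_le_prod (fun f hf => (hδ0 f hf).le) fun f hf => (hδ f hf σ hσ ξ).2
    have h3 : 2 * ‖P‖ ≤ ‖Q + Complex.I * P‖ + ‖Q - Complex.I * P‖ := by
      have : 2 * Complex.I * P = (Q + Complex.I * P) - (Q - Complex.I * P) := by ring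
      calc 2 * ‖P‖ = ‖2 * Complex.I * P‖ := by simp
        _ ≤ _ := by rw [this]; exact norm_sub_le _ _
    have h4 := inCone_iff.mp hcone
    linarith
  · have hsing : F = {e} := by
      refine Finset.eq_singleton_iff_unique_mem.mpr ⟨heF, fun f hf => ?_⟩
      obtain ⟨a, ha, hfa⟩ := hF.exists_mem_branch (u := u) ⟨e, he⟩ hf
      have : a = e := Finset.card_le_one.mp (by unfold degree at hdeg; omega) _ ha _ he
      rw [this, hbranch] at hfa
      exact Finset.mem_singleton.mp hfa
    refine ⟨1 / 4, by norm_num, fun σ hσ ξ => ?_⟩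
    -- A Dirichlet leaf starts with y = 0, w = 1, a boundary point of the cone with |w − iy| = 1;
    -- this gives the bound 1/4.
    have h0 : InCone 0 1 := by simp [InCone]
    obtain ⟨h1, h2⟩ := inCone_normEdgeChar (hL e) (hσ.1 e) (hσ.eLpNorm_le e) ξ h0
    simp only [mul_zero, mul_one, zero_add, sub_zero, norm_one] at h1 h2
    rw [hsing, normChar_singleton, normChar_singleton, ← hu, ← hw, hNu, hNw]
    exact ⟨h1, h2⟩

end MetricTree

namespace MetricTree

variable {m : ℕ} {G : MetricTree m} {F F' : Finset (Fin m)} {Ω τ : ℝ} {k p : Fin m}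
  {σ σ' : Fin m → ℝ → ℂ} {ε : Fin m → ℝ}

/-! ### Transition through a vertex -/

variable (G) in
/-- The edges coming into `v_p` other than `e_k`. -/
def siblings (k p : Fin m) : Finset (Fin m) :=
  ((G.edgesAt Finset.univ p.castSucc).erase p).erase k

variable (G) in
/-- The product of the Dirichlet characteristic functions of the parts coming into `v_p`. -/
noncomputable def siblingProd (k p : Fin m) (σ : Fin m → ℝ → ℂ) (ρ : ℂ) : ℂ :=
  ∏ f ∈ G.siblings k p, G.normChar σ (G.branch Finset.univ p.castSucc f) allDirichlet ρ

variable (G) in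
/-- The characteristic function of the parts coming into `v_p`, joined at this vertex. -/
noncomputable def siblingSum (k p : Fin m) (σ : Fin m → ℝ → ℂ) (ρ : ℂ) : ℂ :=
  ∑ f ∈ G.siblings k p,
    G.normChar σ (G.branch Finset.univ p.castSucc f) (neumannAt p.castSucc) ρ *
      ∏ g ∈ (G.siblings k p).erase f,
        G.normChar σ (G.branch Finset.univ p.castSucc g) allDirichlet ρ

lemma mem_siblings {f : Fin m} :
    f ∈ G.siblings k p ↔ f ≠ k ∧ f ≠ p ∧ f ∈ G.edgesAt Finset.univ p.castSucc := by
  simp [siblings]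

lemma parent_of_mem_siblings {f : Fin m} (hf : f ∈ G.siblings k p) :
    G.parent f = p.castSucc := by
  obtain ⟨-, h1, h2⟩ := mem_siblings.mp hf
  exact (G.mem_edgesAt.mp h2).2.resolve_left fun h => h1 (Fin.castSucc_inj.mp h)

lemma mem_below_of_mem_branch {f g : Fin m} (hf : G.parent f = p.castSucc)
    (hg : g ∈ G.branch Finset.univ p.castSucc f) : g ∈ G.below p.castSucc := by
  have h1 := above_of_mem_branch hf hg
  have h2 := G.lt_parent f
  rw [hf] at h2
  exact mem_below.mpr ⟨(h1.le.trans_lt h2).ne, h1.trans (above_of_parent (hf ▸ .refl))⟩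

lemma edgesAt_leaf (hk : k.castSucc ∈ G.boundary Finset.univ) :
    G.edgesAt Finset.univ k.castSucc = {k} := by
  obtain ⟨a, ha⟩ := Finset.card_eq_one.mp (mem_boundary.mp hk)
  have : k ∈ G.edgesAt Finset.univ k.castSucc :=
    G.mem_edgesAt.mpr ⟨Finset.mem_univ _, .inl rfl⟩
  rw [ha, Finset.mem_singleton] at this
  rw [ha, this]

/-- The splitting at v_p with G_p singled out, and then e_k singled out among the other parts. The
condition at v_k is left free, so that one identity serves Δ and Δ_k. -/
theorem normChar_univ_eq (hk : k.castSucc ∈ G.boundary Finset.univ)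
    (hp : G.parent k = p.castSucc) {ρ : ℂ} (hρ : ρ ≠ 0) {bc : Fin (m + 1) → BoundaryCond}
    (hbc : ∀ v, v ≠ k.castSucc → bc v = .dirichlet) :
    G.normChar σ Finset.univ bc ρ =
      G.normChar σ (G.above p.castSucc) (neumannAt p.castSucc) ρ *
        (normEdgeChar (G.len k) (σ k) (bc k.castSucc) .dirichlet ρ * G.siblingProd k p σ ρ) +
      G.normChar σ (G.above p.castSucc) allDirichlet ρ *
        (normEdgeChar (G.len k) (σ k) (bc k.castSucc) .neumann ρ * G.siblingProd k p σ ρ +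
          normEdgeChar (G.len k) (σ k) (bc k.castSucc) .dirichlet ρ * G.siblingSum k p σ ρ) := by
  set u := p.castSucc with hu
  set w := k.castSucc with hw
  have hlt := G.lt_parent k
  rw [hp] at hlt
  have hwu : w ≠ u := hlt.ne
  have hkp : k ≠ p := fun h => hwu (by rw [hw, hu, h])
  have hleaf : G.edgesAt Finset.univ w = {k} := edgesAt_leaf hk
  have hpA : p ∈ G.edgesAt Finset.univ u := G.mem_edgesAt.mpr ⟨Finset.mem_univ _, .inl rfl⟩
  have hkA : k ∈ G.edgesAt Finset.univ u := G.mem_edgesAt.mpr ⟨Finset.mem_univ _, .inr hp⟩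
  have hkA' : k ∈ (G.edgesAt Finset.univ u).erase p := Finset.mem_erase.mpr ⟨hkp, hkA⟩
  have hdeg : 2 ≤ G.degree Finset.univ u := by
    rw [degree, ← Finset.card_erase_add_one hpA]
    have := Finset.card_pos.mpr ⟨k, hkA'⟩
    omega
  have hbranch : G.branch Finset.univ u k = {k} :=
    branch_eq_singleton (Finset.mem_univ k) (.inr ⟨rfl, hp⟩) hleaf
  have hnot : ∀ f ∈ G.edgesAt Finset.univ u, f ≠ k →
      w ∉ G.boundary (G.branch Finset.univ u f) := fun f hf hfk =>
    notMem_boundary_of_edgesAt branch_subset hleaf fun h => hfk (eq_of_mem_branch hf hkA h).symm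
  have cD : ∀ f ∈ G.edgesAt Finset.univ u, f ≠ k →
      G.normChar σ (G.branch Finset.univ u f) (Function.update bc u .dirichlet) ρ =
        G.normChar σ (G.branch Finset.univ u f) allDirichlet ρ := fun f hf hfk => by
    refine normChar_congr fun v hv => ?_
    by_cases hvu : v = u
    · rw [hvu, Function.update_self]; rfl
    · rw [Function.update_of_ne hvu, hbc v fun h => hnot f hf hfk (h ▸ hv)]; rfl
  have cN : ∀ f ∈ G.edgesAt Finset.univ u, f ≠ k →
      G.normChar σ (G.branch Finset.univ u f) (Function.update bc u .neumann) ρ =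
        G.normChar σ (G.branch Finset.univ u f) (neumannAt u) ρ := fun f hf hfk => by
    refine normChar_congr fun v hv => ?_
    by_cases hvu : v = u
    · rw [hvu, neumannAt, Function.update_self, Function.update_self]
    · rw [neumannAt, Function.update_of_ne hvu, Function.update_of_ne hvu,
        hbc v fun h => hnot f hf hfk (h ▸ hv)]; rfl
  have hsib : ∀ f ∈ G.siblings k p, f ∈ G.edgesAt Finset.univ u ∧ f ≠ k := fun f hf =>
    ⟨(mem_siblings.mp hf).2.2, (mem_siblings.mp hf).1⟩
  have hk1 : ∀ b : BoundaryCond,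
      G.normChar σ (G.branch Finset.univ u k) (Function.update bc u b) ρ =
        normEdgeChar (G.len k) (σ k) (bc w) b ρ := fun b => by
    rw [hbranch, normChar_singleton, hp, ← hw, Function.update_self,
      Function.update_of_ne hwu]
  have hS : ((G.edgesAt Finset.univ u).erase p).erase k = G.siblings k p := rfl
  have hprod : ∏ f ∈ (G.edgesAt Finset.univ u).erase p,
      G.normChar σ (G.branch Finset.univ u f) (Function.update bc u .dirichlet) ρ =
      normEdgeChar (G.len k) (σ k) (bc w) .dirichlet ρ * G.siblingProd k p σ ρ := by
    rw [← Finset.mul_prod_erase _ _ hkA', hk1, hS, siblingProd,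
      Finset.prod_congr rfl fun f hf => cD f (hsib f hf).1 (hsib f hf).2]
  have hsum : ∑ f ∈ (G.edgesAt Finset.univ u).erase p,
      G.normChar σ (G.branch Finset.univ u f) (Function.update bc u .neumann) ρ *
        ∏ g ∈ ((G.edgesAt Finset.univ u).erase p).erase f,
          G.normChar σ (G.branch Finset.univ u g) (Function.update bc u .dirichlet) ρ =
      normEdgeChar (G.len k) (σ k) (bc w) .neumann ρ * G.siblingProd k p σ ρ +
        normEdgeChar (G.len k) (σ k) (bc w) .dirichlet ρ * G.siblingSum k p σ ρ := by
    rw [← Finset.add_sum_erase _ _ hkA', hk1, hS, siblingProd, siblingSum, Finset.mul_sum,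
      Finset.prod_congr rfl fun f hf => cD f (hsib f hf).1 (hsib f hf).2]
    congr 1
    refine Finset.sum_congr rfl fun f hf => ?_
    have hkf : k ∈ ((G.edgesAt Finset.univ u).erase p).erase f :=
      Finset.mem_erase.mpr ⟨(hsib f hf).2.symm, hkA'⟩
    rw [← Finset.mul_prod_erase _ _ hkf, hk1, cN f (hsib f hf).1 (hsib f hf).2,
      Finset.erase_right_comm, hS, Finset.prod_congr rfl fun g hg =>
        cD g (hsib g (Finset.mem_of_mem_erase hg)).1 (hsib g (Finset.mem_of_mem_erase hg)).2]
    ring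
  rw [(connected_univ k).normChar_split_at hdeg hρ hpA, cN p hpA hkp.symm, cD p hpA hkp.symm,
    hprod, hsum, branch_univ_eq_above]

/-- The relations for Δ and Δ_k form a linear system for Δ_p^N P + Δ_p^D Q and Δ_p^D P whose
coefficients are the four edge functions of e_k; its determinant is the Wronskian, equal to 1. -/
theorem normChar_above_mul (hk : k.castSucc ∈ G.boundary Finset.univ)
    (hp : G.parent k = p.castSucc)
    (hσ : MemLp (σ k) 2 (volume.restrict (Ioo 0 (G.len k)))) {ρ : ℂ} (hρ : ρ ≠ 0) :
    G.normChar σ (G.above p.castSucc) allDirichlet ρ * G.siblingProd k p σ ρ =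
      normEdgeChar (G.len k) (σ k) .neumann .dirichlet ρ *
          G.normChar σ Finset.univ allDirichlet ρ -
        normEdgeChar (G.len k) (σ k) .dirichlet .dirichlet ρ *
          G.normChar σ Finset.univ (neumannAt k.castSucc) ρ ∧
    G.normChar σ (G.above p.castSucc) (neumannAt p.castSucc) ρ * G.siblingProd k p σ ρ =
      normEdgeChar (G.len k) (σ k) .dirichlet .neumann ρ *
          G.normChar σ Finset.univ (neumannAt k.castSucc) ρ -
        normEdgeChar (G.len k) (σ k) .neumann .neumann ρ *
          G.normChar σ Finset.univ allDirichlet ρ -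
        G.normChar σ (G.above p.castSucc) allDirichlet ρ * G.siblingSum k p σ ρ := by
  have hW := normEdgeChar_wronskian (G.len_pos k).le hσ hρ
  have hD := normChar_univ_eq (σ := σ) hk hp hρ (bc := allDirichlet) fun v _ => rfl
  have hN := normChar_univ_eq (σ := σ) hk hp hρ (bc := neumannAt k.castSucc) fun v hv => by
    rw [neumannAt, Function.update_of_ne hv]; rfl
  have e1 : (allDirichlet : Fin (m + 1) → BoundaryCond) k.castSucc = .dirichlet := rfl
  have e2 : (neumannAt k.castSucc : Fin (m + 1) → BoundaryCond) k.castSucc = .neumann :=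
    Function.update_self ..
  rw [e1] at hD
  rw [e2] at hN
  rw [hD, hN]
  constructor
  · linear_combination -(G.normChar σ (G.above p.castSucc) allDirichlet ρ *
      G.siblingProd k p σ ρ) * hW
  · linear_combination -(G.normChar σ (G.above p.castSucc) (neumannAt p.castSucc) ρ *
      G.siblingProd k p σ ρ + G.normChar σ (G.above p.castSucc) allDirichlet ρ *
        G.siblingSum k p σ ρ) * hW

/-! ### Estimates for differences -/

variable (G) in
/-- Functions of `ξ` depending on two potentials, with `L₂`-norms dominated by `N` on the ball of
radius `Ω`. -/
def Dominated (Ω : ℝ) (N : (Fin m → ℝ → ℂ) → (Fin m → ℝ → ℂ) → ℝ≥0∞)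
    (A : (Fin m → ℝ → ℂ) → (Fin m → ℝ → ℂ) → ℝ → ℂ) : Prop :=
  ∃ C : ℝ≥0, ∀ σ σ', G.InBall Ω σ → G.InBall Ω σ' →
    Continuous (A σ σ') ∧ eLpNorm (A σ σ') 2 volume ≤ C * N σ σ'

variable {N : (Fin m → ℝ → ℂ) → (Fin m → ℝ → ℂ) → ℝ≥0∞}
  {A A' : (Fin m → ℝ → ℂ) → (Fin m → ℝ → ℂ) → ℝ → ℂ} {B : (Fin m → ℝ → ℂ) → ℝ → ℂ}

lemma Dominated.add (hA : G.Dominated Ω N A) (hA' : G.Dominated Ω N A') :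
    G.Dominated Ω N fun σ σ' ξ => A σ σ' ξ + A' σ σ' ξ := by
  obtain ⟨C, hC⟩ := hA
  obtain ⟨D, hD⟩ := hA'
  refine ⟨C + D, fun σ σ' hσ hσ' => ?_⟩
  obtain ⟨a1, a2⟩ := hC σ σ' hσ hσ'
  obtain ⟨b1, b2⟩ := hD σ σ' hσ hσ'
  refine ⟨a1.add b1, ?_⟩
  rw [ENNReal.coe_add, add_mul]
  exact (eLpNorm_add_le a1.aestronglyMeasurable b1.aestronglyMeasurable (by norm_num)).trans
    (add_le_add a2 b2)

lemma Dominated.mul_left (hB : G.Stable Ω F B) (hA : G.Dominated Ω N A) :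
    G.Dominated Ω N fun σ σ' ξ => B σ ξ * A σ σ' ξ := by
  obtain ⟨C, hC⟩ := hA
  obtain ⟨D, hD⟩ := hB
  refine ⟨D * C, fun σ σ' hσ hσ' => ?_⟩
  obtain ⟨a1, a2⟩ := hC σ σ' hσ hσ'
  obtain ⟨b1, b2, -⟩ := hD σ hσ
  refine ⟨b1.mul a1, (eLpNorm_bdd_mul_le b2).trans ?_⟩
  rw [ENNReal.coe_mul, mul_assoc]
  gcongr

lemma Dominated.mul_left' (hB : G.Stable Ω F B) (hA : G.Dominated Ω N A) :
    G.Dominated Ω N fun σ σ' ξ => B σ' ξ * A σ σ' ξ := by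
  obtain ⟨C, hC⟩ := hA
  obtain ⟨D, hD⟩ := hB
  refine ⟨D * C, fun σ σ' hσ hσ' => ?_⟩
  obtain ⟨a1, a2⟩ := hC σ σ' hσ hσ'
  obtain ⟨b1, b2, -⟩ := hD σ' hσ'
  refine ⟨b1.mul a1, (eLpNorm_bdd_mul_le b2).trans ?_⟩
  rw [ENNReal.coe_mul, mul_assoc]
  gcongr

lemma Dominated.neg (hA : G.Dominated Ω N A) : G.Dominated Ω N fun σ σ' ξ => -A σ σ' ξ := by
  obtain ⟨C, hC⟩ := hA
  refine ⟨C, fun σ σ' hσ hσ' => ⟨(hC σ σ' hσ hσ').1.neg, ?_⟩⟩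
  change eLpNorm (-A σ σ') 2 volume ≤ _
  rw [eLpNorm_neg]
  exact (hC σ σ' hσ hσ').2

lemma Stable.dominated (hB : G.Stable Ω F B)
    (hN : ∀ σ σ', G.l2Norm F (fun j x => σ j x - σ' j x) ≤ N σ σ') :
    G.Dominated Ω N fun σ σ' ξ => B σ ξ - B σ' ξ := by
  obtain ⟨D, hD⟩ := hB
  refine ⟨D, fun σ σ' hσ hσ' => ⟨(hD σ hσ).1.sub (hD σ' hσ').1, ?_⟩⟩
  exact ((hD σ hσ).2.2 σ' hσ').trans (by gcongr; exact hN σ σ')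

lemma dominated_of_mul {P : (Fin m → ℝ → ℂ) → ℝ → ℂ} {δ : ℝ} (hδ : 0 < δ)
    (hP : ∀ σ, G.InBall Ω σ → ∀ ξ, δ ≤ ‖P σ ξ‖)
    (hc : ∀ σ σ', G.InBall Ω σ → G.InBall Ω σ' → Continuous (A σ σ'))
    (hA : G.Dominated Ω N A')
    (h : ∀ σ σ', G.InBall Ω σ → G.InBall Ω σ' → ∀ ξ, P σ ξ * A σ σ' ξ = A' σ σ' ξ) :
    G.Dominated Ω N A := by
  obtain ⟨C, hC⟩ := hA
  refine ⟨(δ⁻¹).toNNReal * C, fun σ σ' hσ hσ' => ⟨hc σ σ' hσ hσ', ?_⟩⟩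
  have hle : ∀ ξ, ‖A σ σ' ξ‖₊ ≤ (δ⁻¹).toNNReal * ‖A' σ σ' ξ‖₊ := fun ξ => by
    rw [← NNReal.coe_le_coe, NNReal.coe_mul, coe_nnnorm, coe_nnnorm,
      Real.coe_toNNReal _ (inv_pos.mpr hδ).le, ← h σ σ' hσ hσ' ξ, norm_mul,
      inv_mul_eq_div, le_div_iff₀ hδ, mul_comm]
    exact mul_le_mul_of_nonneg_right (hP σ hσ ξ) (norm_nonneg _)
  have h1 := eLpNorm_le_nnreal_smul_eLpNorm_of_ae_le_mul (μ := volume) (ae_of_all _ hle) 2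
  rw [ENNReal.smul_def, smul_eq_mul] at h1
  rw [ENNReal.coe_mul, mul_assoc]
  exact h1.trans (by gcongr; exact (hC σ σ' hσ hσ').2)

lemma branch_subset_below {f : Fin m} (hf : f ∈ G.siblings k p) :
    G.branch Finset.univ p.castSucc f ⊆ G.below p.castSucc := fun _ hg =>
  mem_below_of_mem_branch (parent_of_mem_siblings hf) hg

lemma stable_siblings (hL : ∀ j, IsLargeHeight (G.len j) Ω τ (ε j)) :
    G.Stable Ω (G.below p.castSucc) (fun σ ξ => G.siblingProd k p σ (linePt τ ξ)) ∧
      G.Stable Ω (G.below p.castSucc) (fun σ ξ => G.siblingSum k p σ (linePt τ ξ)) := by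
  have h : ∀ f ∈ G.siblings k p, ∀ bc, G.Stable Ω (G.below p.castSucc) fun σ ξ =>
      G.normChar σ (G.branch Finset.univ p.castSucc f) bc (linePt τ ξ) := fun f hf bc =>
    ((connected_branch (Finset.mem_univ f)).stable_normChar hL bc).mono (branch_subset_below hf)
  exact ⟨Stable.prod _ fun f hf => h f hf _, Stable.sum _ fun f hf =>
    (h f hf _).mul (Stable.prod _ fun g hg => h g (Finset.mem_of_mem_erase hg) _)⟩

lemma exists_le_norm_siblingProd (hL : ∀ j, IsLargeHeight (G.len j) Ω τ (ε j)) :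
    ∃ δ : ℝ, 0 < δ ∧ ∀ σ, G.InBall Ω σ → ∀ ξ, δ ≤ ‖G.siblingProd k p σ (linePt τ ξ)‖ := by
  have h : ∀ f ∈ G.siblings k p, ∃ δ : ℝ, 0 < δ ∧ ∀ σ, G.InBall Ω σ → ∀ ξ,
      δ ≤ ‖G.normChar σ (G.branch Finset.univ p.castSucc f) allDirichlet (linePt τ ξ)‖ := by
    intro f hf
    obtain ⟨δ, h0, h1⟩ := exists_le_norm_normChar hL _ f (connected_branch (Finset.mem_univ f))
      (mem_branch_self (Finset.mem_univ f))
      fun g hg => above_of_mem_branch (parent_of_mem_siblings hf) hg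
    exact ⟨δ, h0, fun σ hσ ξ => (h1 σ hσ ξ).2⟩
  choose! δ h0 h1 using h
  refine ⟨∏ f ∈ G.siblings k p, δ f, Finset.prod_pos h0, fun σ hσ ξ => ?_⟩
  rw [siblingProd, norm_prod]
  exact Finset.prod_le_prod (fun f hf => (h0 f hf).le) fun f hf => h1 f hf σ hσ ξ

variable (G) in
/-- The norms of the differences of the data on the line `Im ρ = τ`. -/
noncomputable def lineDist (τ : ℝ) (k p : Fin m) (σ σ' : Fin m → ℝ → ℂ) : ℝ≥0∞ :=
  G.l2Norm (G.below p.castSucc) (fun j x => σ j x - σ' j x) +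
    (eLpNorm (fun ξ => G.normChar σ Finset.univ allDirichlet (linePt τ ξ) -
        G.normChar σ' Finset.univ allDirichlet (linePt τ ξ)) 2 volume +
      eLpNorm (fun ξ => G.normChar σ Finset.univ (neumannAt k.castSucc) (linePt τ ξ) -
        G.normChar σ' Finset.univ (neumannAt k.castSucc) (linePt τ ξ)) 2 volume)

/-- The identities of `normChar_above_mul` for the two potentials are subtracted, every product
difference being written as ab − a'b' = a(b − b') + b'(a − a'). On the left P X − P'X' leaves P(X −
X'), where P is bounded below, and X'(P − P'), which is moved to the right. Each remaining
difference belongs to g_p or to the data. The second identity contains Δ_p^D, so the Dirichlet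
estimate comes first. -/
theorem dominated_above (hL : ∀ j, IsLargeHeight (G.len j) Ω τ (ε j))
    (hk : k.castSucc ∈ G.boundary Finset.univ) (hp : G.parent k = p.castSucc) :
    G.Dominated Ω (G.lineDist τ k p) (fun σ σ' ξ =>
      G.normChar σ (G.above p.castSucc) allDirichlet (linePt τ ξ) -
        G.normChar σ' (G.above p.castSucc) allDirichlet (linePt τ ξ)) ∧
    G.Dominated Ω (G.lineDist τ k p) (fun σ σ' ξ =>
      G.normChar σ (G.above p.castSucc) (neumannAt p.castSucc) (linePt τ ξ) -
        G.normChar σ' (G.above p.castSucc) (neumannAt p.castSucc) (linePt τ ξ)) := by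
  have hne : ∀ ξ, linePt τ ξ ≠ 0 := linePt_ne_zero (hL k).pos
  have hkb : {k} ⊆ G.below p.castSucc := by
    rw [Finset.singleton_subset_iff]
    exact mem_below_of_mem_branch hp (mem_branch_self (Finset.mem_univ k))
  have hconn : G.Connected (G.above p.castSucc) :=
    branch_univ_eq_above (G := G) p ▸ connected_branch (Finset.mem_univ p)
  have sX := hconn.stable_normChar hL allDirichlet
  have sY := hconn.stable_normChar hL (neumannAt p.castSucc)
  have sD := (connected_univ (G := G) k).stable_normChar hL allDirichlet
  have sK := (connected_univ (G := G) k).stable_normChar hL (neumannAt k.castSucc)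
  have sE := fun b b' => (stable_normEdgeChar hL k b b').mono hkb
  obtain ⟨sP, sS⟩ := stable_siblings (k := k) (p := p) hL
  have hbelow : ∀ σ σ', G.l2Norm (G.below p.castSucc) (fun j x => σ j x - σ' j x) ≤
      G.lineDist τ k p σ σ' := fun σ σ' => le_self_add
  have dE := fun b b' => (sE b b').dominated hbelow
  have dP := sP.dominated hbelow
  have dS := sS.dominated hbelow
  have dD : G.Dominated Ω (G.lineDist τ k p) fun σ σ' ξ =>
      G.normChar σ Finset.univ allDirichlet (linePt τ ξ) -
        G.normChar σ' Finset.univ allDirichlet (linePt τ ξ) := by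
    obtain ⟨C, hC⟩ := sD
    refine ⟨1, fun σ σ' hσ hσ' => ⟨(hC σ hσ).1.sub (hC σ' hσ').1, ?_⟩⟩
    rw [ENNReal.coe_one, one_mul]
    exact le_self_add.trans le_add_self
  have dK : G.Dominated Ω (G.lineDist τ k p) fun σ σ' ξ =>
      G.normChar σ Finset.univ (neumannAt k.castSucc) (linePt τ ξ) -
        G.normChar σ' Finset.univ (neumannAt k.castSucc) (linePt τ ξ) := by
    obtain ⟨C, hC⟩ := sK
    refine ⟨1, fun σ σ' hσ hσ' => ⟨(hC σ hσ).1.sub (hC σ' hσ').1, ?_⟩⟩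
    rw [ENNReal.coe_one, one_mul]
    exact le_add_self.trans le_add_self
  obtain ⟨δ, hδ0, hδ⟩ := exists_le_norm_siblingProd (k := k) (p := p) hL
  have dX : G.Dominated Ω (G.lineDist τ k p) (fun σ σ' ξ =>
      G.normChar σ (G.above p.castSucc) allDirichlet (linePt τ ξ) -
        G.normChar σ' (G.above p.castSucc) allDirichlet (linePt τ ξ)) := by
    refine dominated_of_mul hδ0 hδ (fun σ σ' hσ hσ' => ?_)
      ((((dD.mul_left (sE .neumann .dirichlet)).add
        ((dE .neumann .dirichlet).mul_left' sD)).add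
        ((dK.mul_left (sE .dirichlet .dirichlet)).add
        ((dE .dirichlet .dirichlet).mul_left' sK)).neg).add (dP.mul_left' sX).neg)
      fun σ σ' hσ hσ' ξ => ?_
    · obtain ⟨C, hC⟩ := sX
      exact (hC σ hσ).1.sub (hC σ' hσ').1
    · have h1 := (normChar_above_mul hk hp (hσ.1 k) (hne ξ)).1
      have h2 := (normChar_above_mul hk hp (hσ'.1 k) (hne ξ)).1
      linear_combination h1 - h2
  refine ⟨dX, ?_⟩
  refine dominated_of_mul hδ0 hδ (fun σ σ' hσ hσ' => ?_)
    (((((dK.mul_left (sE .dirichlet .neumann)).add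
      ((dE .dirichlet .neumann).mul_left' sK)).add
      ((dD.mul_left (sE .neumann .neumann)).add
      ((dE .neumann .neumann).mul_left' sD)).neg).add
      ((dX.mul_left sS).add (dS.mul_left' sX)).neg).add (dP.mul_left' sY).neg)
    fun σ σ' hσ hσ' ξ => ?_
  · obtain ⟨C, hC⟩ := sY
    exact (hC σ hσ).1.sub (hC σ' hσ').1
  · have h1 := (normChar_above_mul hk hp (hσ.1 k) (hne ξ)).2
    have h2 := (normChar_above_mul hk hp (hσ'.1 k) (hne ξ)).2
    linear_combination h1 - h2

end MetricTree

namespace MetricTree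

variable {m : ℕ} {G : MetricTree m} {F : Finset (Fin m)} {Ω τ : ℝ} {k p : Fin m}
  {σ σ' : Fin m → ℝ → ℂ} {bc : Fin (m + 1) → BoundaryCond} {v : Fin (m + 1)} {ε : Fin m → ℝ}

/-! ### Passage to the real line -/

lemma expo_allDirichlet : G.expo F allDirichlet = ((G.boundary F).card : ℤ) - 1 := by
  simp [expo, allDirichlet, BoundaryCond.order]

lemma expo_neumannAt (hv : v ∈ G.boundary F) :
    G.expo F (neumannAt v) = ((G.boundary F).card : ℤ) - 2 := by
  have h : ∀ w ∈ (G.boundary F).erase v, (1 - (neumannAt v w).order : ℤ) = 1 := fun w hw => by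
    rw [neumannAt, Function.update_of_ne (Finset.ne_of_mem_erase hw)]; rfl
  have h0 : (1 - (neumannAt v v).order : ℤ) = 0 := by
    rw [neumannAt, Function.update_self]; rfl
  rw [expo, ← Finset.add_sum_erase _ _ hv, Finset.sum_congr rfl h, h0, Finset.sum_const,
    Finset.card_erase_of_mem hv, nsmul_one, Nat.cast_sub (Finset.card_pos.mpr ⟨v, hv⟩)]
  ring

lemma last_mem_boundary {r : Fin m} (hr : (r : ℕ) + 1 = m) (hrF : r ∈ F) :
    Fin.last m ∈ G.boundary F := by
  rw [mem_boundary, Finset.card_eq_one]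
  refine ⟨r, Finset.eq_singleton_iff_unique_mem.mpr ⟨G.mem_edgesAt.mpr ⟨hrF, .inr ?_⟩,
    fun e he => ?_⟩⟩
  · have := Fin.lt_def.mp (G.lt_parent r)
    rw [Fin.val_castSucc] at this
    exact Fin.ext (by have := (G.parent r).isLt; rw [Fin.val_last]; omega)
  · rcases (G.mem_edgesAt.mp he).2 with h | h
    · exact absurd h (Fin.castSucc_lt_last e).ne
    · have := G.root_edge e h
      exact Fin.ext (by omega)

/-- With at least two boundary vertices the exponents b − 1 and b − 2 are non-negative, so the
normalized functions are entire, without a pole at ρ = 0. -/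
lemma two_le_card_boundary {r : Fin m} (hr : (r : ℕ) + 1 = m) (hrF : r ∈ F)
    (hk : k.castSucc ∈ G.boundary F) : 2 ≤ (G.boundary F).card :=
  Finset.one_lt_card.mpr ⟨_, hk, _, last_mem_boundary hr hrF, (Fin.castSucc_lt_last k).ne⟩

lemma mem_above_of_last {r : Fin m} (hr : (r : ℕ) + 1 = m) : r ∈ G.above p.castSucc := by
  rw [above, Finset.mem_compl]
  intro h
  obtain ⟨h1, h2⟩ := mem_below.mp h
  have h3 := Fin.le_def.mp (h2.parent_of_ne h1).le
  have h4 := Fin.lt_def.mp (G.lt_parent r)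
  have h5 := p.isLt
  rw [Fin.val_castSucc] at h3 h4
  omega

lemma mem_boundary_above : p.castSucc ∈ G.boundary (G.above p.castSucc) := by
  rw [← branch_univ_eq_above]
  exact mem_boundary_branch (G.mem_edgesAt.mpr ⟨Finset.mem_univ _, .inl rfl⟩)

lemma connected_above : G.Connected (G.above p.castSucc) :=
  branch_univ_eq_above (G := G) p ▸ connected_branch (Finset.mem_univ p)

variable (G) in
/-- A bound for the exponential types of the normalized characteristic functions. -/
def expTypeBound : ℝ := 1 + ∑ e, (2 * G.len e + 1)

lemma expTypeBound_nonneg : 0 ≤ G.expTypeBound :=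
  add_nonneg zero_le_one (Finset.sum_nonneg fun e _ => by have := G.len_pos e; linarith)

lemma hasExpType_normChar (hσ : ∀ j, MemLp (σ j) 2 (volume.restrict (Ioo 0 (G.len j))))
    (h : 0 ≤ G.expo F bc) : HasExpType G.expTypeBound (G.normChar σ F bc) := by
  have h1 : HasExpType (∑ e ∈ F, (2 * G.len e + 1))
      fun ρ => G.charSum (G.edgeValue σ (ρ ^ 2)) F bc :=
    HasExpType.sum _ (Finset.sum_nonneg fun e _ => by have := G.len_pos e; linarith)
      fun c _ => HasExpType.prod F fun e _ =>
        hasExpType_edgeCharFun (G.len_pos e).le (hσ e) _ _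
  have h2 : G.normChar σ F bc =
      fun ρ => ρ ^ (G.expo F bc).toNat * G.charSum (G.edgeValue σ (ρ ^ 2)) F bc := by
    funext ρ
    rw [normChar, ← zpow_natCast ρ (G.expo F bc).toNat, Int.toNat_of_nonneg h]
  rw [h2]
  refine ((HasExpType.pow _).mul h1).mono (add_le_add le_rfl ?_)
  exact Finset.sum_le_sum_of_subset_of_nonneg (Finset.subset_univ F) fun e _ _ => by
    have := G.len_pos e; linarith

lemma Connected.rhoFun_sub_eq (hF : G.Connected F) {n : ℤ} (hn : n = G.expo F bc) :
    rhoFun n (fun lam => G.charFun σ F bc lam - G.charFun σ' F bc lam) =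
      fun x : ℝ => G.normChar σ F bc x - G.normChar σ' F bc x := by
  funext x
  rw [rhoFun, hF.charFun_eq, hF.charFun_eq, normChar, normChar, hn, mul_sub]

/-- The differences of the characteristic functions on the real line and on `Im ρ = τ`. -/
lemma Connected.eLpNorm_rhoFun (hF : G.Connected F) (h : 0 ≤ G.expo F bc)
    {n : ℤ} (hn : n = G.expo F bc) (hτ : 0 ≤ τ)
    (hσ : ∀ j, MemLp (σ j) 2 (volume.restrict (Ioo 0 (G.len j))))
    (hσ' : ∀ j, MemLp (σ' j) 2 (volume.restrict (Ioo 0 (G.len j)))) :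
    Continuous (rhoFun n fun lam => G.charFun σ F bc lam - G.charFun σ' F bc lam) ∧
    eLpNorm (rhoFun n fun lam => G.charFun σ F bc lam - G.charFun σ' F bc lam) 2 volume ≤
      ENNReal.ofReal (Real.exp (G.expTypeBound * τ)) *
        eLpNorm (fun ξ => G.normChar σ F bc (linePt τ ξ) - G.normChar σ' F bc (linePt τ ξ))
          2 volume ∧
    eLpNorm (fun ξ => G.normChar σ F bc (linePt τ ξ) - G.normChar σ' F bc (linePt τ ξ))
        2 volume ≤ ENNReal.ofReal (Real.exp (G.expTypeBound * τ)) *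
      eLpNorm (rhoFun n fun lam => G.charFun σ F bc lam - G.charFun σ' F bc lam) 2 volume := by
  have hE := (hasExpType_normChar hσ h).sub (hasExpType_normChar hσ' h)
  rw [hF.rhoFun_sub_eq hn]
  exact ⟨hE.1.continuous.comp Complex.continuous_ofReal,
    hE.eLpNorm_le_shift expTypeBound_nonneg hτ, hE.eLpNorm_shift_le expTypeBound_nonneg hτ⟩

lemma l2Norm_sub_ne_top (hσ : ∀ j, MemLp (σ j) 2 (volume.restrict (Ioo 0 (G.len j))))
    (hσ' : ∀ j, MemLp (σ' j) 2 (volume.restrict (Ioo 0 (G.len j)))) :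
    G.l2Norm F (fun j x => σ j x - σ' j x) ≠ ∞ := by
  refine ENNReal.rpow_ne_top_of_nonneg (by norm_num) (ENNReal.sum_ne_top.mpr fun j _ => ?_)
  exact ENNReal.pow_ne_top ((hσ j).sub (hσ' j)).eLpNorm_ne_top

/-- On Im ρ = τ the norm is finite by stability, as the potentials differ by an element of L₂; the
Plancherel-Pólya inequality carries this to the real axis. -/
lemma Connected.memLp_rhoFun (hF : G.Connected F) (h : 0 ≤ G.expo F bc)
    {n : ℤ} (hn : n = G.expo F bc) (hL : ∀ j, IsLargeHeight (G.len j) Ω τ (ε j)) (hτ : 0 ≤ τ)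
    (hσ : G.InBall Ω σ) (hσ' : G.InBall Ω σ') :
    MemLp (rhoFun n fun lam => G.charFun σ F bc lam - G.charFun σ' F bc lam) 2 volume := by
  obtain ⟨hc, hle, -⟩ := hF.eLpNorm_rhoFun h hn hτ hσ.1 hσ'.1
  obtain ⟨C, hC⟩ := hF.stable_normChar hL bc
  refine ⟨hc.aestronglyMeasurable, hle.trans_lt (ENNReal.mul_lt_top ENNReal.ofReal_lt_top ?_)⟩
  exact ((hC σ hσ).2.2 σ' hσ').trans_lt (ENNReal.mul_lt_top ENNReal.coe_lt_top
    (l2Norm_sub_ne_top hσ.1 hσ'.1).lt_top)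

lemma exists_isLargeHeight (G : MetricTree m) (hΩ : 0 ≤ Ω) :
    ∃ τ, ∀ j, IsLargeHeight (G.len j) Ω τ (1 / (64 * (2 + Ω * √(G.len j)))) :=
  (Filter.eventually_all.mpr fun j => eventually_isLargeHeight (G.len_pos j) hΩ).exists

end MetricTree

/-! ### Conclusion: assembling the estimate on the real axis. -/

theorem mainTheorem3 {m : ℕ} (G : MetricTree m) (k p : Fin m)
    (hk : k.castSucc ∈ G.boundary Finset.univ) (hp : G.parent k = p.castSucc)
    (Ω : ℝ) (hΩ : 0 < Ω) :
    ∃ C : ℝ≥0, ∀ σ σ' : Fin m → ℝ → ℂ, G.InBall Ω σ → G.InBall Ω σ' →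
      MemLp (G.diffDelta σ σ') 2 volume ∧
      MemLp (G.diffDeltaNeumann k.castSucc σ σ') 2 volume ∧
      MemLp (G.diffDeltaAboveD p.castSucc σ σ') 2 volume ∧
      MemLp (G.diffDeltaAboveN p.castSucc σ σ') 2 volume ∧
      eLpNorm (G.diffDeltaAboveD p.castSucc σ σ') 2 volume +
          eLpNorm (G.diffDeltaAboveN p.castSucc σ σ') 2 volume ≤
        C * (G.l2Norm (G.below p.castSucc) (fun j x => σ j x - σ' j x) +
          G.dataDist k.castSucc σ σ') := by
  -- The height depends only on Ω and the edge lengths, hence so do all constants below, up to their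
  -- dependence on k.
  obtain ⟨τ, hL⟩ := G.exists_isLargeHeight hΩ.le
  have hτ : 0 ≤ τ := (hL k).pos.le
  obtain ⟨r, hr⟩ : ∃ r : Fin m, (r : ℕ) + 1 = m :=
    ⟨⟨m - 1, by have := k.isLt; omega⟩, by have := k.isLt; simp only; omega⟩
  have hU := MetricTree.connected_univ (G := G) k
  have hA := MetricTree.connected_above (G := G) (p := p)
  have hpA := MetricTree.mem_boundary_above (G := G) (p := p)
  have cU := MetricTree.two_le_card_boundary hr (Finset.mem_univ r) hk
  have cA := MetricTree.two_le_card_boundary hr (MetricTree.mem_above_of_last hr) hpA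
  have e1 := MetricTree.expo_allDirichlet (G := G) (F := Finset.univ)
  have e2 := MetricTree.expo_neumannAt hk
  have e3 := MetricTree.expo_allDirichlet (G := G) (F := G.above p.castSucc)
  have e4 := MetricTree.expo_neumannAt hpA
  obtain ⟨⟨C₁, h₁⟩, ⟨C₂, h₂⟩⟩ := MetricTree.dominated_above hL hk hp
  -- The price of one passage between the real axis and the line Im ρ = τ. It is paid twice: the
  -- data are carried up to the line and the result is carried back.
  set M : ℝ≥0 := (Real.exp (G.expTypeBound * τ)).toNNReal with hM
  have hM1 : (1 : ℝ≥0∞) ≤ M := by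
    rw [hM, ENNReal.one_le_coe_iff, Real.one_le_toNNReal]
    exact Real.one_le_exp (mul_nonneg MetricTree.expTypeBound_nonneg hτ)
  refine ⟨M * (C₁ + C₂) * M, fun σ σ' hσ hσ' => ⟨?_, ?_, ?_, ?_, ?_⟩⟩
  · exact hU.memLp_rhoFun (by omega) e1.symm hL hτ hσ hσ'
  · exact hU.memLp_rhoFun (by omega) e2.symm hL hτ hσ hσ'
  · exact hA.memLp_rhoFun (by omega) e3.symm hL hτ hσ hσ'
  · exact hA.memLp_rhoFun (by omega) e4.symm hL hτ hσ hσ'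
  · have b1 := (hU.eLpNorm_rhoFun (by omega) e1.symm hτ hσ.1 hσ'.1).2.2
    have b2 := (hU.eLpNorm_rhoFun (by omega) e2.symm hτ hσ.1 hσ'.1).2.2
    have b3 := (hA.eLpNorm_rhoFun (by omega) e3.symm hτ hσ.1 hσ'.1).2.1
    have b4 := (hA.eLpNorm_rhoFun (by omega) e4.symm hτ hσ.1 hσ'.1).2.1
    have hline : G.lineDist τ k p σ σ' ≤
        M * (G.l2Norm (G.below p.castSucc) (fun j x => σ j x - σ' j x) +
          G.dataDist k.castSucc σ σ') := by
      rw [MetricTree.lineDist, MetricTree.dataDist, mul_add, mul_add]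
      exact add_le_add (le_mul_of_one_le_left' hM1) (add_le_add b1 b2)
    calc _ ≤ M * (C₁ * G.lineDist τ k p σ σ') + M * (C₂ * G.lineDist τ k p σ σ') :=
          add_le_add (b3.trans (mul_le_mul' le_rfl (h₁ σ σ' hσ hσ').2))
            (b4.trans (mul_le_mul' le_rfl (h₂ σ σ' hσ hσ').2))
      _ = M * (C₁ + C₂) * G.lineDist τ k p σ σ' := by ring
      _ ≤ M * (C₁ + C₂) * (M * _) := by gcongr
      _ = _ := by push_cast; ring
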